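/- Let $l\ge 1$ and let $\mathfrak g$ be a complex simple Lie algebra of type $A_l$, with a Cartan subalgebra and Chevalley generators fixed. Let $\alpha_1,\dots,\alpha_l$ be the simple roots and $\omega_1,\dots,\omega_l$ the fundamental weights, numbered along the Dynkin diagram, $\Lambda$ the weight lattice, $\Lambda^+$ the set of dominant weights, $W$ the Weyl group, and $w_0\in W$ its longest element, so that $w_0\omega_i=-\omega_{l+1-i}$. Let $\mathbb Z[\Lambda]$ be the group ring of $\Lambda$ with basis $e(\mu)$, $\mu\in\Lambda$, on which $W$ acts by $w\,e(\mu)=e(w\mu)$. For $\lambda\in\Lambda^+$ let $\Pi(\lambda)\subset\Lambda$ be the saturated set of weights with highest weight $\lambda$ (the smallest set that contains $\lambda$ and, with each $x$, contains $x-k\beta$ for every root $\beta$ and every integer $k$ between $0$ and $\langle x,\beta^\vee\rangle$). Let $V(\lambda)$ be the Weyl module over $\mathbb C$, i.e. the irreducible $\mathfrak g$-module of highest weight $\lambda$, let $m_\lambda(\mu)$ be the dimension of its $\mu$-weight space, and let $\mathrm{ch}_\lambda=\sum_{\mu}m_\lambda(\mu)e(\mu)$ be its formal character. Let $c_{\mu,\nu}^\lambda$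 be the Littlewood–Richardson coefficient, i.e. the multiplicity of $V(\lambda)$ in $V(\mu)\otimes V(\nu)$. Let $(f_\lambda)_{\lambda\in\Lambda^+}$ be a family of $W$-invariant elements $$f_\lambda=\sum_{x\in\Pi(\lambda)}n_\lambda(x)\,e(x)\in\mathbb Z[\Lambda]^W$$ with $n_\lambda(\lambda)=1$, and put $n_\lambda(x)=0$ for $x\notin\Pi(\lambda)$. The $f_\lambda$ then form a $\mathbb Z$-basis of $\mathbb Z[\Lambda]^W$; let $n_{\mu,\nu}^\lambda\in\mathbb Z$ be the structure constants defined by $f_\mu f_\nu=\sum_{\lambda\in\Lambda^+}n_{\mu,\nu}^\lambda f_\lambda$. Assume: 1. $n_\lambda(\mu)=m_\lambda(\mu)$ for all $\lambda,\mu\in\Lambda^+$ such that $\lambda-\mu=\sum_{i=1}^l k_i\alpha_i$ with integers $k_i$, fewer than $l$ of which are nonzero; 2. $n_{\mu,\nu}^\lambda=n_{\lambda,-w_0\nu}^\mu$ for all $\lambda,\mu,\nu\in\Lambda^+$. Then $f_\lambda=\mathrm{ch}_\lambda$ for all $\lambda\in\Lambda^+$, and $n_{\mu,\nu}^\lambda=c_{\mu,\nu}^\lambda$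 for all $\lambda,\mu,\nu\in\Lambda^+$. -/

import Mathlib

open scoped TensorProduct

noncomputable section

namespace TypeA

/-! ### Weights, Weyl group, saturated sets -/

/-- The weight lattice of type `A_l`, in the basis of fundamental weights: the `i`-th coordinate of
a weight is its value on the `i`-th simple coroot. -/
abbrev Weight (l : ℕ) : Type := Fin l → ℤ

/-- The `i`-th simple root, as a weight: `⟨α_i, α_j^∨⟩` is the `(i, j)` Cartan integer. -/
def simpleRoot {l : ℕ} (i : Fin l) : Weight l := fun j => CartanMatrix.A l i j

/-- `⟨λ, α_i^∨⟩`. -/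
def coroot {l : ℕ} (i : Fin l) : Weight l →ₗ[ℤ] ℤ := LinearMap.proj i

theorem coroot_simpleRoot {l : ℕ} (i : Fin l) : coroot i (simpleRoot i) = 2 := by
  simp [coroot, simpleRoot, CartanMatrix.A]

/-- The simple reflection `λ ↦ λ - ⟨λ, α_i^∨⟩ α_i`. -/
def simpleReflection {l : ℕ} (i : Fin l) : Weight l ≃ₗ[ℤ] Weight l :=
  Module.reflection (coroot_simpleRoot i)

/-- The Weyl group, acting on the weight lattice. -/
def weylGroup (l : ℕ) : Subgroup (Weight l ≃ₗ[ℤ] Weight l) :=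
  Subgroup.closure (Set.range simpleReflection)

/-- The longest element `w₀` of the Weyl group, given by `w₀ ω_i = -ω_{l+1-i}`. -/
def longest (l : ℕ) : Weight l ≃ₗ[ℤ] Weight l :=
  (LinearEquiv.neg ℤ).trans (LinearEquiv.funCongrLeft ℤ ℤ Fin.revPerm)

theorem longest_apply {l : ℕ} (x : Weight l) (i : Fin l) : longest l x i = -x i.rev := rfl

/-- `w₀` sends every simple root to the negative of a simple root, hence every positive root to a
negative root. -/
theorem longest_simpleRoot {l : ℕ} (i : Fin l) :
    longest l (simpleRoot i) = -simpleRoot i.rev := by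
  funext j
  have hi := i.isLt
  have hj := j.isLt
  simp only [longest_apply, simpleRoot, Pi.neg_apply, CartanMatrix.A, Matrix.of_apply,
    Fin.ext_iff, Fin.val_rev]
  congr 1
  split_ifs <;> omega

theorem longest_mem_weylGroup (l : ℕ) : longest l ∈ weylGroup l := by
  let D : (Fin (l + 1) → ℤ) → Weight l := fun x i => x i.castSucc - x i.succ
  have key : ∀ w : Equiv.Perm (Fin (l + 1)), ∃ g ∈ weylGroup l, ∀ x, D (x ∘ w) = g (D x) := by
    intro w
    have hw : w ∈ Submonoid.closure
        (Set.range fun i : Fin l => Equiv.swap i.castSucc i.succ) := by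
      rw [Equiv.Perm.mclosure_swap_castSucc_succ]; trivial
    induction hw using Submonoid.closure_induction with
    | mem w hw =>
      obtain ⟨i, rfl⟩ := hw
      refine ⟨simpleReflection i, Subgroup.subset_closure ⟨i, rfl⟩, fun x => ?_⟩
      funext j
      simp only [D, simpleReflection, Module.reflection_apply, coroot, simpleRoot,
        CartanMatrix.A, Matrix.of_apply, LinearMap.proj_apply, Pi.sub_apply, Pi.smul_apply,
        smul_eq_mul, Function.comp_apply, Equiv.swap_apply_def, Fin.ext_iff, Fin.val_castSucc,
        Fin.val_succ]
      have e1 : i.val + 1 = j.val → i.succ = j.castSucc := fun h => Fin.ext h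
      have e2 : j.val + 1 = i.val → j.succ = i.castSucc := fun h => Fin.ext h
      have e3 : i.val = j.val → i = j := fun h => Fin.ext h
      grind
    | one => exact ⟨1, one_mem _, fun x => rfl⟩
    | mul a b _ _ ha hb =>
      obtain ⟨g, hg, hg'⟩ := ha
      obtain ⟨h, hh, hh'⟩ := hb
      exact ⟨h * g, mul_mem hh hg, fun x => by
        rw [Equiv.Perm.coe_mul, ← Function.comp_assoc, hh', hg']; rfl⟩
  obtain ⟨g, hg, h⟩ := key Fin.revPerm
  convert hg
  ext1 y
  let x : Fin (l + 1) → ℤ := fun k => -∑ m : Fin l, if m.val < k.val then y m else 0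
  have hx : D x = y := by
    funext i
    have h1 : ∀ m : Fin l, (if m.val < i.val + 1 then y m else 0) =
        (if m.val < i.val then y m else 0) + if m = i then y m else 0 := by
      intro m
      have := Fin.ext_iff (a := m) (b := i)
      grind
    simp only [D, x, Fin.val_castSucc, Fin.val_succ, h1, Finset.sum_add_distrib]
    simp
  rw [← hx, ← h x]
  funext i
  have h2 : i.rev.succ = i.castSucc.rev := by ext; simp; omega
  have h3 : i.rev.castSucc = i.succ.rev := by ext; simp
  simp [D, longest_apply, h2, h3]

/-- Dominant weights. -/
def DominantWeight (l : ℕ) : Type := {x : Weight l // ∀ i, 0 ≤ x i}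

/-- The dominant weight `-w₀ ν`. -/
def DominantWeight.dual {l : ℕ} (ν : DominantWeight l) : DominantWeight l :=
  ⟨-longest l ν.1, fun i => by simpa [longest_apply] using ν.2 i.rev⟩

/-- A set of weights is saturated if with `x` it contains `x - k β` for every root `β` and every
integer `k` between `0` and `⟨x, β^∨⟩`. Every root is `β = w α_i` with `w` in the Weyl group, and
then `⟨x, β^∨⟩ = ⟨w⁻¹ x, α_i^∨⟩`. -/
def IsSaturated {l : ℕ} (S : Set (Weight l)) : Prop :=
  ∀ x ∈ S, ∀ w ∈ weylGroup l, ∀ (i : Fin l) (k : ℤ),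
    k ∈ Set.uIcc 0 (coroot i (w⁻¹ x)) → x - k • w (simpleRoot i) ∈ S

/-- `Π(λ)`: the saturated set with highest weight `λ`, i.e. the smallest saturated set that
contains `λ`. -/
def saturatedWeights {l : ℕ} (x : DominantWeight l) : Set (Weight l) :=
  ⋂₀ {S | IsSaturated S ∧ x.1 ∈ S}

/-! ### The group ring of the weight lattice -/

/-- `ℤ[Λ]`, with basis the formal exponentials `e(μ)`. -/
abbrev GroupRing (l : ℕ) : Type := AddMonoidAlgebra ℤ (Weight l)

/-- Membership in `ℤ[Λ]^W`, where `w e(μ) = e(w μ)`. -/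
def IsWeylInvariant {l : ℕ} (f : GroupRing l) : Prop :=
  ∀ w ∈ weylGroup l, AddMonoidAlgebra.mapDomain w f = f

/-- The structure constants of a family `f_λ` indexed by the dominant weights: `structConst f μ ν`
is the (finitely supported) family of integers `n^λ_{μ,ν}` with
`f_μ * f_ν = ∑_λ n^λ_{μ,ν} f_λ`. -/
def structConst {l : ℕ} (f : DominantWeight l → GroupRing l) (μ ν : DominantWeight l) :
    DominantWeight l →₀ ℤ :=
  Classical.epsilon fun c => f μ * f ν = c.sum fun x a => a • f x

/-! ### Weyl modules -/

section WeylModule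

variable {l : ℕ} {g : Type*} [LieRing g] [LieAlgebra ℂ g] {H : LieSubalgebra ℂ g}
  (b : LieAlgebra.Basis (Fin l) H)

/-- The left ideal of `U(g)` generated by the `e_i` and the `h_i - ⟨x, α_i^∨⟩`; the quotient of
`U(g)` by it is the Verma module of highest weight `x`. -/
def vermaIdeal (x : Weight l) : Submodule (UniversalEnvelopingAlgebra ℂ g)
    (UniversalEnvelopingAlgebra ℂ g) :=
  Submodule.span _
    (Set.range (fun i => UniversalEnvelopingAlgebra.ι ℂ (b.e i)) ∪
      Set.range (fun i => UniversalEnvelopingAlgebra.ι ℂ (b.h i) -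
        algebraMap ℂ (UniversalEnvelopingAlgebra ℂ g) (x i : ℂ)))

/-- The sum of all proper left ideals containing `vermaIdeal b x`: it corresponds to the largest
proper submodule of the Verma module. -/
def maximalIdeal (x : Weight l) : Submodule (UniversalEnvelopingAlgebra ℂ g)
    (UniversalEnvelopingAlgebra ℂ g) :=
  sSup {J | vermaIdeal b x ≤ J ∧ J ≠ ⊤}

/-- The Weyl module `V(x)` over `ℂ`: the irreducible module of highest weight `x`, constructed as
the irreducible quotient of the Verma module. -/
def WeylModule (x : Weight l) : Type _ := UniversalEnvelopingAlgebra ℂ g ⧸ maximalIdeal b x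

instance WeylModule.addCommGroup (x : Weight l) : AddCommGroup (WeylModule b x) :=
  inferInstanceAs (AddCommGroup (UniversalEnvelopingAlgebra ℂ g ⧸ maximalIdeal b x))

instance WeylModule.moduleU (x : Weight l) : Module (UniversalEnvelopingAlgebra ℂ g) (WeylModule b x) :=
  inferInstanceAs (Module _ (UniversalEnvelopingAlgebra ℂ g ⧸ maximalIdeal b x))

instance WeylModule.module (x : Weight l) : Module ℂ (WeylModule b x) :=
  inferInstanceAs (Module ℂ (UniversalEnvelopingAlgebra ℂ g ⧸ maximalIdeal b x))

instance WeylModule.isScalarTower (x : Weight l) : IsScalarTower ℂ (UniversalEnvelopingAlgebra ℂ g) (WeylModule b x) :=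
  inferInstanceAs (IsScalarTower ℂ _ (UniversalEnvelopingAlgebra ℂ g ⧸ maximalIdeal b x))

instance WeylModule.lieRingModule (x : Weight l) : LieRingModule g (WeylModule b x) where
  bracket a m := UniversalEnvelopingAlgebra.ι ℂ a • m
  add_lie a a' m := by simp only [map_add, add_smul]
  lie_add a m m' := smul_add _ m m'
  leibniz_lie a a' m := by
    simp only [LieHom.map_lie, LieRing.of_associative_ring_bracket, sub_smul, mul_smul]
    abel

instance WeylModule.lieModule (x : Weight l) : LieModule ℂ g (WeylModule b x) where
  smul_lie t a m := by
    change UniversalEnvelopingAlgebra.ι ℂ (t • a) • m = t • UniversalEnvelopingAlgebra.ι ℂ a • m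
    rw [map_smul, smul_assoc]
  lie_smul t a m := by
    change UniversalEnvelopingAlgebra.ι ℂ a • t • m = t • UniversalEnvelopingAlgebra.ι ℂ a • m
    rw [smul_comm]

/-- The weight space of weight `μ` in a `g`-module `M`: the simultaneous eigenspace of the `h_i`,
which span the Cartan subalgebra. -/
def weightSpace (M : Type*) [AddCommGroup M] [Module ℂ M] [LieRingModule g M] [LieModule ℂ g M]
    (μ : Weight l) : Submodule ℂ M :=
  ⨅ i, Module.End.eigenspace (LieModule.toEnd ℂ g M (b.h i)) (μ i : ℂ)

/-- `m_x(μ)`: the multiplicity of the weight `μ` in `V(x)`. -/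
def weightMult (x : DominantWeight l) (μ : Weight l) : ℤ :=
  Module.finrank ℂ (weightSpace b (WeylModule b x.1) μ)

/-- `ch V(x) = ∑_μ m_x(μ) e(μ)`. -/
def formalCharacter (x : DominantWeight l) : GroupRing l :=
  ∑ᶠ μ : Weight l, AddMonoidAlgebra.single μ (weightMult b x μ)

/-- `c^x_{μ,ν}`: the multiplicity of the irreducible module `V(x)` in `V(μ) ⊗ V(ν)`, that is,
the dimension of `Hom_g(V(x), V(μ) ⊗ V(ν))`. -/
def littlewoodRichardson (μ ν x : DominantWeight l) : ℤ :=
  Module.finrank ℂ (WeylModule b x.1 →ₗ⁅ℂ, g⁆ WeylModule b μ.1 ⊗[ℂ] WeylModule b ν.1)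

end WeylModule

end TypeA

end

noncomputable section

namespace TypeA

/-! ### The root order on weights -/

/-! Both `f` and the family of characters are unitriangular for the root order (`IsTriangular`), and
both have structure constants with the symmetry of condition 2. The theorem is a uniqueness
statement for such families, `AgreeOnProperSupport.eq`, combined with the proof that characters form
one.

Uniqueness. The fundamental weights of type A are minuscule, so the two families agree there
(`IsTriangular.eq_fundamentalWeight`). It is then enough that multiplication by a fundamental
element has the same structure constants in both families: the product indexed by `y` and `ω` is the
element indexed by `y + ω` plus terms of smaller height, which gives an induction on height. To
compare these constants, grade weights by the coefficient of the first simple root (`firstDegree`).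
By condition 1 and Weyl invariance the coefficients of `f x` and of the character agree at weights
with the first degree of `x`, so the constants of the product of `x` and `ω` agree at every `y` with
the first degree of `x + ω` (`structConst_eq_of_firstDegree_eq`). If a constant is nonzero, `y ≤ x +
ω` and, by symmetry, `x ≤ y + ω*`, where `ω* = -w₀ ω`. The first degrees of `ω` and `ω*` add up to
exactly that of one simple root, so the first simple root occurs in just one of the two differences,
and once. The other difference avoids it, and there the constants are already known to agree
(`AgreeOnProperSupport.structConst_eq`).

Characters. Weyl modules must be shown to be finite dimensional, tensor products of them completely
reducible, and their duals Weyl modules. All this rests on unitary modules (`IsUnitary`), closed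
under submodules and tensor products and semisimple by orthogonal complements. The exterior algebra
of `ℂ^(l+1)` supplies the fundamental highest weights and tensor products supply the others
(`exists_unitary`). Its operators are extended from the generators to `g` by showing that the graph
of the would-be representation projects isomorphically onto `g` (`IsUnitaryRep.exists_lieHom`). The
symmetry of the structure constants is then tensor-hom adjunction
(`hasSymmetricStructConst_formalCharacter`). -/

theorem simpleRoot_apply {l : ℕ} (i j : Fin l) :
    simpleRoot i j = if i = j then 2
      else if i.val + 1 = j.val ∨ j.val + 1 = i.val then -1 else 0 := rfl

theorem simpleRoot_symm {l : ℕ} (i j : Fin l) : simpleRoot i j = simpleRoot j i := by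
  simp only [simpleRoot_apply, eq_comm (a := i), or_comm]

/-- Pairing of a simple root with a sequence vanishing at both ends of the Dynkin diagram. -/
theorem sum_simpleRoot_mul {l : ℕ} (c : ℕ → ℤ) (h0 : c 0 = 0) (hl : c (l + 1) = 0) (i : Fin l) :
    ∑ j : Fin l, simpleRoot i j * c (j + 1) = 2 * c (i + 1) - c i - c (i + 2) := by
  have h : ∀ j : Fin l, simpleRoot i j * c (j + 1) = (if j.val = i.val then 2 * c (j + 1) else 0)
      - (if j.val + 1 = i.val then c (j + 1) else 0)
      - (if j.val = i.val + 1 then c (j + 1) else 0) := by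
    intro j
    rw [simpleRoot_apply]
    have := Fin.ext_iff (a := i) (b := j)
    split_ifs <;> omega
  have hi := i.isLt
  simp only [h, Finset.sum_sub_distrib]
  rw [Fin.sum_univ_eq_sum_range (fun j => if j = i.val then 2 * c (j + 1) else 0),
    Fin.sum_univ_eq_sum_range (fun j => if j + 1 = i.val then c (j + 1) else 0),
    Fin.sum_univ_eq_sum_range (fun j => if j = i.val + 1 then c (j + 1) else 0)]
  have h1 : ∑ j ∈ Finset.range l, (if j + 1 = i.val then c (j + 1) else 0) = c i := by
    rcases Nat.eq_zero_or_pos i.val with hz | hz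
    · rw [hz, h0]
      exact Finset.sum_eq_zero fun j _ => by simp
    · rw [Finset.sum_eq_single (i.val - 1)]
      · rw [if_pos (by omega)]; congr 1; omega
      · intro j _ hj; rw [if_neg (by omega)]
      · intro hj; simp at hj; omega
  have h2 : ∑ j ∈ Finset.range l, (if j = i.val + 1 then c (j + 1) else 0) = c (i + 2) := by
    rw [Finset.sum_ite_eq']
    split_ifs with hj
    · rfl
    · have : i.val + 2 = l + 1 := by simp at hj; omega
      rw [this, hl]
  rw [h1, h2, Finset.sum_ite_eq', if_pos (by simp)]

/-- The linear form on weights with the given values on the fundamental weights. -/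
def weightForm {l : ℕ} (c : ℕ → ℤ) : Weight l →ₗ[ℤ] ℤ :=
  ∑ j : Fin l, c (j + 1) • coroot j

theorem weightForm_apply {l : ℕ} (c : ℕ → ℤ) (x : Weight l) :
    weightForm c x = ∑ j : Fin l, x j * c (j + 1) := by
  simp [weightForm, coroot, mul_comm]

theorem weightForm_simpleRoot {l : ℕ} (c : ℕ → ℤ) (h0 : c 0 = 0) (hl : c (l + 1) = 0)
    (i : Fin l) : weightForm c (simpleRoot i) = 2 * c (i + 1) - c i - c (i + 2) := by
  rw [weightForm_apply, sum_simpleRoot_mul c h0 hl]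

/-- Twice the pairing with the half-sum of the positive coroots. -/
def height {l : ℕ} : Weight l →ₗ[ℤ] ℤ := weightForm fun m => m * (l + 1 - m)

/-- The pairing with `l + 1` times the first fundamental coweight. -/
def firstDegree {l : ℕ} : Weight l →ₗ[ℤ] ℤ :=
  -- The value at `0` does not enter the form but is the boundary condition of
  -- `weightForm_simpleRoot`. Away from `0` the sequence is affine and vanishes at `l + 1`, so only
  -- the first simple root has nonzero degree.
  weightForm fun m => if m = 0 then 0 else l + 1 - m

theorem height_simpleRoot {l : ℕ} (i : Fin l) : height (simpleRoot i) = 2 := by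
  rw [height, weightForm_simpleRoot _ (by simp) (by push_cast; ring)]
  push_cast
  ring

theorem firstDegree_simpleRoot {l : ℕ} (i : Fin l) :
    firstDegree (simpleRoot i) = if i.val = 0 then (l : ℤ) + 1 else 0 := by
  rw [firstDegree, weightForm_simpleRoot _ (by simp) (by simp)]
  split_ifs <;> first | omega | (push_cast; simp_all)

theorem height_nonneg {l : ℕ} (x : DominantWeight l) : 0 ≤ height x.1 := by
  rw [height, weightForm_apply]
  refine Finset.sum_nonneg fun j _ => mul_nonneg (x.2 j) ?_
  have := j.isLt
  push_cast
  exact mul_nonneg (by omega) (by omega)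

theorem coord_le_height {l : ℕ} (x : DominantWeight l) (i : Fin l) : x.1 i ≤ height x.1 := by
  rw [height, weightForm_apply]
  have hc : ∀ j : Fin l, (1 : ℤ) ≤ ((j + 1 : ℕ) : ℤ) * (l + 1 - (j + 1 : ℕ)) := by
    intro j
    have := j.isLt
    push_cast
    nlinarith [show (1 : ℤ) ≤ l - j by omega, show (0 : ℤ) ≤ (j : ℤ) by omega]
  refine le_trans ?_ (Finset.single_le_sum (f := fun j : Fin l =>
    x.1 j * (((j + 1 : ℕ) : ℤ) * (l + 1 - (j + 1 : ℕ)))) ?_ (Finset.mem_univ i))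
  · nlinarith [hc i, x.2 i]
  · intro j _
    have := hc j
    exact mul_nonneg (x.2 j) (by omega)

/-- The root order: `RootLE μ x` means that `x - μ` is a sum of simple roots. -/
def RootLE {l : ℕ} (μ x : Weight l) : Prop :=
  ∃ k : Fin l → ℕ, x = μ + ∑ i, k i • simpleRoot i

namespace RootLE

variable {l : ℕ} {x y z x' y' : Weight l}

theorem refl (x : Weight l) : RootLE x x := ⟨0, by simp⟩

theorem trans (h : RootLE x y) (h' : RootLE y z) : RootLE x z := by
  obtain ⟨k, rfl⟩ := h
  obtain ⟨k', rfl⟩ := h'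
  exact ⟨k + k', by simp [add_smul, Finset.sum_add_distrib, add_assoc]⟩

theorem add (h : RootLE x y) (h' : RootLE x' y') : RootLE (x + x') (y + y') := by
  obtain ⟨k, rfl⟩ := h
  obtain ⟨k', rfl⟩ := h'
  refine ⟨k + k', ?_⟩
  simp only [Pi.add_apply, add_smul, Finset.sum_add_distrib]
  abel

theorem sub_simpleRoot (h : RootLE x y) (i : Fin l) : RootLE (x - simpleRoot i) y := by
  refine trans ⟨Pi.single i 1, ?_⟩ h
  rw [Finset.sum_eq_single i] <;> simp +contextual

theorem height_eq {k : Fin l → ℕ} (h : x = y + ∑ i, k i • simpleRoot i) :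
    height x = height y + 2 * ∑ i, (k i : ℤ) := by
  subst h
  simp only [map_add, map_sum, map_nsmul, height_simpleRoot, Finset.mul_sum]
  simp [mul_comm]

theorem height_le (h : RootLE x y) : height x ≤ height y := by
  obtain ⟨k, hk⟩ := h
  rw [height_eq hk]
  have : 0 ≤ ∑ i, (k i : ℤ) := Finset.sum_nonneg fun i _ => by positivity
  linarith

/-- Each simple root raises the height by `2`, so no root can be added without raising it. -/
theorem eq_of_height_le (h : RootLE x y) (h' : height y ≤ height x) : x = y := by
  obtain ⟨k, hk⟩ := h
  have h1 := height_eq hk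
  have h2 : ∑ i, (k i : ℤ) = 0 := by
    have : 0 ≤ ∑ i, (k i : ℤ) := Finset.sum_nonneg fun i _ => by positivity
    linarith
  have h3 : ∀ i, k i = 0 := by
    intro i
    have := (Finset.sum_eq_zero_iff_of_nonneg (fun i _ => by positivity)).mp h2 i
      (Finset.mem_univ i)
    exact_mod_cast this
  rw [hk]
  simp [h3]

theorem height_lt (h : RootLE x y) (hne : x ≠ y) : height x < height y :=
  lt_of_le_of_ne h.height_le fun he => hne (h.eq_of_height_le he.ge)

theorem antisymm (h : RootLE x y) (h' : RootLE y x) : x = y :=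
  h.eq_of_height_le h'.height_le

/-- The rank is `l + 1` here, so that the coefficient `k 0` of the first simple root makes sense;
the difference of first degrees counts it. -/
theorem firstDegree_eq {k : Fin (l + 1) → ℕ} {x y : Weight (l + 1)}
    (h : x = y + ∑ i, k i • simpleRoot i) :
    firstDegree x = firstDegree y + (l + 2) * k 0 := by
  subst h
  simp only [map_add, map_sum, map_nsmul, firstDegree_simpleRoot]
  rw [Fin.sum_univ_succ]
  simp
  ring

theorem firstDegree_le (h : RootLE x y) : firstDegree x ≤ firstDegree y := by
  obtain ⟨k, rfl⟩ := h
  simp only [map_add, map_sum, map_nsmul, firstDegree_simpleRoot]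
  have : 0 ≤ ∑ i : Fin l, k i • (if i.val = 0 then (l : ℤ) + 1 else 0) :=
    Finset.sum_nonneg fun i _ => by positivity
  linarith

/-- `RootLE` is reversed by negation. -/
theorem neg (h : RootLE x y) : RootLE (-y) (-x) := by
  obtain ⟨k, rfl⟩ := h
  exact ⟨k, by abel⟩

theorem longest (h : RootLE x y) : RootLE (longest l y) (longest l x) := by
  obtain ⟨k, rfl⟩ := h
  refine ⟨fun i => k i.rev, ?_⟩
  rw [map_add, map_sum, add_assoc, left_eq_add, ← Equiv.sum_comp Fin.revPerm]
  simp only [map_nsmul, longest_simpleRoot, Fin.revPerm_apply, Fin.rev_rev,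
    ← Finset.sum_add_distrib, smul_neg, neg_add_cancel, Finset.sum_const_zero]

end RootLE

/-- A weight with a single positive coordinate, equal to at most one, is minimal among dominant
weights. -/
theorem eq_of_rootLE_minuscule {l : ℕ} {μ : DominantWeight l} {x : Weight l} (i : Fin l)
    (hi : x i ≤ 1) (hx : ∀ j, j ≠ i → x j ≤ 0) (h : RootLE μ.1 x) : μ.1 = x := by
  obtain ⟨k, hk⟩ := h
  -- The coefficients are extended by zero beyond both ends of the diagram, so that the coordinates
  -- of `x - μ` become second differences of `c`.
  let c : ℕ → ℤ := fun m => if h : 0 < m ∧ m ≤ l then (k ⟨m - 1, by omega⟩ : ℤ) else 0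
  have hc : ∀ j : Fin l, c (j + 1) = k j := fun j => by
    have := j.isLt
    simp [c]
  have h0 : c 0 = 0 := by simp [c]
  have hl : c (l + 1) = 0 := by simp [c]
  have hcoord : ∀ j : Fin l, x j = μ.1 j + (2 * c (j + 1) - c j - c (j + 2)) := by
    intro j
    rw [← sum_simpleRoot_mul c h0 hl j, hk]
    simp only [Pi.add_apply, Finset.sum_apply, Pi.smul_apply, hc]
    congr 1
    exact Finset.sum_congr rfl fun m _ => by rw [simpleRoot_symm, nsmul_eq_mul, mul_comm]
  by_contra hne
  have hpos : ∃ j, 0 < k j := by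
    by_contra! hcon
    apply hne
    rw [hk]
    simp [fun j => Nat.le_zero.mp (hcon j)]
  obtain ⟨j₀, hj₀⟩ := hpos
  have hmax : ∃ j, ∀ m, k m ≤ k j := by
    have : Nonempty (Fin l) := ⟨j₀⟩
    exact Finite.exists_max k
  obtain ⟨M, hM⟩ := hmax
  have hcM : ∀ m, c m ≤ k M := by
    intro m
    simp only [c]
    split_ifs
    · exact_mod_cast hM _
    · positivity
  have hMpos : 0 < k M := lt_of_lt_of_le hj₀ (hM j₀)
  -- the maximum is attained only at `i`
  have key : ∀ j : Fin l, k j = k M → c j < k M ∨ c (j + 2) < k M → j = i := by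
    intro j hj hlt
    by_contra hji
    have h1 := hcoord j
    have h2 := μ.2 j
    have h3 := hx j hji
    have h4 := hcM j
    have h5 := hcM (j + 2)
    rw [hc, hj] at h1
    omega
  -- Walking left from a maximum, a drop must occur before `c 0 = 0`, and by `key` a drop occurs
  -- only at `i`. Hence every maximum lies at or to the right of `i`.
  have hfirst : ∀ n : ℕ, n ≤ l → c n = k M → i.val + 1 ≤ n := by
    intro n
    induction n with
    | zero => intro _ h; rw [h0] at h; omega
    | succ n ih =>
      intro hn h
      by_cases hlt : c n < k M
      · have := key ⟨n, by omega⟩ (by have := hc ⟨n, by omega⟩; simp at this; omega) (Or.inl hlt)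
        rw [← this]
      · have := ih (by omega) (le_antisymm (hcM n) (by omega))
        omega
  -- The mirror argument, with positions counted from the right end.
  have hlast : ∀ n : ℕ, n < l → c (l - n) = k M → l - n ≤ i.val + 1 := by
    intro n
    induction n with
    | zero =>
      intro hn h
      have h1 : k ⟨l - 1, by omega⟩ = k M := by
        have := hc ⟨l - 1, by omega⟩
        simp only [show l - 1 + 1 = l by omega] at this
        simp only [Nat.sub_zero] at h
        omega
      have := key ⟨l - 1, by omega⟩ h1 (Or.inr (by
        simp only [show l - 1 + 2 = l + 1 by omega, hl]; omega))
      rw [← this]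
      simp only
      omega
    | succ n ih =>
      intro hn h
      by_cases hlt : c (l - n) < k M
      · have h1 : k ⟨l - (n + 1) - 1, by omega⟩ = k M := by
          have := hc ⟨l - (n + 1) - 1, by omega⟩
          simp only [show l - (n + 1) - 1 + 1 = l - (n + 1) by omega] at this
          omega
        have := key ⟨l - (n + 1) - 1, by omega⟩ h1 (Or.inr (by
          simp only [show l - (n + 1) - 1 + 2 = l - n by omega]; omega))
        rw [← this]
        simp only
        omega
      · have := ih (by omega) (le_antisymm (hcM _) (by omega))
        omega
  have hil := i.isLt
  have hMi : M = i := by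
    have hM' : c (M + 1) = k M := hc M
    have h1 := hfirst (M + 1) (by omega) hM'
    have h2 := hlast (l - (M + 1)) (by omega) (by
      rw [show l - (l - (M.val + 1)) = M + 1 by omega]; exact hM')
    ext
    omega
  subst hMi
  have h1 : c M < k M := by
    refine lt_of_le_of_ne (hcM _) fun h => ?_
    have := hfirst M (by omega) h
    omega
  have h2 : c (M + 2) < k M := by
    refine lt_of_le_of_ne (hcM _) fun h => ?_
    rcases Nat.lt_or_ge l (M + 2) with h3 | h3
    · rw [show M.val + 2 = l + 1 by omega, hl] at h
      omega
    · have := hlast (l - (M + 2)) (by omega) (by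
        rw [show l - (l - (M.val + 2)) = M + 2 by omega]; exact h)
      omega
  -- At a strict peak the second difference is at least `2`, whereas `x i - μ i ≤ 1`.
  have h3 := hcoord M
  have h4 := μ.2 M
  rw [hc] at h3
  omega

/-! ### Simple reflections and the Weyl group -/

theorem simpleReflection_apply {l : ℕ} (i : Fin l) (x : Weight l) :
    simpleReflection i x = x - x i • simpleRoot i := rfl

theorem simpleReflection_mem {l : ℕ} (i : Fin l) : simpleReflection i ∈ weylGroup l :=
  Subgroup.subset_closure ⟨i, rfl⟩

theorem simpleReflection_simpleReflection {l : ℕ} (i : Fin l) (x : Weight l) :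
    simpleReflection i (simpleReflection i x) = x :=
  Module.involutive_reflection (coroot_simpleRoot i) x

/-- A property of weights preserved by simple reflections is preserved by the Weyl group. -/
theorem weylGroup_induction {l : ℕ} {P : Weight l → Prop}
    (h : ∀ i x, P x → P (simpleReflection i x)) {w : Weight l ≃ₗ[ℤ] Weight l}
    (hw : w ∈ weylGroup l) (x : Weight l) : P (w x) ↔ P x := by
  have h' : ∀ i x, P (simpleReflection i x) ↔ P x := fun i x =>
    ⟨fun hx => by simpa [simpleReflection_simpleReflection] using h i _ hx, h i x⟩
  induction hw using Subgroup.closure_induction generalizing x with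
  | mem w hw => obtain ⟨i, rfl⟩ := hw; exact h' i x
  | one => rfl
  | mul a b _ _ ha hb => exact (ha (b x)).trans (hb x)
  | inv a _ ha =>
    refine (ha (a⁻¹ x)).symm.trans (iff_of_eq (congrArg P ?_))
    exact LinearEquiv.apply_symm_apply a x

/-! ### Weyl-invariant elements of the group ring and triangular families -/

namespace IsWeylInvariant

variable {l : ℕ} {g g' : GroupRing l}

theorem coeff_simpleReflection (hg : IsWeylInvariant g) (i : Fin l) (x : Weight l) :
    g.coeff (simpleReflection i x) = g.coeff x := by
  conv_lhs => rw [← hg _ (simpleReflection_mem i)]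
  exact Finsupp.mapDomain_apply (simpleReflection i).injective _ _

theorem of_coeff (h : ∀ i x, g.coeff (simpleReflection i x) = g.coeff x) : IsWeylInvariant g := by
  intro w hw
  ext x
  have h1 : g.coeff (w (w⁻¹ x)) = g.coeff (w⁻¹ x) :=
    (weylGroup_induction (P := fun y => g.coeff y = g.coeff (w⁻¹ x))
      (fun i y hy => (h i y).trans hy) hw (w⁻¹ x)).mpr rfl
  have h2 : w (w⁻¹ x) = x := LinearEquiv.apply_symm_apply w x
  have h3 : (AddMonoidAlgebra.mapDomain w g).coeff (w (w⁻¹ x)) = g.coeff (w⁻¹ x) :=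
    Finsupp.mapDomain_apply w.injective _ _
  rw [h2] at h1 h3
  rw [h3, h1]

theorem sub (hg : IsWeylInvariant g) (hg' : IsWeylInvariant g') : IsWeylInvariant (g - g') :=
  of_coeff fun i x => by
    simp [hg.coeff_simpleReflection, hg'.coeff_simpleReflection]

theorem sum {ι : Type*} {s : Finset ι} {a : ι → ℤ} {f : ι → GroupRing l}
    (hf : ∀ i, IsWeylInvariant (f i)) : IsWeylInvariant (∑ i ∈ s, a i • f i) :=
  of_coeff fun i x => by
    simp only [AddMonoidAlgebra.coeff_sum, AddMonoidAlgebra.coeff_smul, Finsupp.finsetSum_apply,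
      Finsupp.smul_apply, (hf _).coeff_simpleReflection]

theorem mul (hg : IsWeylInvariant g) (hg' : IsWeylInvariant g') : IsWeylInvariant (g * g') := by
  intro w hw
  rw [AddMonoidAlgebra.mapDomain_mul, hg w hw, hg' w hw]

/-- A weight of maximal height in the support of an invariant element is dominant. -/
theorem nonneg_of_maximal (hg : IsWeylInvariant g) {x : Weight l} (hx : g.coeff x ≠ 0)
    (hmax : ∀ y, g.coeff y ≠ 0 → height y ≤ height x) (i : Fin l) : 0 ≤ x i := by
  by_contra! hi
  have h := hmax (simpleReflection i x) (by rwa [hg.coeff_simpleReflection])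
  rw [simpleReflection_apply, map_sub, map_smul, height_simpleRoot, smul_eq_mul] at h
  linarith

theorem exists_maximal (hne : g ≠ 0) :
    ∃ x, g.coeff x ≠ 0 ∧ ∀ y, g.coeff y ≠ 0 → height y ≤ height x := by
  have hs : g.coeff.support.Nonempty := by
    rw [Finsupp.support_nonempty_iff]
    simpa using hne
  obtain ⟨x, hx, hmax⟩ := Finset.exists_max_image g.coeff.support height hs
  exact ⟨x, by simpa using hx, fun y hy => hmax y (by simpa using hy)⟩

/-- A nonzero invariant element has a support weight of maximal height, which is dominant. Invariant
elements are therefore determined by their dominant coefficients. -/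
theorem eq_zero (hg : IsWeylInvariant g) (h : ∀ x : DominantWeight l, g.coeff x.1 = 0) :
    g = 0 := by
  by_contra hne
  obtain ⟨x, hx, hmax⟩ := exists_maximal hne
  exact hx (h ⟨x, hg.nonneg_of_maximal hx hmax⟩)

theorem eq_of_coeff_eq (hg : IsWeylInvariant g) (hg' : IsWeylInvariant g')
    (h : ∀ x : DominantWeight l, g.coeff x.1 = g'.coeff x.1) : g = g' :=
  sub_eq_zero.mp <| (hg.sub hg').eq_zero fun x => by simp [h x]

end IsWeylInvariant

/-- A family of invariant elements that is unitriangular with respect to the root order. -/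
structure IsTriangular {l : ℕ} (f : DominantWeight l → GroupRing l) : Prop where
  invariant : ∀ x, IsWeylInvariant (f x)
  top : ∀ x, (f x).coeff x.1 = 1
  support : ∀ x μ, (f x).coeff μ ≠ 0 → RootLE μ x.1

theorem coeff_finsuppSum {l : ℕ} (f : DominantWeight l → GroupRing l) (c : DominantWeight l →₀ ℤ)
    (μ : Weight l) : (c.sum fun x a => a • f x).coeff μ = c.sum fun x a => a * (f x).coeff μ := by
  simp only [Finsupp.sum, AddMonoidAlgebra.coeff_sum, AddMonoidAlgebra.coeff_smul,
    Finsupp.finsetSum_apply, Finsupp.smul_apply, smul_eq_mul]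

theorem exists_add_eq_of_coeff_mul_ne_zero {l : ℕ} {g g' : GroupRing l} {x : Weight l}
    (h : (g * g').coeff x ≠ 0) : ∃ a b, g.coeff a ≠ 0 ∧ g'.coeff b ≠ 0 ∧ a + b = x := by
  classical
  have := AddMonoidAlgebra.support_coeff_mul_subset g g' (Finsupp.mem_support_iff.mpr h)
  obtain ⟨a, ha, b, hb, rfl⟩ := Finset.mem_add.mp this
  exact ⟨a, b, by simpa using ha, by simpa using hb, rfl⟩

namespace IsTriangular

variable {l : ℕ} {f φ : DominantWeight l → GroupRing l}

/-- Subtracting the combination of the `f x` that matches the dominant part of height `n` lowers the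
height bound. Dominant weights have nonnegative height, so at bound `0` nothing is left. The bound
by `y` survives because each `f x` is supported below `x`. -/
theorem exists_expansion_of_height_lt (hf : IsTriangular f) (y : Weight l) (n : ℕ)
    (g : GroupRing l) (hg : IsWeylInvariant g) (hn : ∀ x, g.coeff x ≠ 0 → height x < n)
    (hy : ∀ x, g.coeff x ≠ 0 → RootLE x y) :
    ∃ c : DominantWeight l →₀ ℤ, (g = c.sum fun x a => a • f x) ∧
      ∀ x, c x ≠ 0 → RootLE x.1 y := by
  classical
  induction n generalizing g with
  | zero =>
    refine ⟨0, ?_, by simp⟩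
    rw [Finsupp.sum_zero_index]
    refine hg.eq_zero fun x => ?_
    by_contra hx
    have := hn _ hx
    have := height_nonneg x
    omega
  | succ n ih =>
    let T : Finset (DominantWeight l) := 
      g.coeff.support.subtype fun x : Weight l => ∀ i, 0 ≤ x i
    have hT : ∀ x : DominantWeight l, x ∈ T ↔ g.coeff x.1 ≠ 0 := by
      intro x
      exact Finset.mem_subtype.trans Finsupp.mem_support_iff
    let c₀ : DominantWeight l →₀ ℤ := Finsupp.onFinset (T.filter fun x => height x.1 = n)
      (fun x => if height x.1 = n then g.coeff x.1 else 0) (by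
        intro x hx
        rw [Finset.mem_filter, hT]
        split_ifs at hx with h
        · exact ⟨hx, h⟩
        · exact absurd rfl hx)
    have hc₀ : ∀ x, c₀ x = if height x.1 = n then g.coeff x.1 else 0 := fun x => rfl
    have hc₀' : ∀ x, c₀ x ≠ 0 → height x.1 = n ∧ g.coeff x.1 ≠ 0 := by
      intro x hx
      rw [hc₀] at hx
      split_ifs at hx with h
      · exact ⟨h, hx⟩
      · exact absurd rfl hx
    let g' := g - c₀.sum fun x a => a • f x
    have hg' : IsWeylInvariant g' := hg.sub (IsWeylInvariant.sum hf.invariant)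
    have hcoeff : ∀ x, g'.coeff x = g.coeff x - c₀.sum fun z a => a * (f z).coeff x := by
      intro x
      simp only [g', AddMonoidAlgebra.coeff_sub, Finsupp.sub_apply, coeff_finsuppSum]
    have hsupp : ∀ x, g'.coeff x ≠ 0 → g.coeff x ≠ 0 ∨
        ∃ z, c₀ z ≠ 0 ∧ (f z).coeff x ≠ 0 := by
      intro x hx
      by_contra! hcon
      apply hx
      rw [hcoeff, hcon.1, Finsupp.sum, Finset.sum_eq_zero, sub_zero]
      intro z hz
      rw [hcon.2 z (by simpa using hz), mul_zero]
    have hy' : ∀ x, g'.coeff x ≠ 0 → RootLE x y := by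
      intro x hx
      rcases hsupp x hx with h | ⟨z, hz, h⟩
      · exact hy x h
      · exact (hf.support z x h).trans (hy _ (hc₀' z hz).2)
    have hle : ∀ x, g'.coeff x ≠ 0 → height x ≤ n := by
      intro x hx
      rcases hsupp x hx with h | ⟨z, hz, h⟩
      · have := hn x h
        push_cast at this
        omega
      · have := (hf.support z x h).height_le
        rw [(hc₀' z hz).1] at this
        exact this
    have hlt : ∀ x, g'.coeff x ≠ 0 → height x < n := by
      intro x hx
      -- A support weight of height `n` would be of maximal height, hence dominant; but at dominant
      -- weights of that height only the leading term of one `f z` contributes, and it cancels.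
      refine lt_of_le_of_ne (hle x hx) fun he => hx ?_
      have hdom := hg'.nonneg_of_maximal hx fun y hy => he ▸ hle y hy
      obtain ⟨z, rfl⟩ : ∃ z : DominantWeight l, z.1 = x := ⟨⟨x, hdom⟩, rfl⟩
      rw [hcoeff, Finsupp.sum, Finset.sum_eq_single z, hc₀, if_pos he, hf.top, mul_one, sub_self]
      · intro z' hz hne
        by_contra hcon
        have hz' := hc₀' z' (Finsupp.mem_support_iff.mp hz)
        have hle := hf.support z' z.1 (right_ne_zero_of_mul hcon)
        exact hne (Subtype.ext (hle.eq_of_height_le (by rw [hz'.1, he])).symm)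
      · intro h
        rw [Finsupp.notMem_support_iff.mp h, zero_mul]
    obtain ⟨c, hc, hcy⟩ := ih g' hg' hlt hy'
    refine ⟨c₀ + c, ?_, ?_⟩
    · rw [Finsupp.sum_add_index' (by simp) (by simp [add_smul]), ← hc]
      simp [g']
    · intro x hx
      by_cases h : c x = 0
      · rw [Finsupp.add_apply, h, add_zero] at hx
        exact hy _ (hc₀' x hx).2
      · exact hcy x h

theorem exists_expansion (hf : IsTriangular f) (y : Weight l) {g : GroupRing l}
    (hg : IsWeylInvariant g) (hy : ∀ x, g.coeff x ≠ 0 → RootLE x y) :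
    ∃ c : DominantWeight l →₀ ℤ, (g = c.sum fun x a => a • f x) ∧
      ∀ x, c x ≠ 0 → RootLE x.1 y :=
  hf.exists_expansion_of_height_lt y ((height y).toNat + 1) g hg (fun x hx => by
    have := (hy x hx).height_le
    push_cast
    omega) hy

theorem eq_zero_of_sum_eq_zero (hf : IsTriangular f) {c : DominantWeight l →₀ ℤ}
    (hc : (c.sum fun x a => a • f x) = 0) : c = 0 := by
  by_contra hne
  obtain ⟨x, hx, hmax⟩ := Finset.exists_max_image c.support (fun x => height x.1)
    (Finsupp.support_nonempty_iff.mpr hne)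
  have h := congrArg (fun g => g.coeff x.1) hc
  simp only [coeff_finsuppSum, AddMonoidAlgebra.coeff_zero, Finsupp.zero_apply] at h
  rw [Finsupp.sum, Finset.sum_eq_single x, hf.top, mul_one] at h
  · exact (Finsupp.mem_support_iff.mp hx) h
  · intro z hz hzx
    by_contra hcon
    have hle := hf.support z x.1 (right_ne_zero_of_mul hcon)
    exact hzx (Subtype.ext (hle.eq_of_height_le (hmax z hz)).symm)
  · exact fun h' => absurd hx h'

theorem expansion_unique (hf : IsTriangular f) {c c' : DominantWeight l →₀ ℤ}
    (h : (c.sum fun x a => a • f x) = c'.sum fun x a => a • f x) : c = c' := by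
  rw [← sub_eq_zero]
  apply hf.eq_zero_of_sum_eq_zero
  rw [Finsupp.sum_sub_index (by intros; rw [sub_smul]), h, sub_self]

/-- `Classical.epsilon` picks some expansion once one exists, and expansions are unique. -/
theorem structConst_eq (hf : IsTriangular f) {μ ν : DominantWeight l} {c : DominantWeight l →₀ ℤ}
    (hc : f μ * f ν = c.sum fun x a => a • f x) : structConst f μ ν = c :=
  hf.expansion_unique ((Classical.epsilon_spec (p := fun c => f μ * f ν = c.sum fun x a => a • f x)
    ⟨c, hc⟩).symm.trans hc)

theorem support_mul (hf : IsTriangular f) (μ ν : DominantWeight l) (x : Weight l)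
    (hx : (f μ * f ν).coeff x ≠ 0) : RootLE x (μ.1 + ν.1) := by
  obtain ⟨a, b, ha, hb, rfl⟩ := exists_add_eq_of_coeff_mul_ne_zero hx
  exact (hf.support _ _ ha).add (hf.support _ _ hb)

theorem structConst_spec (hf : IsTriangular f) (μ ν : DominantWeight l) :
    (f μ * f ν = (structConst f μ ν).sum fun x a => a • f x) ∧
      ∀ x, structConst f μ ν x ≠ 0 → RootLE x.1 (μ.1 + ν.1) := by
  obtain ⟨c, hc, hc'⟩ := hf.exists_expansion (μ.1 + ν.1)
    ((hf.invariant μ).mul (hf.invariant ν)) (hf.support_mul μ ν)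
  rw [hf.structConst_eq hc]
  exact ⟨hc, hc'⟩

end IsTriangular

/-- The fundamental weights. -/
def fundamentalWeight {l : ℕ} (i : Fin l) : DominantWeight l :=
  ⟨Pi.single i 1, fun j => by rw [Pi.single_apply]; split_ifs <;> simp⟩

theorem fundamentalWeight_dual {l : ℕ} (i : Fin l) :
    (fundamentalWeight i).dual = fundamentalWeight i.rev := by
  apply Subtype.ext
  funext j
  simp [DominantWeight.dual, fundamentalWeight, longest_apply, Pi.single_apply,
    Fin.rev_eq_iff]

theorem firstDegree_fundamentalWeight {l : ℕ} (i : Fin l) :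
    firstDegree (fundamentalWeight i).1 = l - i := by
  rw [firstDegree, weightForm_apply, Finset.sum_eq_single i]
  · simp [fundamentalWeight]
  · intro j _ hj
    simp [fundamentalWeight, hj]
  · simp

/-- The dominant weight `0`. -/
instance {l : ℕ} : Zero (DominantWeight l) := ⟨⟨0, fun _ => le_rfl⟩⟩

instance {l : ℕ} : Add (DominantWeight l) :=
  ⟨fun x y => ⟨x.1 + y.1, fun i => add_nonneg (x.2 i) (y.2 i)⟩⟩

theorem DominantWeight.eq_zero_of_rootLE {l : ℕ} {μ : DominantWeight l}
    (h : RootLE μ.1 0) : μ = 0 := by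
  apply Subtype.ext
  funext i
  have h1 := h.height_le
  rw [map_zero] at h1
  exact le_antisymm ((coord_le_height μ i).trans h1) (μ.2 i)

/-- A nonzero dominant weight is the sum of a dominant weight and a fundamental weight. -/
theorem DominantWeight.exists_eq_add {l : ℕ} (x : DominantWeight l) (hx : x ≠ 0) :
    ∃ (y : DominantWeight l) (i : Fin l), x = y + fundamentalWeight i := by
  obtain ⟨i, hi⟩ : ∃ i, x.1 i ≠ 0 := by
    by_contra! hcon
    exact hx (Subtype.ext (funext hcon))
  have hpos : 0 < x.1 i := lt_of_le_of_ne (x.2 i) hi.symm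
  refine ⟨⟨x.1 - Pi.single i 1, fun j => ?_⟩, i, Subtype.ext ?_⟩
  · rcases eq_or_ne j i with rfl | hj
    · simp; omega
    · simpa [hj] using x.2 j
  · exact (sub_add_cancel x.1 (Pi.single i 1)).symm

theorem height_fundamentalWeight_pos {l : ℕ} (i : Fin l) :
    0 < height (fundamentalWeight i).1 :=
  lt_of_lt_of_le (by simp [fundamentalWeight]) (coord_le_height (fundamentalWeight i) i)

theorem DominantWeight.induction {l : ℕ} {P : DominantWeight l → Prop} (x : DominantWeight l)
    (zero : P 0) (add : ∀ x i, P x → P (x + fundamentalWeight i)) : P x := by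
  induction hn : (height x.1).toNat using Nat.strong_induction_on generalizing x with
  | _ n ih =>
    by_cases hx : x = 0
    · rwa [hx]
    · obtain ⟨y, i, rfl⟩ := x.exists_eq_add hx
      refine add y i (ih _ ?_ y rfl)
      have h1 := height_nonneg y
      have h2 := height_fundamentalWeight_pos i
      have h3 : height (y + fundamentalWeight i).1 = height y.1 + height (fundamentalWeight i).1 :=
        map_add _ _ _
      omega

/-! ### Uniqueness of a triangular family with symmetric structure constants -/

/-- Symmetry of the structure constants: `n^x_{μ,ν} = n^μ_{x,-w₀ν}`. -/
def HasSymmetricStructConst {l : ℕ} (f : DominantWeight l → GroupRing l) : Prop :=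
  ∀ x μ ν, structConst f μ ν x = structConst f x ν.dual μ

/-- Equality of the coefficients of `f_x` and `φ_x` at dominant weights differing from `x` by a
combination of a proper subset of the simple roots. -/
def AgreeOnProperSupport {l : ℕ} (f φ : DominantWeight l → GroupRing l) : Prop :=
  ∀ (x μ : DominantWeight l) (k : Fin l → ℤ), x.1 - μ.1 = ∑ i, k i • simpleRoot i →
    (Function.support k).ncard < l → (f x).coeff μ.1 = (φ x).coeff μ.1

section Uniqueness

variable {l : ℕ} {f φ : DominantWeight l → GroupRing l}

namespace AgreeOnProperSupport

/-- At a dominant weight, equal first degree means that the first simple root is missing from `x -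
μ`, and the agreement hypothesis applies. Other weights are moved up by simple reflections. -/
theorem coeff_eq_of_firstDegree_eq (h : AgreeOnProperSupport f φ) (hf : IsTriangular f)
    (hφ : IsTriangular φ) (hl : 0 < l) (x : DominantWeight l) (μ : Weight l)
    (hμ : firstDegree μ = firstDegree x.1) : (f x).coeff μ = (φ x).coeff μ := by
  induction hn : (height x.1 - height μ).toNat using Nat.strong_induction_on generalizing μ with
  | _ n ih =>
    by_contra hne
    have hle : ∀ ν, (f x).coeff ν ≠ (φ x).coeff ν → RootLE ν x.1 := by
      intro ν hν
      by_cases h0 : (f x).coeff ν = 0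
      · exact hφ.support x ν fun h1 => hν (h0.trans h1.symm)
      · exact hf.support x ν h0
    by_cases hdom : ∀ i, 0 ≤ μ i
    · obtain ⟨m, rfl⟩ : ∃ m, l = m + 1 := ⟨l - 1, by omega⟩
      obtain ⟨k, hk⟩ := hle μ hne
      have hk0 : k 0 = 0 := by
        have := RootLE.firstDegree_eq hk
        have h1 : ((m : ℤ) + 2) * k 0 = 0 := by linarith
        rcases mul_eq_zero.mp h1 with h2 | h2
        · omega
        · exact_mod_cast h2
      refine hne (h x ⟨μ, hdom⟩ (fun i => k i) ?_ ?_)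
      · rw [hk, add_sub_cancel_left]
        exact Finset.sum_congr rfl fun i _ => by rw [Nat.cast_smul_eq_nsmul]
      · have hsub : Function.support (fun i => (k i : ℤ)) ⊂ Set.univ := by
          refine Set.ssubset_univ_iff.mpr fun hu => ?_
          have : (0 : Fin (m + 1)) ∈ Function.support (fun i => (k i : ℤ)) := by
            rw [hu]; trivial
          exact this (by simp [hk0])
        have := Set.ncard_lt_ncard hsub
        simpa using this
    · push Not at hdom
      obtain ⟨i, hi⟩ := hdom
      -- Reflecting where the coordinate is negative raises the height and does not lower the first
      -- degree. The result is still below `x`, so its first degree is again that of `x`.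
      have hne' : (f x).coeff (simpleReflection i μ) ≠ (φ x).coeff (simpleReflection i μ) := by
        rwa [(hf.invariant x).coeff_simpleReflection, (hφ.invariant x).coeff_simpleReflection]
      have hle' := hle _ hne'
      have h1 := hle'.firstDegree_le
      have h2 := hle'.height_le
      have h3 : height (simpleReflection i μ) = height μ - 2 * μ i := by
        rw [simpleReflection_apply, map_sub, map_smul, height_simpleRoot, smul_eq_mul]
        ring
      have h4 : firstDegree (simpleReflection i μ) =
          firstDegree μ - μ i * firstDegree (simpleRoot i) := by
        rw [simpleReflection_apply, map_sub, map_smul, smul_eq_mul]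
      have h5 : 0 ≤ firstDegree (simpleRoot i) := by
        rw [firstDegree_simpleRoot]
        split_ifs <;> positivity
      refine hne' (ih _ ?_ _ ?_ rfl)
      · omega
      · nlinarith

variable (h : AgreeOnProperSupport f φ) (hf : IsTriangular f) (hφ : IsTriangular φ)
include h hf hφ

/-- In the top first degree, the product and the triangular system that determines the structure
constants involve only coefficients already known to agree. The system is solved by descending
height. -/
theorem structConst_eq_of_firstDegree_eq (i : Fin l)
    (hi : f (fundamentalWeight i) = φ (fundamentalWeight i)) (x y : DominantWeight l)
    (hy : firstDegree y.1 = firstDegree (x.1 + (fundamentalWeight i).1)) :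
    structConst f x (fundamentalWeight i) y = structConst φ x (fundamentalWeight i) y := by
  classical
  have hl : 0 < l := i.pos
  induction hn : (height (x.1 + (fundamentalWeight i).1) - height y.1).toNat
    using Nat.strong_induction_on generalizing y with
  | _ n ih =>
    set ω := fundamentalWeight i with hω
    obtain ⟨hfs, hfl⟩ := hf.structConst_spec x ω
    obtain ⟨hφs, hφl⟩ := hφ.structConst_spec x ω
    set c := structConst f x ω
    set d := structConst φ x ω
    -- Otherwise `y = a + b` with `a ≤ x`, `b ≤ ω` and the families differing at `a`; as `y` has the
    -- largest possible first degree, `a` has that of `x`, where they agree.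
    have hprod : (f x * f ω).coeff y.1 = (φ x * φ ω).coeff y.1 := by
      rw [hi, ← sub_eq_zero, ← Finsupp.sub_apply, ← AddMonoidAlgebra.coeff_sub, ← sub_mul]
      by_contra hne
      obtain ⟨a, b, ha, hb, hab⟩ := exists_add_eq_of_coeff_mul_ne_zero hne
      rw [AddMonoidAlgebra.coeff_sub, Finsupp.sub_apply, sub_ne_zero] at ha
      have hax : RootLE a x.1 := by
        by_cases h0 : (f x).coeff a = 0
        · exact hφ.support x a fun h1 => ha (h0.trans h1.symm)
        · exact hf.support x a h0
      have h1 := hax.firstDegree_le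
      have h2 := (hφ.support ω b hb).firstDegree_le
      refine ha (h.coeff_eq_of_firstDegree_eq hf hφ hl x a ?_)
      rw [← hab, map_add, map_add] at hy
      linarith
    -- Both expansions are summed over one finite set containing `y`, and the diagonal term, with
    -- leading coefficient `1`, is split off.
    rw [hfs, hφs, coeff_finsuppSum, coeff_finsuppSum,
      Finsupp.sum_of_support_subset c (s := insert y (c.support ∪ d.support)) (by grind) _
        (by simp),
      Finsupp.sum_of_support_subset d (s := insert y (c.support ∪ d.support)) (by grind) _
        (by simp),
      ← Finset.add_sum_erase _ _ (Finset.mem_insert_self _ _),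
      ← Finset.add_sum_erase _ _ (Finset.mem_insert_self _ _), hf.top, hφ.top, mul_one, mul_one]
      at hprod
    refine add_right_cancel (hprod.trans (congrArg _ (Finset.sum_congr rfl fun z hz => ?_).symm))
    have hzy : z ≠ y := Finset.ne_of_mem_erase hz
    -- A term contributes only if `y ≤ z ≤ x + ω`. Then `z` has the same first degree as `y` and
    -- greater height, so the induction hypothesis applies.
    by_cases hyz : RootLE y.1 z.1
    · by_cases hzx : RootLE z.1 (x.1 + ω.1)
      · have h1 := hyz.firstDegree_le
        have h2 := hzx.firstDegree_le
        have h3 := hyz.height_lt fun he => hzy (Subtype.ext he.symm)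
        have h4 := hzx.height_le
        rw [ih _ (by omega) z (by linarith) rfl,
          h.coeff_eq_of_firstDegree_eq hf hφ hl z y.1 (by linarith)]
      · rw [not_not.mp fun hc => hzx (hfl z hc), not_not.mp fun hd => hzx (hφl z hd)]
        simp
    · rw [not_not.mp fun hc => hyz (hf.support z y.1 hc),
        not_not.mp fun hd => hyz (hφ.support z y.1 hd)]
      simp

omit h in
theorem _root_.TypeA.IsTriangular.eq_of_minimal (x : DominantWeight l)
    (hx : ∀ μ : DominantWeight l, RootLE μ.1 x.1 → μ = x) : f x = φ x := by
  refine (hf.invariant x).eq_of_coeff_eq (hφ.invariant x) fun μ => ?_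
  by_cases hμ : RootLE μ.1 x.1
  · rw [hx μ hμ, hf.top, hφ.top]
  · rw [not_not.mp fun hc => hμ (hf.support x μ.1 hc),
      not_not.mp fun hc => hμ (hφ.support x μ.1 hc)]

omit h in
theorem _root_.TypeA.IsTriangular.eq_fundamentalWeight (i : Fin l) :
    f (fundamentalWeight i) = φ (fundamentalWeight i) :=
  hf.eq_of_minimal hφ _ fun _ hμ => Subtype.ext <|
    eq_of_rootLE_minuscule i (by simp [fundamentalWeight])
      (fun j hj => by simp [fundamentalWeight, hj]) hμ

variable (hfs : HasSymmetricStructConst f) (hφs : HasSymmetricStructConst φ)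
include hfs hφs

/-- A nonzero constant puts `y` below `x + ω` and, by symmetry, `x` below `y + ω*`. Adding the first
degrees shows that one of these differences avoids the first simple root, and
`structConst_eq_of_firstDegree_eq` applies on that side. -/
theorem structConst_eq (i : Fin l) (x y : DominantWeight l) :
    structConst f x (fundamentalWeight i) y = structConst φ x (fundamentalWeight i) y := by
  have hi := hf.eq_fundamentalWeight hφ
  by_contra hne
  have h1 : firstDegree y.1 ≠ firstDegree (x.1 + (fundamentalWeight i).1) := fun he =>
    hne (h.structConst_eq_of_firstDegree_eq hf hφ i (hi i) x y he)
  have h2 : firstDegree x.1 ≠ firstDegree (y.1 + (fundamentalWeight i.rev).1) := by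
    intro he
    apply hne
    rw [hfs, hφs, fundamentalWeight_dual]
    exact h.structConst_eq_of_firstDegree_eq hf hφ i.rev (hi i.rev) y x he
  have h3 : RootLE y.1 (x.1 + (fundamentalWeight i).1) ∧
      RootLE x.1 (y.1 + (fundamentalWeight i.rev).1) := by
    by_cases h0 : structConst f x (fundamentalWeight i) y = 0
    · have h0' : structConst φ x (fundamentalWeight i) y ≠ 0 := fun h1 => hne (h0.trans h1.symm)
      refine ⟨(hφ.structConst_spec _ _).2 _ h0', (hφ.structConst_spec _ _).2 _ ?_⟩
      rwa [← fundamentalWeight_dual, ← hφs]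
    · refine ⟨(hf.structConst_spec _ _).2 _ h0, (hf.structConst_spec _ _).2 _ ?_⟩
      rwa [← fundamentalWeight_dual, ← hfs]
  obtain ⟨m, rfl⟩ : ∃ m, l = m + 1 := ⟨l - 1, by have := i.pos; omega⟩
  obtain ⟨⟨k, hk⟩, k', hk'⟩ := h3
  have h4 := RootLE.firstDegree_eq hk
  have h5 := RootLE.firstDegree_eq hk'
  rw [map_add, firstDegree_fundamentalWeight] at h1 h2 h4 h5
  have h6 : ((i.rev : Fin (m + 1)) : ℤ) = m - i := by
    have := i.isLt
    rw [Fin.val_rev]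
    omega
  rw [h6] at h5 h2
  push_cast at h1 h2 h4 h5
  -- With `l = m + 1`, the first degrees of the two fundamental weights are `m + 1 - i` and `i + 1`;
  -- their sum `m + 2` is the first degree of the first simple root.
  have h7 : ((m : ℤ) + 2) * (k 0 + k' 0) = m + 2 := by linarith
  have h8 : (k 0 : ℤ) + k' 0 = 1 := by
    have : (m : ℤ) + 2 ≠ 0 := by omega
    exact mul_left_cancel₀ this (by linarith)
  rcases (show (k 0 = 0 ∨ k' 0 = 0) by omega) with h9 | h9
  · exact h1 (by rw [h9] at h4; simp at h4; linarith)
  · exact h2 (by rw [h9] at h5; simp at h5; linarith)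

/-- Two triangular families with symmetric structure constants that agree on proper supports are
equal. -/
theorem eq : f = φ := by
  classical
  funext x
  induction hn : (height x.1).toNat using Nat.strong_induction_on generalizing x with
  | _ n ih =>
    by_cases hx : x = 0
    · rw [hx]
      exact hf.eq_of_minimal hφ _ fun μ hμ => DominantWeight.eq_zero_of_rootLE hμ
    obtain ⟨y, i, rfl⟩ := x.exists_eq_add hx
    set ω := fundamentalWeight i
    have hadd : height (y + ω).1 = height y.1 + height ω.1 := map_add _ _ _
    have hy0 := height_nonneg y
    have hω := height_fundamentalWeight_pos i
    have hlt : ∀ z : DominantWeight l, height z.1 < height (y + ω).1 → f z = φ z := fun z hz =>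
      ih _ (by have := height_nonneg z; omega) z rfl
    obtain ⟨hf1, hf2⟩ := hf.structConst_spec y ω
    have hφ1 := (hφ.structConst_spec y ω).1
    have hc : structConst f y ω = structConst φ y ω :=
      Finsupp.ext fun z => h.structConst_eq hf hφ hfs hφs i y z
    -- The same product is now expanded in both families with the same coefficients `c`.
    rw [← hlt y (by linarith), ← hf.eq_fundamentalWeight hφ i, ← hc, hf1] at hφ1
    set c := structConst f y ω
    have htop : c (y + ω) = 1 := by
      have h1 : (f y * f ω).coeff (y.1 + ω.1) = c (y + ω) := by
        rw [hf1, coeff_finsuppSum, Finsupp.sum, Finset.sum_eq_single (y + ω)]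
        · exact (congrArg _ (hf.top (y + ω))).trans (mul_one _)
        · intro z hz hne
          by_contra hcon
          have hz1 := hf.support z _ (right_ne_zero_of_mul hcon)
          exact hne (Subtype.ext ((hf2 z (Finsupp.mem_support_iff.mp hz)).antisymm hz1))
        · intro hz
          rw [Finsupp.notMem_support_iff.mp hz, zero_mul]
      rw [← h1]
      -- The extreme weight `a + b` arises from a single pair of support weights, since all others
      -- have smaller total height.
      have h2 : ∀ g g' : GroupRing l, ∀ a b : Weight l, (∀ a', g.coeff a' ≠ 0 → RootLE a' a) →
          (∀ b', g'.coeff b' ≠ 0 → RootLE b' b) →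
          (g * g').coeff (a + b) = g.coeff a * g'.coeff b := by
        intro g g' a b hg hg'
        refine AddMonoidAlgebra.coeff_mul_add_of_uniqueAdd fun a' b' ha hb hab => ?_
        have ha' := hg a' (by simpa using ha)
        have hb' := hg' b' (by simpa using hb)
        have h3 := congrArg height hab
        rw [map_add, map_add] at h3
        have h4 := ha'.height_le
        have h5 := hb'.height_le
        exact ⟨ha'.eq_of_height_le (by linarith), hb'.eq_of_height_le (by linarith)⟩
      rw [h2 _ _ _ _ (hf.support y) (hf.support ω), hf.top, hf.top, one_mul]
    have hmem : y + ω ∈ c.support := by simp [htop]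
    -- Every term other than the leading one has smaller height and cancels by induction.
    rw [Finsupp.sum, Finsupp.sum, ← Finset.add_sum_erase _ _ hmem,
      ← Finset.add_sum_erase _ _ hmem, htop, one_smul, one_smul] at hφ1
    refine add_right_cancel (hφ1.trans (congrArg _ (Finset.sum_congr rfl fun z hz => ?_).symm))
    rw [hlt z]
    exact (hf2 z (Finsupp.mem_support_iff.mp (Finset.mem_of_mem_erase hz))).height_lt
      fun he => Finset.ne_of_mem_erase hz (Subtype.ext he)

end AgreeOnProperSupport

end Uniqueness

/-! ### Weight spaces of modules over a Lie algebra of type `A_l` -/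

section WeightSpaces

variable {l : ℕ} {g : Type*} [LieRing g] [LieAlgebra ℂ g] {H : LieSubalgebra ℂ g}
  (b : LieAlgebra.Basis (Fin l) H)
  {M : Type*} [AddCommGroup M] [Module ℂ M] [LieRingModule g M] [LieModule ℂ g M]
  {N : Type*} [AddCommGroup N] [Module ℂ N] [LieRingModule g N] [LieModule ℂ g N]

/-- A property closed under the Lie algebra operations and true for the `e_i` and `f_i` is true. -/
theorem generator_induction {P : g → Prop} (zero : P 0) (add : ∀ x y, P x → P y → P (x + y))
    (smul : ∀ (t : ℂ) x, P x → P (t • x)) (lie : ∀ x y, P x → P y → P ⁅x, y⁆)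
    (e : ∀ i, P (b.e i)) (f : ∀ i, P (b.f i)) (x : g) : P x := by
  have hx : x ∈ LieSubalgebra.lieSpan ℂ g (Set.range b.e ∪ Set.range b.f) := by
    rw [b.span_ef]; trivial
  induction hx using LieSubalgebra.lieSpan_induction with
  | mem x hx =>
    rcases hx with ⟨i, rfl⟩ | ⟨i, rfl⟩
    exacts [e i, f i]
  | zero => exact zero
  | add x y _ _ hx hy => exact add x y hx hy
  | smul t x _ hx => exact smul t x hx
  | lie x y _ _ hx hy => exact lie x y hx hy

/-- A subspace stable under the `e_i` and `f_i` is a submodule. -/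
def lieSubmoduleOfGenerators (W : Submodule ℂ M) (he : ∀ i, ∀ m ∈ W, ⁅b.e i, m⁆ ∈ W)
    (hf : ∀ i, ∀ m ∈ W, ⁅b.f i, m⁆ ∈ W) : LieSubmodule ℂ g M where
  __ := W
  lie_mem := by
    intro x
    change ∀ {m}, m ∈ W → ⁅x, m⁆ ∈ W
    refine generator_induction b (P := fun x => ∀ {m}, m ∈ W → ⁅x, m⁆ ∈ W) ?_ ?_ ?_ ?_
      (fun i _ => he i _) (fun i _ => hf i _) x
    · intro m _; simp
    · intro x y hx hy m hm; rw [add_lie]; exact W.add_mem (hx hm) (hy hm)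
    · intro t x hx m hm; rw [smul_lie]; exact W.smul_mem t (hx hm)
    · intro x y hx hy m hm; rw [lie_lie]; exact W.sub_mem (hx (hy hm)) (hy (hx hm))

variable {b}

theorem mem_weightSpace {μ : Weight l} {m : M} :
    m ∈ weightSpace b M μ ↔ ∀ i, ⁅b.h i, m⁆ = (μ i : ℂ) • m := by
  simp [weightSpace, Submodule.mem_iInf]

theorem map_mem_weightSpace {F : Type*} [FunLike F M N] [LinearMapClass F ℂ M N] (φ : F)
    (hφ : ∀ (x : g) m, φ ⁅x, m⁆ = ⁅x, φ m⁆) {μ : Weight l} {m : M}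
    (hm : m ∈ weightSpace b M μ) : φ m ∈ weightSpace b N μ := by
  rw [mem_weightSpace] at hm ⊢
  intro i
  rw [← hφ, hm, map_smul]

theorem lie_e_mem_weightSpace (hb : b.A = CartanMatrix.A l) {μ : Weight l} {m : M}
    (hm : m ∈ weightSpace b M μ) (i : Fin l) : ⁅b.e i, m⁆ ∈ weightSpace b M (μ + simpleRoot i) := by
  rw [mem_weightSpace] at hm ⊢
  intro j
  rw [leibniz_lie, hm, b.lie_h_e, hb, lie_smul, zsmul_lie, ← Int.cast_smul_eq_zsmul ℂ, ← add_smul]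
  simp [simpleRoot, add_comm]

theorem lie_f_mem_weightSpace (hb : b.A = CartanMatrix.A l) {μ : Weight l} {m : M}
    (hm : m ∈ weightSpace b M μ) (i : Fin l) : ⁅b.f i, m⁆ ∈ weightSpace b M (μ - simpleRoot i) := by
  rw [mem_weightSpace] at hm ⊢
  intro j
  rw [leibniz_lie, hm, b.lie_h_f, hb, lie_smul, zsmul_lie, ← Int.cast_smul_eq_zsmul ℂ,
    ← add_smul]
  simp [simpleRoot, sub_eq_add_neg, add_comm]

-- The `h i` commute, and distinct weights give distinct systems of eigenvalues because `ℤ` embeds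
-- in `ℂ`.
variable (b M) in
theorem iSupIndep_weightSpace : iSupIndep (weightSpace b M) := by
  have hcomm : ∀ i j, Commute (LieModule.toEnd ℂ g M (b.h i)) (LieModule.toEnd ℂ g M (b.h j)) := by
    intro i j
    refine LinearMap.ext fun m => ?_
    change ⁅b.h i, ⁅b.h j, m⁆⁆ = ⁅b.h j, ⁅b.h i, m⁆⁆
    rw [leibniz_lie, b.lie_h_h, zero_lie, zero_add]
  have h := Module.End.independent_iInf_maxGenEigenspace_of_forall_mapsTo
    (fun i => LieModule.toEnd ℂ g M (b.h i)) fun i j φ =>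
      Module.End.mapsTo_maxGenEigenspace_of_comm (hcomm j i) φ
  have hinj : Function.Injective fun (μ : Weight l) (i : Fin l) => (μ i : ℂ) := by
    intro μ ν h
    funext i
    have := congrFun h i
    simpa using this
  refine (h.comp hinj).mono fun μ => ?_
  exact iInf_mono fun i => Module.End.eigenspace_le_maxGenEigenspace

theorem finite_weights [FiniteDimensional ℂ M] : {μ | weightSpace b M μ ≠ ⊥}.Finite :=
  WellFoundedGT.finite_ne_bot_of_iSupIndep (iSupIndep_weightSpace b M)

theorem weightSpace_ne_bot_of_mem {μ : Weight l} {m : M} (hm : m ∈ weightSpace b M μ)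
    (h0 : m ≠ 0) : weightSpace b M μ ≠ ⊥ :=
  fun h => h0 (by simpa [h] using hm)

/-- A vector in a weight space and in a sum of other weight spaces vanishes. -/
theorem eq_zero_of_mem_weightSpace {μ : Weight l} {S : Set (Weight l)} (hμ : μ ∉ S) {m : M}
    (hm : m ∈ weightSpace b M μ) (hm' : m ∈ ⨆ ν ∈ S, weightSpace b M ν) : m = 0 :=
  Submodule.disjoint_def.mp ((iSupIndep_weightSpace b M).disjoint_biSup hμ) m hm hm'

/-- Nonzero powers would produce infinitely many weights `μ + p α_i`. -/
theorem exists_pow_e_eq_zero [FiniteDimensional ℂ M] (hb : b.A = CartanMatrix.A l) {μ : Weight l}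
    {m : M} (hm : m ∈ weightSpace b M μ) (i : Fin l) :
    ∃ p, (LieModule.toEnd ℂ g M (b.e i) ^ p) m = 0 := by
  by_contra! hcon
  have hmem : ∀ p : ℕ, (LieModule.toEnd ℂ g M (b.e i) ^ p) m ∈
      weightSpace b M (μ + p • simpleRoot i) := by
    intro p
    induction p with
    | zero => simpa using hm
    | succ p ih =>
      rw [pow_succ', succ_nsmul, ← add_assoc]
      exact lie_e_mem_weightSpace hb ih i
  refine Set.infinite_of_injective_forall_mem (f := fun p : ℕ => μ + p • simpleRoot i) ?_
    (fun p => weightSpace_ne_bot_of_mem (hmem p) (hcon p)) (finite_weights (b := b) (M := M))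
  intro p q hpq
  have := congrFun (add_left_cancel hpq) i
  simpa [simpleRoot_apply] using this

/-- The opposite basis exchanges the roles of the `e i` and `f i`, so statements about lowering also
give statements about raising. -/
theorem _root_.LieAlgebra.Basis.symm_weightSpace (μ : Weight l) :
    weightSpace b.symm M μ = weightSpace b M (-μ) := by
  ext m
  simp only [mem_weightSpace, LieAlgebra.Basis.symm_h, Pi.neg_apply, neg_lie, Int.cast_neg,
    neg_smul, neg_eq_iff_eq_neg]

end WeightSpaces

/-! ### Representations of `sl₂` -/

section Sl2

variable {g : Type*} [LieRing g] [LieAlgebra ℂ g]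
  {M : Type*} [AddCommGroup M] [Module ℂ M] [LieRingModule g M] [LieModule ℂ g M]
  {h e f : g}

theorem lie_h_pow_f (t : IsSl2Triple h e f) {v : M} {m : ℂ} (hv : ⁅h, v⁆ = m • v) (j : ℕ) :
    ⁅h, (LieModule.toEnd ℂ g M f ^ j) v⁆ = (m - 2 * j) • (LieModule.toEnd ℂ g M f ^ j) v := by
  induction j with
  | zero => simpa using hv
  | succ j ih =>
    rw [pow_succ', Module.End.mul_apply, LieModule.toEnd_apply_apply, leibniz_lie, ih,
      t.lie_lie_smul_f ℂ, lie_smul, neg_lie, smul_lie, ← neg_smul, ← add_smul]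
    push_cast
    ring_nf

theorem lie_e_pow_f (t : IsSl2Triple h e f) {v : M} {m : ℂ} (hv : ⁅h, v⁆ = m • v) (j : ℕ) :
    ⁅e, (LieModule.toEnd ℂ g M f ^ (j + 1)) v⁆ = (LieModule.toEnd ℂ g M f ^ (j + 1)) ⁅e, v⁆ +
      ((j + 1) * (m - j)) • (LieModule.toEnd ℂ g M f ^ j) v := by
  induction j with
  | zero =>
    simp only [zero_add, pow_one, pow_zero, LieModule.toEnd_apply_apply, Module.End.one_apply]
    rw [leibniz_lie, t.lie_e_f, hv, add_comm]
    simp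
  | succ j ih =>
    have hf : ∀ (n : ℕ) (x : M), (LieModule.toEnd ℂ g M f ^ (n + 1)) x =
        ⁅f, (LieModule.toEnd ℂ g M f ^ n) x⁆ := by
      intro n x
      rw [pow_succ', Module.End.mul_apply, LieModule.toEnd_apply_apply]
    rw [hf (j + 1), leibniz_lie, t.lie_e_f, ih, lie_h_pow_f t hv, lie_add, lie_smul, hf (j + 1),
      ← hf j v]
    push_cast
    module

/-- In a module where `e` acts nilpotently, `f ^ j` kills no nonzero vector of weight `m ≥ j`. -/
theorem eq_zero_of_pow_f_eq_zero (t : IsSl2Triple h e f) {v : M} {m : ℤ}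
    (hv : ⁅h, v⁆ = (m : ℂ) • v) {p : ℕ} (hp : (LieModule.toEnd ℂ g M e ^ p) v = 0) {j : ℕ}
    (hj : (j : ℤ) ≤ m) (hf : (LieModule.toEnd ℂ g M f ^ j) v = 0) : v = 0 := by
  induction p generalizing v m j with
  | zero => simpa using hp
  | succ p ih =>
    -- `⁅e, v⁆` has weight `m + 2` and is killed by `f ^ (j + 1)`, by the commutation formula, so
    -- the induction on the nilpotency exponent applies to it.
    have hev : ⁅e, v⁆ = 0 := by
      refine ih (v := ⁅e, v⁆) (m := m + 2) (j := j + 1) ?_ ?_ (by push_cast; omega) ?_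
      · rw [leibniz_lie, hv, lie_smul, t.lie_h_e_smul ℂ, smul_lie, ← add_smul]
        push_cast
        ring_nf
      · simpa [pow_succ] using hp
      · have h1 := lie_e_pow_f t hv j
        rw [pow_succ', Module.End.mul_apply, hf, map_zero, lie_zero, smul_zero, add_zero,
          ← pow_succ'] at h1
        exact h1.symm
    -- Now `e` kills `v`, so applying `e` to `f ^ (j + 1)` of `v` gives `(j + 1) * (m - j)` times `f
    -- ^ j` of `v`, with nonzero factor because `j < m`.
    clear ih hp
    induction j with
    | zero => simpa using hf
    | succ j ihj =>
      refine ihj (by push_cast at hj; omega) ?_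
      have h1 := lie_e_pow_f t hv j
      rw [hf, hev, map_zero, lie_zero, zero_add] at h1
      refine (smul_eq_zero.mp h1.symm).resolve_left (mul_ne_zero ?_ ?_)
      · exact_mod_cast j.succ_ne_zero
      · rw [sub_ne_zero]
        have : m ≠ j := by push_cast at hj; omega
        exact_mod_cast this

end Sl2

/-! ### Weyl symmetry and saturation of the weights of a finite dimensional module -/

section Reflections

variable {l : ℕ} {g : Type*} [LieRing g] [LieAlgebra ℂ g] {H : LieSubalgebra ℂ g}
  {b : LieAlgebra.Basis (Fin l) H} (hb : b.A = CartanMatrix.A l)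
  {M : Type*} [AddCommGroup M] [Module ℂ M] [LieRingModule g M] [LieModule ℂ g M]
  [FiniteDimensional ℂ M]
include hb

omit [FiniteDimensional ℂ M] in
theorem pow_f_mem_weightSpace {μ : Weight l} {m : M} (hm : m ∈ weightSpace b M μ) (i : Fin l)
    (p : ℕ) : (LieModule.toEnd ℂ g M (b.f i) ^ p) m ∈ weightSpace b M (μ - p • simpleRoot i) := by
  induction p with
  | zero => simpa using hm
  | succ p ih =>
    rw [pow_succ', succ_nsmul, ← sub_sub]
    exact lie_f_mem_weightSpace hb ih i

/-- The `p`-th power of `f i` is injective on this weight space by `eq_zero_of_pow_f_eq_zero`. -/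
theorem finrank_weightSpace_le (μ : Weight l) (i : Fin l) (p : ℕ) (hp : (p : ℤ) ≤ μ i) :
    Module.finrank ℂ (weightSpace b M μ) ≤
      Module.finrank ℂ (weightSpace b M (μ - p • simpleRoot i)) := by
  refine LinearMap.finrank_le_finrank_of_injective
    (f := (LieModule.toEnd ℂ g M (b.f i) ^ p).restrict
      fun m hm => pow_f_mem_weightSpace hb hm i p) ?_
  rw [← LinearMap.ker_eq_bot, LinearMap.ker_eq_bot']
  rintro ⟨m, hm⟩ h
  have hf : (LieModule.toEnd ℂ g M (b.f i) ^ p) m = 0 := congrArg Subtype.val h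
  obtain ⟨q, hq⟩ := exists_pow_e_eq_zero hb hm i
  exact Subtype.ext (eq_zero_of_pow_f_eq_zero (b.sl2 i) (mem_weightSpace.mp hm i) hq hp hf)

/-- For negative `k` the opposite basis is used. The endpoint `k = μ i` yields invariance under
reflection, the other values yield saturation. -/
theorem finrank_weightSpace_le_of_mem_uIcc (μ : Weight l) (i : Fin l) (k : ℤ)
    (hk : k ∈ Set.uIcc 0 (μ i)) : Module.finrank ℂ (weightSpace b M μ) ≤
      Module.finrank ℂ (weightSpace b M (μ - k • simpleRoot i)) := by
  rcases le_total 0 (μ i) with h | h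
  · rw [Set.uIcc_of_le h] at hk
    have := finrank_weightSpace_le hb (M := M) μ i k.toNat (by have := hk.1; have := hk.2; omega)
    rwa [← natCast_zsmul, Int.toNat_of_nonneg hk.1] at this
  · rw [Set.uIcc_of_ge h] at hk
    have := finrank_weightSpace_le (b := b.symm) hb (M := M) (-μ) i (-k).toNat (by
      have := hk.1; have := hk.2; simp; omega)
    rwa [← natCast_zsmul, Int.toNat_of_nonneg (by have := hk.2; omega), b.symm_weightSpace,
      b.symm_weightSpace, neg_neg, neg_sub, sub_neg_eq_add, neg_smul, neg_add_eq_sub] at this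

theorem finrank_weightSpace_simpleReflection (i : Fin l) (μ : Weight l) :
    Module.finrank ℂ (weightSpace b M (simpleReflection i μ)) =
      Module.finrank ℂ (weightSpace b M μ) := by
  have h : ∀ μ : Weight l, Module.finrank ℂ (weightSpace b M μ) ≤
      Module.finrank ℂ (weightSpace b M (simpleReflection i μ)) := fun μ =>
    finrank_weightSpace_le_of_mem_uIcc hb μ i (μ i) Set.right_mem_uIcc
  refine le_antisymm ?_ (h μ)
  conv_rhs => rw [← simpleReflection_simpleReflection i μ]
  exact h _

theorem finrank_weightSpace_weylGroup {w : Weight l ≃ₗ[ℤ] Weight l} (hw : w ∈ weylGroup l)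
    (μ : Weight l) : Module.finrank ℂ (weightSpace b M (w μ)) =
      Module.finrank ℂ (weightSpace b M μ) :=
  (weylGroup_induction (P := fun ν => Module.finrank ℂ (weightSpace b M ν) =
    Module.finrank ℂ (weightSpace b M μ))
    (fun i _ h => (finrank_weightSpace_simpleReflection hb i _).trans h) hw μ).mpr rfl

/-- The root is moved to a simple one by `w⁻¹`, which preserves multiplicities; along a simple root
string multiplicities do not decrease towards the inside. -/
theorem isSaturated_weights : IsSaturated {μ | weightSpace b M μ ≠ ⊥} := by
  intro x hx w hw i k hk
  have h : ∀ μ, weightSpace b M μ ≠ ⊥ ↔ 0 < Module.finrank ℂ (weightSpace b M μ) := by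
    intro μ
    rw [Module.finrank_pos_iff, Submodule.nontrivial_iff_ne_bot]
  rw [Set.mem_ofPred_eq, h] at hx ⊢
  have h1 := finrank_weightSpace_le_of_mem_uIcc hb (M := M) (w⁻¹ x) i k hk
  rw [finrank_weightSpace_weylGroup hb (inv_mem hw),
    ← finrank_weightSpace_weylGroup hb hw (w⁻¹ x - _), map_sub, map_smul,
    show w (w⁻¹ x) = x from LinearEquiv.apply_symm_apply w x] at h1
  exact hx.trans_le h1

/-- A nonzero weight vector killed by the `e_i` has dominant weight. -/
theorem nonneg_of_lie_e_eq_zero {μ : Weight l} {m : M} (hm : m ∈ weightSpace b M μ) (h0 : m ≠ 0)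
    {i : Fin l} (he : ⁅b.e i, m⁆ = 0) : 0 ≤ μ i := by
  by_contra! hlt
  have hm' : m ∈ weightSpace b.symm M (-μ) := by rwa [b.symm_weightSpace, neg_neg]
  obtain ⟨q, hq⟩ := exists_pow_e_eq_zero (b := b.symm) hb hm' i
  refine h0 (eq_zero_of_pow_f_eq_zero (b.symm.sl2 i) (mem_weightSpace.mp hm' i) hq (j := 1)
    (by simp; omega) ?_)
  simpa using he

end Reflections

/-! ### Highest weight modules -/

section HighestWeight

variable {l : ℕ} {g : Type*} [LieRing g] [LieAlgebra ℂ g] {H : LieSubalgebra ℂ g}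
  (b : LieAlgebra.Basis (Fin l) H)
  {M : Type*} [AddCommGroup M] [Module ℂ M] [LieRingModule g M] [LieModule ℂ g M]
  {N : Type*} [AddCommGroup N] [Module ℂ N] [LieRingModule g N] [LieModule ℂ g N]

/-- A highest weight vector: a nonzero weight vector killed by the `e_i`. -/
structure IsHighestWeightVector (x : Weight l) (v : M) : Prop where
  ne_zero : v ≠ 0
  mem_weightSpace : v ∈ weightSpace b M x
  lie_e : ∀ i, ⁅b.e i, v⁆ = 0

/-- Successive application of the `f_i` to a vector. -/
def lowering (v : M) : List (Fin l) → M
  | [] => v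
  | i :: L => ⁅b.f i, lowering v L⁆

variable (M) in
/-- The sum of the weight spaces of weight strictly below `x`. -/
def lowerWeightSpaces (x : Weight l) : Submodule ℂ M :=
  ⨆ μ ∈ {μ | RootLE μ x ∧ μ ≠ x}, weightSpace b M μ

variable {b} {x : Weight l} {v : M}

theorem IsHighestWeightVector.map (hv : IsHighestWeightVector b x v) (φ : M →ₗ⁅ℂ, g⁆ N)
    (h0 : φ v ≠ 0) : IsHighestWeightVector b x (φ v) where
  ne_zero := h0
  mem_weightSpace := map_mem_weightSpace φ (fun _ _ => φ.map_lie _ _) hv.mem_weightSpace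
  lie_e i := by rw [← φ.map_lie, hv.lie_e, map_zero]

theorem lowering_mem (hb : b.A = CartanMatrix.A l) (hv : v ∈ weightSpace b M x)
    (L : List (Fin l)) : lowering b v L ∈ weightSpace b M (x - (L.map simpleRoot).sum) := by
  induction L with
  | nil => simpa [lowering] using hv
  | cons i L ih =>
    have := lie_f_mem_weightSpace hb ih i
    rwa [sub_sub, add_comm, ← List.sum_cons, ← List.map_cons] at this

theorem rootLE_sub_sum (x : Weight l) (L : List (Fin l)) :
    RootLE (x - (L.map simpleRoot).sum) x := by
  induction L with
  | nil => simpa using RootLE.refl x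
  | cons i L ih =>
    have := ih.sub_simpleRoot i
    rwa [sub_sub, add_comm, ← List.sum_cons, ← List.map_cons] at this

theorem height_sum_simpleRoot (L : List (Fin l)) :
    height (L.map simpleRoot).sum = 2 * (L.length : ℤ) := by
  induction L with
  | nil => simp
  | cons i L ih =>
    rw [List.map_cons, List.sum_cons, map_add, ih, height_simpleRoot, List.length_cons]
    push_cast
    ring

theorem lowering_mem_lowerWeightSpaces (hb : b.A = CartanMatrix.A l)
    (hv : v ∈ weightSpace b M x) {L : List (Fin l)} (hL : L ≠ []) :
    lowering b v L ∈ lowerWeightSpaces b M x := by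
  refine Submodule.mem_iSup_of_mem _ (Submodule.mem_iSup_of_mem ⟨rootLE_sub_sum x L, ?_⟩
    (lowering_mem hb hv L))
  intro h
  have h1 := congrArg height h
  rw [map_sub, height_sum_simpleRoot] at h1
  have : 0 < L.length := List.length_pos_iff.mpr hL
  omega

variable (hb : b.A = CartanMatrix.A l) (hv : v ∈ weightSpace b M x) (he : ∀ i, ⁅b.e i, v⁆ = 0)
  (hc : LieSubmodule.lieSpan ℂ g {v} = ⊤)
include hb hv he hc

/-- The span is stable under the `f i` by construction, and under the `e i` because moving `e i`
past `f j` costs only `h i`, which acts by a scalar on each lowered vector. -/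
theorem span_lowering_eq_top : Submodule.span ℂ (Set.range (lowering b v)) = ⊤ := by
  let W := Submodule.span ℂ (Set.range (lowering b v))
  have hmem : ∀ L, lowering b v L ∈ W := fun L => Submodule.subset_span ⟨L, rfl⟩
  have hf : ∀ i, ∀ m ∈ W, ⁅b.f i, m⁆ ∈ W := by
    intro i m hm
    induction hm using Submodule.span_induction with
    | mem m hm => obtain ⟨L, rfl⟩ := hm; exact hmem (i :: L)
    | zero => simp
    | add m m' _ _ h h' => rw [lie_add]; exact W.add_mem h h'
    | smul t m _ h => rw [lie_smul]; exact W.smul_mem t h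
  have he' : ∀ i, ∀ m ∈ W, ⁅b.e i, m⁆ ∈ W := by
    intro i m hm
    induction hm using Submodule.span_induction with
    | mem m hm =>
      obtain ⟨L, rfl⟩ := hm
      induction L with
      | nil => simp [lowering, he]
      | cons j L ih =>
        change ⁅b.e i, ⁅b.f j, lowering b v L⁆⁆ ∈ W
        rw [leibniz_lie]
        refine W.add_mem ?_ (hf j _ ih)
        rcases eq_or_ne i j with rfl | hij
        · rw [(b.sl2 i).lie_e_f, mem_weightSpace.mp (lowering_mem hb hv L)]
          exact W.smul_mem _ (hmem L)
        · simp [b.lie_e_f_ne i j hij]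
    | zero => simp
    | add m m' _ _ h h' => rw [lie_add]; exact W.add_mem h h'
    | smul t m _ h => rw [lie_smul]; exact W.smul_mem t h
  let W' := lieSubmoduleOfGenerators b W he' hf
  have h1 : LieSubmodule.lieSpan ℂ g {v} ≤ W' := by
    rw [LieSubmodule.lieSpan_le, Set.singleton_subset_iff]
    exact hmem []
  rw [hc, top_le_iff] at h1
  exact (LieSubmodule.toSubmodule_eq_top (N := W')).mpr h1

theorem exists_smul_add_mem_lowerWeightSpaces (m : M) :
    ∃ c : ℂ, ∃ m' ∈ lowerWeightSpaces b M x, m = c • v + m' := by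
  have hm : m ∈ Submodule.span ℂ (Set.range (lowering b v)) := by
    rw [span_lowering_eq_top hb hv he hc]; trivial
  induction hm using Submodule.span_induction with
  | mem m hm =>
    obtain ⟨L, rfl⟩ := hm
    rcases eq_or_ne L [] with rfl | hL
    · exact ⟨1, 0, zero_mem _, by simp [lowering]⟩
    · exact ⟨0, _, lowering_mem_lowerWeightSpaces hb hv hL, by simp⟩
  | zero => exact ⟨0, 0, zero_mem _, by simp⟩
  | add m m' _ _ h h' =>
    obtain ⟨c, n, hn, rfl⟩ := h
    obtain ⟨c', n', hn', rfl⟩ := h'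
    exact ⟨c + c', n + n', add_mem hn hn', by rw [add_smul]; abel⟩
  | smul t m _ h =>
    obtain ⟨c, n, hn, rfl⟩ := h
    exact ⟨t * c, t • n, Submodule.smul_mem _ t hn, by rw [smul_add, smul_smul]⟩

/-- Every vector is a multiple of `v` plus a sum of strictly lower weight vectors; independence of
weight spaces removes the latter. -/
theorem exists_eq_smul_of_mem_weightSpace {m : M} (hm : m ∈ weightSpace b M x) :
    ∃ c : ℂ, m = c • v := by
  obtain ⟨c, m', hm', rfl⟩ := exists_smul_add_mem_lowerWeightSpaces hb hv he hc m
  have h0 : m' = 0 := by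
    refine eq_zero_of_mem_weightSpace (b := b) (μ := x) (S := {μ | RootLE μ x ∧ μ ≠ x})
      (fun h => h.2 rfl) ?_ hm'
    simpa using Submodule.sub_mem _ hm (Submodule.smul_mem _ c hv)
  exact ⟨c, by rw [h0, add_zero]⟩

theorem rootLE_of_weightSpace_ne_bot {μ : Weight l} (hμ : weightSpace b M μ ≠ ⊥) :
    RootLE μ x := by
  obtain ⟨m, hm, h0⟩ := Submodule.exists_mem_ne_zero_of_ne_bot hμ
  by_contra hle
  refine h0 (eq_zero_of_mem_weightSpace (S := {ν | RootLE ν x}) hle hm ?_)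
  obtain ⟨c, m', hm', rfl⟩ := exists_smul_add_mem_lowerWeightSpaces hb hv he hc m
  refine Submodule.add_mem _ (Submodule.smul_mem _ c ?_) ?_
  · exact Submodule.mem_iSup_of_mem x (Submodule.mem_iSup_of_mem (RootLE.refl x) hv)
  · exact (biSup_mono fun _ h => h.1 : lowerWeightSpaces b M x ≤ _) hm'

end HighestWeight

/-! ### Cyclic modules over the universal enveloping algebra -/

section Enveloping

variable {g : Type*} [LieRing g] [LieAlgebra ℂ g]

section

attribute [local instance] LieRing.ofAssociativeRing

/-- The elements satisfying `P` form a subalgebra containing `g`. The universal property gives a map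
into it whose composite with the inclusion is the identity. -/
theorem universalEnvelopingAlgebra_induction {P : UniversalEnvelopingAlgebra ℂ g → Prop}
    (algebraMap : ∀ t : ℂ, P (algebraMap ℂ _ t))
    (ι : ∀ a, P (UniversalEnvelopingAlgebra.ι ℂ a))
    (mul : ∀ u u', P u → P u' → P (u * u')) (add : ∀ u u', P u → P u' → P (u + u'))
    (u : UniversalEnvelopingAlgebra ℂ g) : P u := by
  let S : Subalgebra ℂ (UniversalEnvelopingAlgebra ℂ g) :=
    { carrier := {u | P u}
      mul_mem' := fun h h' => mul _ _ h h'
      add_mem' := fun h h' => add _ _ h h'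
      algebraMap_mem' := algebraMap }
  let j : g →ₗ⁅ℂ⁆ S :=
    { toFun a := ⟨UniversalEnvelopingAlgebra.ι ℂ a, ι a⟩
      map_add' a a' := Subtype.ext (map_add _ a a')
      map_smul' t a := Subtype.ext (map_smul _ t a)
      map_lie' {a a'} := Subtype.ext (LieHom.map_lie (UniversalEnvelopingAlgebra.ι ℂ) a a') }
  have h : S.val.comp (UniversalEnvelopingAlgebra.lift ℂ j) = AlgHom.id ℂ _ := by
    refine UniversalEnvelopingAlgebra.hom_ext ℂ (LieHom.ext fun a => ?_)
    change (UniversalEnvelopingAlgebra.lift ℂ j (UniversalEnvelopingAlgebra.ι ℂ a) :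
      UniversalEnvelopingAlgebra ℂ g) = UniversalEnvelopingAlgebra.ι ℂ a
    rw [UniversalEnvelopingAlgebra.lift_ι_apply]
    rfl
  have h' := congrArg (fun φ => φ u) h
  simp only [AlgHom.comp_apply, AlgHom.id_apply] at h'
  rw [← h']
  exact (UniversalEnvelopingAlgebra.lift ℂ j u).2

end

variable (M : Type*) [AddCommGroup M] [Module ℂ M] [LieRingModule g M] [LieModule ℂ g M]

/-- The action of the universal enveloping algebra on a Lie module. -/
def envelopingAction : UniversalEnvelopingAlgebra ℂ g →ₐ[ℂ] Module.End ℂ M :=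
  UniversalEnvelopingAlgebra.lift ℂ (LieModule.toEnd ℂ g M)

variable {M}

theorem envelopingAction_ι (a : g) (m : M) :
    envelopingAction M (UniversalEnvelopingAlgebra.ι ℂ a) m = ⁅a, m⁆ := by
  rw [envelopingAction, UniversalEnvelopingAlgebra.lift_ι_apply]
  rfl

theorem envelopingAction_mem (N : LieSubmodule ℂ g M) (u : UniversalEnvelopingAlgebra ℂ g)
    {m : M} (hm : m ∈ N) : envelopingAction M u m ∈ N := by
  revert m
  refine universalEnvelopingAlgebra_induction
    (P := fun u => ∀ {m : M}, m ∈ N → envelopingAction M u m ∈ N) ?_ ?_ ?_ ?_ u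
  · intro t m hm
    rw [AlgHom.commutes, Module.algebraMap_end_apply]
    exact N.smul_mem t hm
  · intro a m hm
    rw [envelopingAction_ι]
    exact N.lie_mem hm
  · intro u u' h h' m hm
    rw [map_mul]
    exact h (h' hm)
  · intro u u' h h' m hm
    rw [map_add]
    exact N.add_mem (h hm) (h' hm)

/-- The submodule generated by a vector, as the orbit under the universal enveloping algebra. -/
def orbitSubmodule (m : M) : LieSubmodule ℂ g M where
  __ := LinearMap.range ((envelopingAction (g := g) M).toLinearMap.flip m)
  lie_mem := by
    rintro a _ ⟨u, rfl⟩
    refine ⟨UniversalEnvelopingAlgebra.ι ℂ a * u, ?_⟩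
    change envelopingAction M _ m = ⁅a, envelopingAction M u m⁆
    rw [map_mul, Module.End.mul_apply, envelopingAction_ι]

theorem mem_orbitSubmodule {m n : M} :
    n ∈ orbitSubmodule (g := g) m ↔ ∃ u, envelopingAction (g := g) M u m = n := Iff.rfl

theorem exists_envelopingAction_eq [LieModule.IsIrreducible ℂ g M] {m : M} (hm : m ≠ 0) (n : M) :
    ∃ u, envelopingAction (g := g) M u m = n := by
  have hmem : m ∈ orbitSubmodule (g := g) m := ⟨1, by simp⟩
  have htop : orbitSubmodule (g := g) m = ⊤ :=
    (eq_bot_or_eq_top _).resolve_left fun h => hm (by rwa [h, LieSubmodule.mem_bot] at hmem)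
  rw [← mem_orbitSubmodule, htop]
  trivial

/-- The left ideal annihilating a vector. -/
def annihilatorIdeal (m : M) :
    Submodule (UniversalEnvelopingAlgebra ℂ g) (UniversalEnvelopingAlgebra ℂ g) where
  carrier := {u | envelopingAction M u m = 0}
  add_mem' {u u'} h h' := by
    rw [Set.mem_ofPred_eq] at h h' ⊢
    rw [map_add, LinearMap.add_apply, h, h', add_zero]
  zero_mem' := by simp
  smul_mem' u u' h := by
    rw [Set.mem_ofPred_eq] at h ⊢
    rw [smul_eq_mul, map_mul, Module.End.mul_apply, h, map_zero]

theorem mem_annihilatorIdeal {m : M} {u : UniversalEnvelopingAlgebra ℂ g} :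
    u ∈ annihilatorIdeal m ↔ envelopingAction M u m = 0 := Iff.rfl

/-- The quotient of the universal enveloping algebra by a left ideal. -/
def CyclicQuotient (J : Submodule (UniversalEnvelopingAlgebra ℂ g)
    (UniversalEnvelopingAlgebra ℂ g)) : Type _ := UniversalEnvelopingAlgebra ℂ g ⧸ J

namespace CyclicQuotient

variable (J : Submodule (UniversalEnvelopingAlgebra ℂ g) (UniversalEnvelopingAlgebra ℂ g))

instance : AddCommGroup (CyclicQuotient J) :=
  inferInstanceAs (AddCommGroup (UniversalEnvelopingAlgebra ℂ g ⧸ J))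

instance : Module (UniversalEnvelopingAlgebra ℂ g) (CyclicQuotient J) :=
  inferInstanceAs (Module _ (UniversalEnvelopingAlgebra ℂ g ⧸ J))

instance : Module ℂ (CyclicQuotient J) :=
  inferInstanceAs (Module ℂ (UniversalEnvelopingAlgebra ℂ g ⧸ J))

instance : IsScalarTower ℂ (UniversalEnvelopingAlgebra ℂ g) (CyclicQuotient J) :=
  inferInstanceAs (IsScalarTower ℂ _ (UniversalEnvelopingAlgebra ℂ g ⧸ J))

instance : LieRingModule g (CyclicQuotient J) where
  bracket a m := UniversalEnvelopingAlgebra.ι ℂ a • m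
  add_lie a a' m := by simp only [map_add, add_smul]
  lie_add a m m' := smul_add _ m m'
  leibniz_lie a a' m := by
    simp only [LieHom.map_lie, LieRing.of_associative_ring_bracket, sub_smul, mul_smul]
    abel

instance : LieModule ℂ g (CyclicQuotient J) where
  smul_lie t a m := by
    change UniversalEnvelopingAlgebra.ι ℂ (t • a) • m = t • UniversalEnvelopingAlgebra.ι ℂ a • m
    rw [map_smul, smul_assoc]
  lie_smul t a m := by
    change UniversalEnvelopingAlgebra.ι ℂ a • t • m = t • UniversalEnvelopingAlgebra.ι ℂ a • m
    rw [smul_comm]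

/-- The class of an element of the universal enveloping algebra. -/
def mk (u : UniversalEnvelopingAlgebra ℂ g) : CyclicQuotient J := Submodule.Quotient.mk u

theorem mk_eq_zero {u : UniversalEnvelopingAlgebra ℂ g} : mk J u = 0 ↔ u ∈ J :=
  Submodule.Quotient.mk_eq_zero J

theorem mk_sub (u u' : UniversalEnvelopingAlgebra ℂ g) : mk J (u - u') = mk J u - mk J u' := rfl

theorem mk_smul (t : ℂ) (u : UniversalEnvelopingAlgebra ℂ g) : mk J (t • u) = t • mk J u := rfl

theorem lie_mk (a : g) (u : UniversalEnvelopingAlgebra ℂ g) :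
    ⁅a, mk J u⁆ = mk J (UniversalEnvelopingAlgebra.ι ℂ a * u) := rfl

theorem envelopingAction_mk (u u' : UniversalEnvelopingAlgebra ℂ g) :
    envelopingAction (CyclicQuotient J) u (mk J u') = mk J (u * u') := by
  revert u'
  refine universalEnvelopingAlgebra_induction (P := fun u => ∀ u',
    envelopingAction (CyclicQuotient J) u (mk J u') = mk J (u * u')) ?_ ?_ ?_ ?_ u
  · intro t u'
    rw [AlgHom.commutes, Module.algebraMap_end_apply, ← Algebra.smul_def, mk_smul]
  · intro a u'
    rw [envelopingAction_ι, lie_mk]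
  · intro u₁ u₂ h₁ h₂ u'
    rw [map_mul, Module.End.mul_apply, h₂, h₁, mul_assoc]
  · intro u₁ u₂ h₁ h₂ u'
    rw [map_add, LinearMap.add_apply, h₁, h₂, add_mul]
    rfl

theorem lieSpan_mk_one : LieSubmodule.lieSpan ℂ g {mk J 1} = ⊤ := by
  rw [eq_top_iff]
  intro m _
  obtain ⟨u, rfl⟩ := Submodule.Quotient.mk_surjective J m
  have h := envelopingAction_mem (LieSubmodule.lieSpan ℂ g {mk J 1}) u
    (LieSubmodule.subset_lieSpan (Set.mem_singleton _))
  rwa [envelopingAction_mk, mul_one] at h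

end CyclicQuotient

end Enveloping

/-! ### Characterization of Weyl modules -/

section WeylModuleEquiv

variable {l : ℕ} {g : Type*} [LieRing g] [LieAlgebra ℂ g] {H : LieSubalgebra ℂ g}
  {b : LieAlgebra.Basis (Fin l) H}
  {N : Type*} [AddCommGroup N] [Module ℂ N] [LieRingModule g N] [LieModule ℂ g N]
  {x : Weight l} {v : N}

theorem vermaIdeal_le_annihilatorIdeal (hv : IsHighestWeightVector b x v) :
    vermaIdeal b x ≤ annihilatorIdeal v := by
  refine Submodule.span_le.mpr ?_
  rintro _ (⟨i, rfl⟩ | ⟨i, rfl⟩)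
  · rw [SetLike.mem_coe, mem_annihilatorIdeal, envelopingAction_ι, hv.lie_e]
  · rw [SetLike.mem_coe, mem_annihilatorIdeal, map_sub, LinearMap.sub_apply, envelopingAction_ι,
      mem_weightSpace.mp hv.mem_weightSpace, AlgHom.commutes, Module.algebraMap_end_apply, sub_self]

variable [LieModule.IsIrreducible ℂ g N]

/-- Otherwise `J` contains some `j'` fixing `v`. Modulo `K`, the part of `J` killing `v`, `j'` is a
vector of weight `x` in a cyclic highest weight module, hence a multiple `c` of the generator. Then
`c • 1 ∈ J`: if `c ≠ 0`, `J` is everything, and if `c = 0`, `j'` kills `v`. -/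
theorem le_annihilatorIdeal (hb : b.A = CartanMatrix.A l) (hv : IsHighestWeightVector b x v)
    {J : Submodule (UniversalEnvelopingAlgebra ℂ g) (UniversalEnvelopingAlgebra ℂ g)}
    (hJ : vermaIdeal b x ≤ J) (hJt : J ≠ ⊤) : J ≤ annihilatorIdeal v := by
  intro j hj
  by_contra hne
  obtain ⟨u, hu⟩ := exists_envelopingAction_eq (g := g) hne v
  rw [← Module.End.mul_apply, ← map_mul] at hu
  replace hj : u * j ∈ J := J.smul_mem u hj
  set j' := u * j
  let K := J ⊓ annihilatorIdeal v
  have hK : vermaIdeal b x ≤ K := le_inf hJ (vermaIdeal_le_annihilatorIdeal hv)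
  have he : ∀ i, ⁅b.e i, CyclicQuotient.mk K 1⁆ = 0 := by
    intro i
    rw [CyclicQuotient.lie_mk, mul_one, CyclicQuotient.mk_eq_zero]
    exact hK (Submodule.subset_span (Or.inl ⟨i, rfl⟩))
  have hw : CyclicQuotient.mk K 1 ∈ weightSpace b (CyclicQuotient K) x := by
    rw [mem_weightSpace]
    intro i
    rw [CyclicQuotient.lie_mk, mul_one, ← CyclicQuotient.mk_smul, ← sub_eq_zero,
      ← CyclicQuotient.mk_sub, CyclicQuotient.mk_eq_zero, ← Algebra.algebraMap_eq_smul_one]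
    exact hK (Submodule.subset_span (Or.inr ⟨i, rfl⟩))
  have hj'w : CyclicQuotient.mk K j' ∈ weightSpace b (CyclicQuotient K) x := by
    rw [mem_weightSpace]
    intro i
    rw [CyclicQuotient.lie_mk, ← CyclicQuotient.mk_smul, ← sub_eq_zero, ← CyclicQuotient.mk_sub,
      CyclicQuotient.mk_eq_zero]
    refine ⟨?_, ?_⟩
    · refine J.sub_mem (J.smul_mem _ hj) ?_
      rw [Algebra.smul_def]
      exact J.smul_mem _ hj
    · rw [SetLike.mem_coe, mem_annihilatorIdeal, map_sub, map_mul, map_smul, LinearMap.sub_apply,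
        Module.End.mul_apply, LinearMap.smul_apply, hu, envelopingAction_ι,
        mem_weightSpace.mp hv.mem_weightSpace, sub_self]
  obtain ⟨c, hc⟩ := exists_eq_smul_of_mem_weightSpace hb hw he
    (CyclicQuotient.lieSpan_mk_one K) hj'w
  rw [← CyclicQuotient.mk_smul, ← sub_eq_zero, ← CyclicQuotient.mk_sub,
    CyclicQuotient.mk_eq_zero] at hc
  have hcJ : c • (1 : UniversalEnvelopingAlgebra ℂ g) ∈ J := by
    have := J.sub_mem hj hc.1
    rwa [sub_sub_cancel] at this
  rcases eq_or_ne c 0 with rfl | hc0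
  · have h1 := hc.2
    rw [zero_smul, sub_zero, SetLike.mem_coe, mem_annihilatorIdeal, hu] at h1
    exact hv.ne_zero h1
  · apply hJt
    rw [Submodule.eq_top_iff']
    intro y
    have h1 := J.smul_mem (c⁻¹ • y) hcJ
    rwa [smul_eq_mul, smul_mul_smul_comm, inv_mul_cancel₀ hc0, one_smul, mul_one] at h1

theorem maximalIdeal_eq_annihilatorIdeal (hb : b.A = CartanMatrix.A l)
    (hv : IsHighestWeightVector b x v) : maximalIdeal b x = annihilatorIdeal v := by
  refine le_antisymm (sSup_le fun J hJ => le_annihilatorIdeal hb hv hJ.1 hJ.2) (le_sSup ⟨?_, ?_⟩)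
  · exact vermaIdeal_le_annihilatorIdeal hv
  · intro h
    have h1 : (1 : UniversalEnvelopingAlgebra ℂ g) ∈ annihilatorIdeal v := by rw [h]; trivial
    rw [mem_annihilatorIdeal, map_one] at h1
    exact hv.ne_zero h1

/-- An irreducible module with a highest weight vector is a Weyl module. -/
theorem nonempty_weylModule_equiv (hb : b.A = CartanMatrix.A l)
    (hv : IsHighestWeightVector b x v) : Nonempty (WeylModule b x ≃ₗ⁅ℂ, g⁆ N) := by
  let _ : Module (UniversalEnvelopingAlgebra ℂ g) N :=
    Module.compHom N (envelopingAction (g := g) N).toRingHom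
  -- The map `u ↦ u v` is onto by irreducibility, and its kernel, the annihilator of `v`, is the
  -- maximal ideal.
  let T := LinearMap.toSpanSingleton (UniversalEnvelopingAlgebra ℂ g) N v
  have hT : ∀ u, T u = envelopingAction (g := g) N u v := fun u => rfl
  have hker : maximalIdeal b x = LinearMap.ker T := by
    rw [maximalIdeal_eq_annihilatorIdeal hb hv]
    rfl
  have hsurj : Function.Surjective T := fun n => exists_envelopingAction_eq hv.ne_zero n
  let E := (Submodule.quotEquivOfEq _ _ hker).trans (T.quotKerEquivOfSurjective hsurj)
  have hE : ∀ u, E (Submodule.Quotient.mk u) = envelopingAction (g := g) N u v := fun u => rfl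
  exact ⟨{
    toFun := fun m => E m
    map_add' := fun m m' => E.map_add m m'
    map_smul' := by
      intro t m
      obtain ⟨u, rfl⟩ := Submodule.Quotient.mk_surjective _ m
      change E (Submodule.Quotient.mk (t • u)) = t • E (Submodule.Quotient.mk u)
      rw [hE, hE, map_smul, LinearMap.smul_apply]
    map_lie' := by
      intro a m
      obtain ⟨u, rfl⟩ := Submodule.Quotient.mk_surjective _ m
      change E (Submodule.Quotient.mk (UniversalEnvelopingAlgebra.ι ℂ a * u)) =
        ⁅a, E (Submodule.Quotient.mk u)⁆
      rw [hE, hE, map_mul, Module.End.mul_apply, envelopingAction_ι]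
    invFun := fun n => E.symm n
    left_inv := fun m => E.symm_apply_apply m
    right_inv := fun n => E.apply_symm_apply n }⟩

end WeylModuleEquiv

/-! ### Unitary modules -/

section Unitary

variable {l : ℕ} {g : Type*} [LieRing g] [LieAlgebra ℂ g] {H : LieSubalgebra ℂ g}
  (b : LieAlgebra.Basis (Fin l) H)
  (M : Type*) [AddCommGroup M] [Module ℂ M] [LieRingModule g M] [LieModule ℂ g M]
  (N : Type*) [AddCommGroup N] [Module ℂ N] [LieRingModule g N] [LieModule ℂ g N]

/-- A finite dimensional module that is a sum of weight spaces and carries an inner product, pulled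
back from a Hilbert space, for which `e_i` is adjoint to `f_i`. -/
structure IsUnitary : Prop where
  iSup_weightSpace : ⨆ μ, weightSpace b M μ = ⊤
  exists_form : ∃ (E : Type) (_ : NormedAddCommGroup E) (_ : InnerProductSpace ℂ E)
    (_ : FiniteDimensional ℂ E) (φ : M →ₗ[ℂ] E), Function.Injective φ ∧
      ∀ i m n, inner ℂ (φ ⁅b.e i, m⁆) (φ n) = inner ℂ (φ m) (φ ⁅b.f i, n⁆)

variable {b M N}

theorem iSup_weightSpace_eq_top_of_surjective (h : ⨆ μ, weightSpace b M μ = ⊤)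
    (φ : M →ₗ⁅ℂ, g⁆ N) (hφ : Function.Surjective φ) : ⨆ μ, weightSpace b N μ = ⊤ := by
  rw [eq_top_iff]
  intro n _
  obtain ⟨m, rfl⟩ := hφ n
  have hm : m ∈ ⨆ μ, weightSpace b M μ := by rw [h]; trivial
  induction hm using Submodule.iSup_induction' with
  | mem μ m hm =>
    exact Submodule.mem_iSup_of_mem μ (map_mem_weightSpace φ (fun _ _ => φ.map_lie _ _) hm)
  | zero => rw [map_zero]; exact zero_mem _
  | add m m' _ _ h h' =>
    rw [map_add]
    exact Submodule.add_mem _ (h trivial) (h' trivial)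

omit [LieAlgebra ℂ g] [LieModule ℂ g M] in
/-- The projection onto a submodule along a complement. -/
theorem exists_projection {U U' : LieSubmodule ℂ g M} (h : IsCompl U U') :
    ∃ π : M →ₗ⁅ℂ, g⁆ U, (∀ u : U, π u = u) ∧ ∀ m, π m = 0 ↔ m ∈ U' := by
  have h' : IsCompl (U : Submodule ℂ M) (U' : Submodule ℂ M) :=
    LieSubmodule.isCompl_toSubmodule.mpr h
  let π := Submodule.projectionOnto (U : Submodule ℂ M) (U' : Submodule ℂ M) h'
  have hl : ∀ u : U, π u = u := fun u => Submodule.projectionOnto_apply_left h' u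
  have h0 : ∀ m, π m = 0 ↔ m ∈ U' := fun m => Submodule.projectionOnto_apply_eq_zero_iff h'
  refine ⟨{ (π : M →ₗ[ℂ] U) with map_lie' := ?_ }, hl, h0⟩
  intro a m
  change π ⁅a, m⁆ = (⁅a, (π m : U)⁆ : U)
  have h1 : m - (π m : M) ∈ U' := by
    rw [← h0, map_sub, sub_eq_zero]
    exact (hl (π m)).symm
  have h2 : π ⁅a, m - (π m : M)⁆ = 0 := (h0 _).mpr (U'.lie_mem h1)
  rw [lie_sub, map_sub, sub_eq_zero] at h2
  rw [h2]
  exact hl ⁅a, (π m : U)⁆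

namespace IsUnitary

theorem finiteDimensional (h : IsUnitary b M) : FiniteDimensional ℂ M := by
  obtain ⟨E, _, _, _, φ, hφ, -⟩ := h.exists_form
  exact FiniteDimensional.of_injective φ hφ

/-- The orthogonal complement is stable because `e i` and `f i` are adjoint to each other. -/
theorem exists_isCompl (h : IsUnitary b M) (U : LieSubmodule ℂ g M) :
    ∃ U' : LieSubmodule ℂ g M, IsCompl U U' := by
  obtain ⟨E, _, _, _, φ, hφ, hform⟩ := h.exists_form
  let V := (U : Submodule ℂ M).map φ
  let W := Vᗮ.comap φ
  have hW : ∀ m, m ∈ W ↔ ∀ u ∈ U, inner ℂ (φ u) (φ m) = 0 := by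
    intro m
    rw [Submodule.mem_comap, Submodule.mem_orthogonal]
    constructor
    · intro hm u hu
      exact hm _ ⟨u, hu, rfl⟩
    · rintro hm _ ⟨u, hu, rfl⟩
      exact hm u hu
  refine ⟨lieSubmoduleOfGenerators b W ?_ ?_, ?_⟩
  · intro i m hm
    rw [hW] at hm ⊢
    intro u hu
    rw [← inner_conj_symm, hform, ← inner_conj_symm, hm _ (U.lie_mem hu)]
    simp
  · intro i m hm
    rw [hW] at hm ⊢
    intro u hu
    rw [← hform]
    exact hm _ (U.lie_mem hu)
  · rw [← LieSubmodule.isCompl_toSubmodule]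
    change IsCompl (U : Submodule ℂ M) W
    rw [isCompl_iff, Submodule.disjoint_def, Submodule.codisjoint_iff_exists_add_eq]
    constructor
    · intro m hm hm'
      apply hφ
      rw [map_zero, ← inner_self_eq_zero (𝕜 := ℂ)]
      exact (hW m).mp hm' m hm
    · intro m
      obtain ⟨_, ⟨u, hu, rfl⟩, q, hq, hpq⟩ := V.exists_add_mem_mem_orthogonal (φ m)
      refine ⟨u, m - u, hu, ?_, by abel⟩
      rw [Submodule.mem_comap, map_sub, hpq, add_sub_cancel_left]
      exact hq

theorem of_equiv (h : IsUnitary b N) (e : M ≃ₗ⁅ℂ, g⁆ N) : IsUnitary b M where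
  iSup_weightSpace :=
    iSup_weightSpace_eq_top_of_surjective h.iSup_weightSpace e.symm.toLieModuleHom e.symm.surjective
  exists_form := by
    obtain ⟨E, i₁, i₂, i₃, φ, hφ, hform⟩ := h.exists_form
    refine ⟨E, i₁, i₂, i₃, φ ∘ₗ (e.toLieModuleHom : M →ₗ[ℂ] N), hφ.comp e.injective, ?_⟩
    intro i m n
    change inner ℂ (φ (e.toLieModuleHom ⁅b.e i, m⁆)) (φ (e.toLieModuleHom n)) =
      inner ℂ (φ (e.toLieModuleHom m)) (φ (e.toLieModuleHom ⁅b.f i, n⁆))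
    rw [LieModuleHom.map_lie, LieModuleHom.map_lie, hform]

/-- The form restricts, and the equivariant projection along a complement carries the weight
decomposition over. -/
theorem submodule (h : IsUnitary b M) (U : LieSubmodule ℂ g M) : IsUnitary b U where
  iSup_weightSpace := by
    obtain ⟨U', hU'⟩ := h.exists_isCompl U
    obtain ⟨π, hπ, -⟩ := exists_projection hU'
    exact iSup_weightSpace_eq_top_of_surjective h.iSup_weightSpace π fun u => ⟨u, hπ u⟩
  exists_form := by
    obtain ⟨E, i₁, i₂, i₃, φ, hφ, hform⟩ := h.exists_form
    exact ⟨E, i₁, i₂, i₃, φ ∘ₗ U.incl, hφ.comp Subtype.val_injective,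
      fun i m n => hform i m n⟩

end IsUnitary

theorem tmul_mem_weightSpace {μ ν : Weight l} {m : M} {n : N} (hm : m ∈ weightSpace b M μ)
    (hn : n ∈ weightSpace b N ν) : m ⊗ₜ[ℂ] n ∈ weightSpace b (M ⊗[ℂ] N) (μ + ν) := by
  rw [mem_weightSpace] at hm hn ⊢
  intro i
  rw [TensorProduct.LieModule.lie_tmul_right, hm, hn, TensorProduct.tmul_smul,
    ← TensorProduct.smul_tmul', ← add_smul, Pi.add_apply, Int.cast_add]

namespace IsUnitary

theorem tensor (h : IsUnitary b M) (h' : IsUnitary b N) : IsUnitary b (M ⊗[ℂ] N) where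
  iSup_weightSpace := by
    rw [eq_top_iff, ← TensorProduct.span_tmul_eq_top, Submodule.span_le]
    rintro _ ⟨m, n, rfl⟩
    have hm : m ∈ ⨆ μ, weightSpace b M μ := by rw [h.iSup_weightSpace]; trivial
    have hn : n ∈ ⨆ μ, weightSpace b N μ := by rw [h'.iSup_weightSpace]; trivial
    rw [SetLike.mem_coe]
    induction hm using Submodule.iSup_induction' with
    | mem μ m hm =>
      induction hn using Submodule.iSup_induction' with
      | mem ν n hn => exact Submodule.mem_iSup_of_mem _ (tmul_mem_weightSpace hm hn)
      | zero => rw [TensorProduct.tmul_zero]; exact zero_mem _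
      | add n n' _ _ h h' => rw [TensorProduct.tmul_add]; exact Submodule.add_mem _ h h'
    | zero => rw [TensorProduct.zero_tmul]; exact zero_mem _
    | add m m' _ _ h h' => rw [TensorProduct.add_tmul]; exact Submodule.add_mem _ h h'
  exists_form := by
    obtain ⟨E, _, _, _, φ, hφ, hform⟩ := h.exists_form
    obtain ⟨F, _, _, _, ψ, hψ, hform'⟩ := h'.exists_form
    refine ⟨E ⊗[ℂ] F, inferInstance, inferInstance, inferInstance, TensorProduct.map φ ψ,
      TensorProduct.map_injective_of_flat_flat φ ψ hφ hψ, ?_⟩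
    intro i s t
    induction s using TensorProduct.induction_on with
    | zero => simp
    | add s s' hs hs' => rw [lie_add, map_add, inner_add_left, hs, hs', map_add, inner_add_left]
    | tmul m n =>
      induction t using TensorProduct.induction_on with
      | zero => simp
      | add t t' ht ht' => rw [lie_add, map_add, map_add, inner_add_right, inner_add_right, ht, ht']
      | tmul m' n' =>
        simp only [TensorProduct.LieModule.lie_tmul_right, map_add, TensorProduct.map_tmul,
          inner_add_left, inner_add_right, TensorProduct.inner_tmul, hform, hform']

/-- A unitary module generated by a highest weight vector is irreducible. -/
theorem isIrreducible_of_cyclic (h : IsUnitary b M) (hb : b.A = CartanMatrix.A l) {x : Weight l}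
    {v : M} (hv : IsHighestWeightVector b x v) (hc : LieSubmodule.lieSpan ℂ g {v} = ⊤) :
    LieModule.IsIrreducible ℂ g M := by
  have : Nontrivial M := ⟨v, 0, hv.ne_zero⟩
  have htop : ∀ U : LieSubmodule ℂ g M, v ∈ U → U = ⊤ := by
    intro U hU
    rw [← top_le_iff, ← hc, LieSubmodule.lieSpan_le, Set.singleton_subset_iff]
    exact hU
  refine LieModule.IsIrreducible.mk fun U hU => ?_
  obtain ⟨U', hU'⟩ := h.exists_isCompl U
  obtain ⟨π, hπ, hπ0⟩ := exists_projection hU'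
  have hw : ((π v : U) : M) ∈ weightSpace b M x :=
    map_mem_weightSpace (U.incl.comp π) (fun _ _ => LieModuleHom.map_lie _ _ _) hv.mem_weightSpace
  -- The projection of `v` to `U` has weight `x`, and that weight space is a line. So the projection
  -- is zero, with `v` in the complement, or it is a nonzero multiple of `v`, with `v` in `U`.
  obtain ⟨c, hcv⟩ := exists_eq_smul_of_mem_weightSpace hb hv.mem_weightSpace hv.lie_e hc hw
  rcases eq_or_ne c 0 with rfl | hc0
  · rw [zero_smul, ZeroMemClass.coe_eq_zero, hπ0] at hcv
    have := hU'.disjoint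
    rw [htop U' hcv, disjoint_top] at this
    exact absurd this hU
  · apply htop
    have h1 : c • v ∈ U := hcv ▸ (π v).2
    have h2 := U.smul_mem c⁻¹ h1
    rwa [smul_smul, inv_mul_cancel₀ hc0, one_smul] at h2

end IsUnitary

omit [LieAlgebra ℂ g] [LieModule ℂ g M] in
theorem lieSpan_singleton_self (v : M) :
    LieSubmodule.lieSpan ℂ g {(⟨v, LieSubmodule.subset_lieSpan (Set.mem_singleton v)⟩ :
      LieSubmodule.lieSpan ℂ g {v})} = ⊤ := by
  set S := LieSubmodule.lieSpan ℂ g {v}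
  set T := LieSubmodule.lieSpan ℂ g
    {(⟨v, LieSubmodule.subset_lieSpan (Set.mem_singleton v)⟩ : S)}
  have h : S ≤ T.map S.incl := by
    rw [LieSubmodule.lieSpan_le, Set.singleton_subset_iff]
    exact ⟨_, LieSubmodule.subset_lieSpan (Set.mem_singleton _), rfl⟩
  rw [eq_top_iff]
  rintro ⟨m, hm⟩ -
  obtain ⟨t, ht, rfl⟩ := h hm
  exact ht

theorem IsHighestWeightVector.lieSpan {x : Weight l} {v : M} (hv : IsHighestWeightVector b x v) :
    IsHighestWeightVector b x (⟨v, LieSubmodule.subset_lieSpan (Set.mem_singleton v)⟩ :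
      LieSubmodule.lieSpan ℂ g {v}) where
  ne_zero h := hv.ne_zero (congrArg Subtype.val h)
  mem_weightSpace := TypeA.mem_weightSpace.mpr fun i =>
    Subtype.ext (TypeA.mem_weightSpace.mp hv.mem_weightSpace i)
  lie_e i := Subtype.ext (hv.lie_e i)

/-- The submodule of a unitary module generated by a highest weight vector is a Weyl module. -/
theorem IsUnitary.nonempty_weylModule_equiv (h : IsUnitary b M) (hb : b.A = CartanMatrix.A l)
    {x : Weight l} {v : M} (hv : IsHighestWeightVector b x v) :
    Nonempty (WeylModule b x ≃ₗ⁅ℂ, g⁆ LieSubmodule.lieSpan ℂ g {v}) := by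
  have := (h.submodule (LieSubmodule.lieSpan ℂ g {v})).isIrreducible_of_cyclic hb hv.lieSpan
    (lieSpan_singleton_self v)
  exact TypeA.nonempty_weylModule_equiv hb hv.lieSpan

/-- A nonzero unitary module has a highest weight vector, of dominant weight. -/
theorem exists_isHighestWeightVector [FiniteDimensional ℂ M] [Nontrivial M]
    (h : ⨆ μ, weightSpace b M μ = ⊤) (hb : b.A = CartanMatrix.A l) :
    ∃ (x : DominantWeight l) (v : M), IsHighestWeightVector b x.1 v := by
  have hne : {μ | weightSpace b M μ ≠ ⊥}.Nonempty := by
    by_contra hcon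
    rw [Set.not_nonempty_iff_eq_empty, Set.eq_empty_iff_forall_notMem] at hcon
    have : ⨆ μ, weightSpace b M μ = ⊥ := iSup_eq_bot.mpr fun μ => not_not.mp (hcon μ)
    exact bot_ne_top (this.symm.trans h)
  obtain ⟨x, hx, hmax⟩ := Set.exists_max_image _ height (finite_weights (b := b) (M := M)) hne
  obtain ⟨v, hv, hv0⟩ := Submodule.exists_mem_ne_zero_of_ne_bot hx
  have he : ∀ i, ⁅b.e i, v⁆ = 0 := by
    intro i
    by_contra hcon
    have h1 := hmax _ (weightSpace_ne_bot_of_mem (lie_e_mem_weightSpace hb hv i) hcon)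
    rw [map_add, height_simpleRoot] at h1
    omega
  exact ⟨⟨x, fun i => nonneg_of_lie_e_eq_zero hb hv hv0 (he i)⟩, v, hv0, hv, he⟩

end Unitary

/-! ### Unitary representations from matrices -/

section MatrixRepresentation

attribute [local instance] LieRing.ofAssociativeRing

open Matrix
open scoped ComplexOrder

variable {l : ℕ} {g : Type*} [LieRing g] [LieAlgebra ℂ g] {H : LieSubalgebra ℂ g}
  (b : LieAlgebra.Basis (Fin l) H) {ι : Type} [Fintype ι] [DecidableEq ι]

/-- Matrices `E_i` and diagonal integer matrices `H_i = diag (d_i)` that, together with the adjoints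
of the `E_i`, satisfy the same relations as the generators of a Lie algebra with a basis. -/
structure IsUnitaryRep (E : Fin l → Matrix ι ι ℂ) (d : Fin l → ι → ℤ) : Prop where
  lie_h_e : ∀ i j, ⁅diagonal fun s => (d j s : ℂ), E i⁆ = b.A i j • E i
  lie_e_f : ∀ i, ⁅E i, (E i)ᴴ⁆ = diagonal fun s => (d i s : ℂ)
  lie_e_f_ne : ∀ i j, i ≠ j → ⁅E i, (E j)ᴴ⁆ = 0

variable {b} {E : Fin l → Matrix ι ι ℂ} {d : Fin l → ι → ℤ}

theorem conjTranspose_lie (A B : Matrix ι ι ℂ) : ⁅A, B⁆ᴴ = ⁅Bᴴ, Aᴴ⁆ := by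
  simp [Ring.lie_def, conjTranspose_sub, conjTranspose_mul]

omit [Fintype ι] in
theorem conjTranspose_diagonal_intCast (d : ι → ℤ) :
    (diagonal fun s => (d s : ℂ))ᴴ = diagonal fun s => (d s : ℂ) := by
  rw [diagonal_conjTranspose]
  congr 1
  funext s
  simp

variable (b E) in
/-- The graph of the representation to be constructed: the subalgebra of `g × Matrix ι ι ℂ`
generated by the `(e_i, E_i)` and the `(f_i, E_iᴴ)`. -/
def repGraph : LieSubalgebra ℂ (g × Matrix ι ι ℂ) :=
  LieSubalgebra.lieSpan ℂ _
    ((Set.range fun i => (b.e i, E i)) ∪ Set.range fun i => (b.f i, (E i)ᴴ))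

namespace IsUnitaryRep

variable (h : IsUnitaryRep b E d)
include h

theorem lie_h_f (i j : Fin l) : ⁅diagonal fun s => (d j s : ℂ), (E i)ᴴ⁆ = -b.A i j • (E i)ᴴ := by
  have := congrArg conjTranspose (h.lie_h_e i j)
  rw [conjTranspose_lie, conjTranspose_diagonal_intCast, ← lie_skew] at this
  rw [neg_smul, ← neg_eq_iff_eq_neg, this, conjTranspose_smul, star_trivial]

omit h in
/-- The generators of the graph. -/
def graphE (b : LieAlgebra.Basis (Fin l) H) (E : Fin l → Matrix ι ι ℂ) (i : Fin l) : repGraph b E :=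
  ⟨(b.e i, E i), LieSubalgebra.subset_lieSpan (Or.inl ⟨i, rfl⟩)⟩

omit h in
/-- The generators of the graph. -/
def graphF (b : LieAlgebra.Basis (Fin l) H) (E : Fin l → Matrix ι ι ℂ) (i : Fin l) : repGraph b E :=
  ⟨(b.f i, (E i)ᴴ), LieSubalgebra.subset_lieSpan (Or.inr ⟨i, rfl⟩)⟩

omit h in
/-- The coroots in the graph. -/
def graphH (b : LieAlgebra.Basis (Fin l) H) (E : Fin l → Matrix ι ι ℂ) (i : Fin l) : repGraph b E :=
  ⁅graphE b E i, graphF b E i⁆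

theorem coe_graphH (i : Fin l) :
    (graphH b E i : g × Matrix ι ι ℂ) = (b.h i, diagonal fun s => (d i s : ℂ)) := by
  change (⁅b.e i, b.f i⁆, ⁅E i, (E i)ᴴ⁆) = _
  rw [(b.sl2 i).lie_e_f, h.lie_e_f]

/-- The graph has the same kind of basis as `g`. -/
def graphBasis : LieAlgebra.Basis (Fin l)
    (LieSubalgebra.lieSpan ℂ (repGraph b E) (Set.range (graphH b E))) where
  A := b.A
  h := graphH b E
  e := graphE b E
  f := graphF b E
  cartan_eq_lieSpan := rfl
  span_ef := by
    have hr : Set.range (graphE b E) ∪ Set.range (graphF b E) = Subtype.val ⁻¹'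
        ((Set.range fun i => (b.e i, E i)) ∪ Set.range fun i => (b.f i, (E i)ᴴ)) := by
      ext x
      simp [graphE, graphF, Subtype.ext_iff]
    rw [hr]
    exact LieSubalgebra.lieSpan_lieSpan_coe_preimage
  linInd := by
    refine .of_comp (repGraph b E).subtype <| .of_comp (LinearMap.fst ℂ g (Matrix ι ι ℂ)) ?_
    convert b.linInd
    funext i
    exact congrArg Prod.fst (h.coe_graphH i)
  nondegen := b.nondegen
  sl2 i :=
    { h_ne_zero := fun h0 => (b.sl2 i).h_ne_zero (by
        have := h.coe_graphH i
        rw [h0] at this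
        exact (congrArg Prod.fst this).symm)
      lie_e_f := rfl
      lie_h_e_nsmul := by
        have h1 := (b.sl2 i).lie_h_e_nsmul
        have h2 := h.lie_h_e i i
        have : b.A i i = 2 := by
          have : IsAddTorsionFree g := IsAddTorsionFree.of_isTorsionFree ℂ g
          exact b.A_diag_eq_two i
        rw [this] at h2
        ext1
        rw [LieSubalgebra.coe_bracket, h.coe_graphH]
        refine Prod.ext h1 (h2.trans ?_)
        rw [ofNat_smul_eq_nsmul]
        rfl
      lie_h_f_nsmul := by
        have h1 := (b.sl2 i).lie_h_f_nsmul
        have h2 := h.lie_h_f i i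
        have : b.A i i = 2 := by
          have : IsAddTorsionFree g := IsAddTorsionFree.of_isTorsionFree ℂ g
          exact b.A_diag_eq_two i
        rw [this] at h2
        ext1
        rw [LieSubalgebra.coe_bracket, h.coe_graphH]
        refine Prod.ext h1 (h2.trans ?_)
        rw [neg_smul, ofNat_smul_eq_nsmul]
        rfl }
  lie_h_h i j := by
    ext1
    rw [LieSubalgebra.coe_bracket, h.coe_graphH, h.coe_graphH]
    refine Prod.ext (b.lie_h_h i j) ?_
    simp [Ring.lie_def, diagonal_mul_diagonal, mul_comm]
  lie_h_e i j := by
    ext1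
    rw [LieSubalgebra.coe_bracket, h.coe_graphH]
    exact Prod.ext (b.lie_h_e i j) (h.lie_h_e i j)
  lie_h_f i j := by
    ext1
    rw [LieSubalgebra.coe_bracket, h.coe_graphH]
    exact Prod.ext (b.lie_h_f i j) (h.lie_h_f i j)
  lie_e_f_ne i j hij := by
    ext1
    exact Prod.ext (b.lie_e_f_ne i j hij) (h.lie_e_f_ne i j hij)

-- The generators are exchanged by the adjoint in the second coordinate, and the adjoint is
-- compatible with sums, scalars up to conjugation, and brackets up to reversal. Nothing is claimed
-- about how `x` depends on `a`.
omit h in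
theorem exists_conjTranspose_mem {a : g × Matrix ι ι ℂ} (ha : a ∈ repGraph b E) :
    ∃ x : g, (x, a.2ᴴ) ∈ repGraph b E := by
  induction ha using LieSubalgebra.lieSpan_induction with
  | mem a ha =>
    rcases ha with ⟨i, rfl⟩ | ⟨i, rfl⟩
    · exact ⟨b.f i, (graphF b E i).2⟩
    · exact ⟨b.e i, (conjTranspose_conjTranspose (E i)).symm ▸ (graphE b E i).2⟩
  | zero => exact ⟨0, by rw [Prod.snd_zero, conjTranspose_zero]; exact (repGraph b E).zero_mem⟩
  | add a a' _ _ ha ha' =>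
    obtain ⟨x, hx⟩ := ha
    obtain ⟨x', hx'⟩ := ha'
    exact ⟨x + x', by simpa [conjTranspose_add] using (repGraph b E).add_mem hx hx'⟩
  | smul t a _ ha =>
    obtain ⟨x, hx⟩ := ha
    exact ⟨star t • x, by simpa [conjTranspose_smul] using (repGraph b E).smul_mem (star t) hx⟩
  | lie a a' _ _ ha ha' =>
    obtain ⟨x, hx⟩ := ha
    obtain ⟨x', hx'⟩ := ha'
    refine ⟨⁅x', x⁆, ?_⟩
    have := (repGraph b E).lie_mem hx' hx
    rwa [LieAlgebra.Prod.bracket_apply, ← conjTranspose_lie] at this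

/-- The subalgebra spanned by the coroots is its own centralizer. -/
theorem mem_cartan_of_lie_eq_zero {a : repGraph b E} (ha : ∀ i, ⁅graphH b E i, a⁆ = 0) :
    a ∈ Submodule.span ℂ (Set.range (graphH b E)) := by
  let B := h.graphBasis
  have := B.isLieAbelian_cartan
  have hspan := B.coe_cartan_eq_span
  change _ = Submodule.span ℂ (Set.range (graphH b E)) at hspan
  rw [← hspan]
  -- The Cartan subalgebra of the graph is its own zero generalized weight space, which contains
  -- everything killed by the coroots.
  have heq := B.cartan_eq
  set C := LieSubalgebra.lieSpan ℂ (repGraph b E) (Set.range (graphH b E))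
  change a ∈ C
  rw [← LieSubalgebra.mem_toLieSubmodule, heq, LieModule.mem_genWeightSpace]
  rintro ⟨y, hy⟩
  refine ⟨1, ?_⟩
  have hy' : y ∈ Submodule.span ℂ (Set.range (graphH b E)) := by rw [← hspan]; exact hy
  have : ⁅y, a⁆ = 0 := by
    clear hy
    induction hy' using Submodule.span_induction with
    | mem y hy => obtain ⟨i, rfl⟩ := hy; exact ha i
    | zero => rw [zero_lie]
    | add y y' _ _ h h' => rw [add_lie, h, h', add_zero]
    | smul t y _ h => rw [smul_lie, h, smul_zero]
  simpa using this

theorem eq_zero_of_mem_span_of_fst_eq_zero {a : repGraph b E}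
    (ha : a ∈ Submodule.span ℂ (Set.range (graphH b E))) (h0 : a.1.1 = 0) : a = 0 := by
  obtain ⟨c, rfl⟩ := (Submodule.mem_span_range_iff_exists_fun ℂ).mp ha
  have h1 : ∑ i, c i • b.h i = 0 := by
    rw [← h0]
    change _ = ((LinearMap.fst ℂ g (Matrix ι ι ℂ)).comp
      (repGraph b E).toSubmodule.subtype) (∑ i, c i • graphH b E i)
    rw [map_sum]
    refine Finset.sum_congr rfl fun i _ => ?_
    rw [map_smul]
    exact congrArg (fun x => c i • x) (congrArg Prod.fst (h.coe_graphH i)).symm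
  have h2 := Fintype.linearIndependent_iff.mp b.linInd c h1
  simp [h2]

omit h in
theorem fst_surjective (x : g) : ∃ a : repGraph b E, a.1.1 = x := by
  refine generator_induction b (P := fun x => ∃ a : repGraph b E, a.1.1 = x) ?_ ?_ ?_ ?_
    (fun i => ⟨graphE b E i, rfl⟩) (fun i => ⟨graphF b E i, rfl⟩) x
  · exact ⟨0, rfl⟩
  · rintro _ _ ⟨a, rfl⟩ ⟨a', rfl⟩
    exact ⟨a + a', rfl⟩
  · rintro t _ ⟨a, rfl⟩
    exact ⟨t • a, rfl⟩
  · rintro _ _ ⟨a, rfl⟩ ⟨a', rfl⟩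
    exact ⟨⁅a, a'⁆, rfl⟩

omit h in
variable (b E) in
/-- The elements of the graph over `0`. -/
def graphKer : LieIdeal ℂ (repGraph b E) :=
  ((LieHom.fst ℂ g (Matrix ι ι ℂ)).comp (repGraph b E).incl).ker

omit h in
theorem mem_graphKer {a : repGraph b E} : a ∈ graphKer b E ↔ a.1.1 = 0 := Iff.rfl

/-- An eigenvector over `0` of the coroots vanishes. -/
theorem eq_zero_of_lie_eq_smul {a : repGraph b E} (ha : a.1.1 = 0) (χ : Fin l → ℂ)
    (hχ : ∀ i, ⁅graphH b E i, a⁆ = χ i • a) : a = 0 := by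
  have hsnd : ∀ i, ⁅diagonal fun s => (d i s : ℂ), a.1.2⁆ = χ i • a.1.2 := by
    intro i
    have := congrArg (fun a : repGraph b E => a.1.2) (hχ i)
    rw [LieSubalgebra.coe_bracket, h.coe_graphH] at this
    exact this
  by_contra h0
  have hY : a.1.2 ≠ 0 := fun hY => h0 (Subtype.ext (Prod.ext ha hY))
  -- On a nonzero matrix entry, the eigenvalue is a difference of two of the integers `d i s`.
  have hreal : ∀ i, star (χ i) = χ i := by
    intro i
    obtain ⟨s, t, hst⟩ : ∃ s t, a.1.2 s t ≠ 0 := by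
      by_contra! hcon
      exact hY (Matrix.ext hcon)
    have := congrFun (congrFun (hsnd i) s) t
    rw [Ring.lie_def, Matrix.sub_apply, diagonal_mul, mul_diagonal, Matrix.smul_apply, smul_eq_mul,
      mul_comm (a.1.2 s t), ← sub_mul] at this
    rw [← mul_right_cancel₀ hst this]
    simp
  obtain ⟨x, hx⟩ := exists_conjTranspose_mem a.2
  let z : repGraph b E := ⟨(x, a.1.2ᴴ), hx⟩
  have hz : ∀ i, ⁅diagonal fun s => (d i s : ℂ), a.1.2ᴴ⁆ = -χ i • a.1.2ᴴ := by
    intro i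
    have := congrArg conjTranspose (hsnd i)
    rw [conjTranspose_lie, conjTranspose_diagonal_intCast, ← lie_skew, conjTranspose_smul,
      hreal] at this
    rw [neg_smul, ← neg_eq_iff_eq_neg, this]
  -- `a` and its adjoint partner `z` have opposite weights, so their bracket has weight zero and
  -- lies in the span of the coroots. As it lies over `0`, it vanishes, and the matrix of `a` is
  -- normal.
  have hcomm : ∀ i, ⁅graphH b E i, ⁅a, z⁆⁆ = 0 := by
    intro i
    rw [leibniz_lie, hχ]
    ext1
    have h1 : (⁅χ i • a, z⁆ : repGraph b E).1 = (0, χ i • ⁅a.1.2, a.1.2ᴴ⁆) := by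
      refine Prod.ext ?_ (smul_lie _ _ _)
      change ⁅χ i • a.1.1, x⁆ = 0
      rw [ha, smul_zero, zero_lie]
    have h2 : (⁅a, ⁅graphH b E i, z⁆⁆ : repGraph b E).1 = (0, -χ i • ⁅a.1.2, a.1.2ᴴ⁆) := by
      rw [LieSubalgebra.coe_bracket, LieSubalgebra.coe_bracket, h.coe_graphH]
      refine Prod.ext ?_ ?_
      · change ⁅a.1.1, _⁆ = (0 : g)
        rw [ha, zero_lie]
      · change ⁅a.1.2, ⁅diagonal fun s => (d i s : ℂ), a.1.2ᴴ⁆⁆ = _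
        rw [hz, lie_smul]
    change (⁅χ i • a, z⁆ : repGraph b E).1 + (⁅a, ⁅graphH b E i, z⁆⁆ : repGraph b E).1 = 0
    rw [h1, h2, Prod.mk_add_mk, neg_smul, add_neg_cancel, add_zero]
    rfl
  have haz : ⁅a, z⁆ = 0 := by
    refine h.eq_zero_of_mem_span_of_fst_eq_zero (h.mem_cartan_of_lie_eq_zero hcomm) ?_
    change ⁅a.1.1, x⁆ = 0
    rw [ha, zero_lie]
  have hYY : ⁅a.1.2, a.1.2ᴴ⁆ = 0 := congrArg (fun a : repGraph b E => a.1.2) haz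
  -- For the matrix `Y` of `a` and `D = diag (d i)`, `χ i * tr (Y Yᴴ) = tr (⁅D, Y⁆ Yᴴ) = tr (D ⁅Y,
  -- Yᴴ⁆) = 0`, while `tr (Y Yᴴ) ≠ 0`.
  have hχ0 : ∀ i, χ i = 0 := by
    intro i
    have h1 : χ i * (a.1.2 * a.1.2ᴴ).trace = 0 := by
      have h2 : ∀ D Y : Matrix ι ι ℂ, (Y * D * Yᴴ).trace = (D * (Yᴴ * Y)).trace := fun D Y => by
        rw [mul_assoc, trace_mul_comm, mul_assoc]
      rw [← smul_eq_mul, ← trace_smul, ← smul_mul, ← hsnd i, Ring.lie_def, sub_mul, trace_sub,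
        h2, mul_assoc, ← trace_sub, ← mul_sub]
      rw [Ring.lie_def] at hYY
      rw [hYY, mul_zero, trace_zero]
    refine (mul_eq_zero.mp h1).resolve_right ?_
    rw [trace_mul_conjTranspose_self_eq_zero_iff]
    exact hY
  refine h0 (h.eq_zero_of_mem_span_of_fst_eq_zero (h.mem_cartan_of_lie_eq_zero fun i => ?_) ha)
  rw [hχ, hχ0, zero_smul]

variable [FiniteDimensional ℂ g]

/-- A nonzero kernel is a finite dimensional module over the nilpotent Cartan subalgebra, so it
contains a joint eigenvector, which `eq_zero_of_lie_eq_smul` excludes. -/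
theorem fst_injective {a : repGraph b E} (ha : a.1.1 = 0) : a = 0 := by
  by_contra h0
  let B := h.graphBasis
  have := B.isLieAbelian_cartan
  let C := LieSubalgebra.lieSpan ℂ (repGraph b E) (Set.range (graphH b E))
  have : Nontrivial (graphKer b E) := ⟨⟨a, ha⟩, 0, fun h => h0 (congrArg Subtype.val h)⟩
  have : FiniteDimensional ℂ (repGraph b E) :=
    inferInstanceAs (FiniteDimensional ℂ (repGraph b E).toSubmodule)
  have : FiniteDimensional ℂ (graphKer b E) :=
    inferInstanceAs (FiniteDimensional ℂ (graphKer b E).toSubmodule)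
  obtain ⟨χ, hχ⟩ := LieModule.exists_nontrivial_weightSpace_of_isNilpotent ℂ C (graphKer b E)
  obtain ⟨⟨y, hy⟩, hy0⟩ := exists_ne (0 : LieModule.weightSpace (graphKer b E) χ)
  rw [LieModule.mem_weightSpace] at hy
  have hmem : ∀ i, graphH b E i ∈ C := fun i => LieSubalgebra.subset_lieSpan ⟨i, rfl⟩
  have hy' : (y : repGraph b E) = 0 :=
    h.eq_zero_of_lie_eq_smul (mem_graphKer.mp y.2) (fun i => χ ⟨_, hmem i⟩)
      fun i => congrArg Subtype.val (hy ⟨_, hmem i⟩)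
  exact hy0 (Subtype.ext (Subtype.ext hy'))

/-- The relations satisfied by the matrices extend to a representation. -/
theorem exists_lieHom : ∃ ρ : g →ₗ⁅ℂ⁆ Matrix ι ι ℂ,
    ∀ i, ρ (b.e i) = E i ∧ ρ (b.f i) = (E i)ᴴ := by
  -- The representation is the second projection of the graph after the inverse of the first.
  let p := (LieHom.fst ℂ g (Matrix ι ι ℂ)).comp (repGraph b E).incl
  have hp : Function.Bijective p :=
    ⟨(injective_iff_map_eq_zero p).mpr fun a ha => h.fst_injective ha, fst_surjective⟩
  let e : repGraph b E ≃ₗ⁅ℂ⁆ g := LieEquiv.ofBijective p hp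
  refine ⟨((LieHom.snd ℂ g (Matrix ι ι ℂ)).comp (repGraph b E).incl).comp e.symm.toLieHom,
    fun i => ⟨?_, ?_⟩⟩
  · have : e.symm (b.e i) = graphE b E i := by
      rw [show b.e i = e (graphE b E i) from rfl, LieEquiv.symm_apply_apply]
    change (e.symm (b.e i)).1.2 = _
    rw [this]
    rfl
  · have : e.symm (b.f i) = graphF b E i := by
      rw [show b.f i = e (graphF b E i) from rfl, LieEquiv.symm_apply_apply]
    change (e.symm (b.f i)).1.2 = _
    rw [this]
    rfl

theorem exists_module : ∃ (_ : LieRingModule g (ι → ℂ)) (_ : LieModule ℂ g (ι → ℂ)),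
    (∀ i (φ : ι → ℂ), ⁅b.e i, φ⁆ = E i *ᵥ φ) ∧
      (∀ i (φ : ι → ℂ) s, ⁅b.h i, φ⁆ s = d i s * φ s) ∧ IsUnitary b (ι → ℂ) := by
  obtain ⟨ρ, hρ⟩ := h.exists_lieHom
  let _ : LieRingModule g (ι → ℂ) := LieRingModule.compLieHom _ ρ
  have : LieModule ℂ g (ι → ℂ) := LieModule.compLieHom _ ρ
  have hlie : ∀ (x : g) (φ : ι → ℂ), ⁅x, φ⁆ = ρ x *ᵥ φ := fun _ _ => rfl
  have hh : ∀ i (φ : ι → ℂ) s, ⁅b.h i, φ⁆ s = d i s * φ s := by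
    intro i φ s
    rw [hlie, ← (b.sl2 i).lie_e_f, LieHom.map_lie, (hρ i).1, (hρ i).2, h.lie_e_f,
      mulVec_diagonal]
  refine ⟨inferInstance, inferInstance, fun i φ => by rw [hlie, (hρ i).1], hh, ?_, ?_⟩
  · rw [eq_top_iff, ← (Pi.basisFun ℂ ι).span_eq, Submodule.span_le]
    rintro _ ⟨s, rfl⟩
    refine Submodule.mem_iSup_of_mem (fun i => d i s) (mem_weightSpace.mpr fun i => ?_)
    funext t
    rw [hh, Pi.smul_apply, Pi.basisFun_apply, smul_eq_mul]
    rcases eq_or_ne t s with rfl | hts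
    · rfl
    · simp [hts]
  · refine ⟨EuclideanSpace ℂ ι, inferInstance, inferInstance, inferInstance,
      (WithLp.linearEquiv 2 ℂ (ι → ℂ)).symm.toLinearMap, LinearEquiv.injective _, ?_⟩
    intro i m n
    change inner ℂ (WithLp.toLp 2 (ρ (b.e i) *ᵥ m)) (WithLp.toLp 2 n) =
      inner ℂ (WithLp.toLp 2 m) (WithLp.toLp 2 (ρ (b.f i) *ᵥ n))
    rw [(hρ i).1, (hρ i).2, EuclideanSpace.inner_toLp_toLp, EuclideanSpace.inner_toLp_toLp,
      star_mulVec, dotProduct_comm, ← dotProduct_mulVec, dotProduct_comm]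

end IsUnitaryRep

end MatrixRepresentation

/-! ### The Fock space -/

section Fock

open Matrix

variable {l : ℕ}

/-- Exchange of two consecutive occupation numbers. -/
def exchange (i : Fin l) (s : Fin (l + 1) → Bool) : Fin (l + 1) → Bool :=
  s ∘ Equiv.swap i.castSucc i.succ

theorem exchange_apply (i : Fin l) (s : Fin (l + 1) → Bool) (k : Fin (l + 1)) : exchange i s k =
    if k.val = i.val then s i.succ else if k.val = i.val + 1 then s i.castSucc else s k := by
  simp only [exchange, Function.comp_apply, Equiv.swap_apply_def, Fin.ext_iff, Fin.val_castSucc,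
    Fin.val_succ]
  split_ifs <;> rfl

theorem exchange_exchange (i : Fin l) (s : Fin (l + 1) → Bool) :
    exchange i (exchange i s) = s := by
  funext k
  simp [exchange]

theorem exchange_castSucc (i : Fin l) (s : Fin (l + 1) → Bool) :
    exchange i s i.castSucc = s i.succ := by
  simp [exchange]

theorem exchange_succ (i : Fin l) (s : Fin (l + 1) → Bool) :
    exchange i s i.succ = s i.castSucc := by
  simp [exchange]

/-- The raising operators on the Fock space `⋀ ℂ^(l+1)`, in the basis of occupation numbers. -/
def fockE (i : Fin l) : Matrix (Fin (l + 1) → Bool) (Fin (l + 1) → Bool) ℂ :=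
  -- The row `s` is the state after raising, the column `t` the state before. A particle moves
  -- between adjacent positions, so it passes no other and no exterior algebra sign appears.
  of fun s t => if s i.castSucc = true ∧ s i.succ = false ∧ t = exchange i s then 1 else 0

/-- The weights of the Fock space. -/
def fockWeight (i : Fin l) (s : Fin (l + 1) → Bool) : ℤ :=
  (if s i.castSucc = true then 1 else 0) - if s i.succ = true then 1 else 0

theorem fockE_mulVec (i : Fin l) (φ : (Fin (l + 1) → Bool) → ℂ) (s : Fin (l + 1) → Bool) :
    (fockE i *ᵥ φ) s =
      if s i.castSucc = true ∧ s i.succ = false then φ (exchange i s) else 0 := by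
  simp only [fockE, mulVec, dotProduct, of_apply, ite_mul, one_mul, zero_mul]
  split_ifs with h
  · simp [h]
  · exact Finset.sum_eq_zero fun t _ => if_neg fun h' => h ⟨h'.1, h'.2.1⟩

theorem fockE_conjTranspose_mulVec (i : Fin l) (φ : (Fin (l + 1) → Bool) → ℂ)
    (s : Fin (l + 1) → Bool) : ((fockE i)ᴴ *ᵥ φ) s =
      if s i.castSucc = false ∧ s i.succ = true then φ (exchange i s) else 0 := by
  have h : (fockE i)ᴴ = of fun s t =>
      if s i.castSucc = false ∧ s i.succ = true ∧ t = exchange i s then 1 else 0 := by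
    ext s t
    rw [conjTranspose_apply, fockE, of_apply, of_apply]
    have : (t i.castSucc = true ∧ t i.succ = false ∧ s = exchange i t) ↔
        (s i.castSucc = false ∧ s i.succ = true ∧ t = exchange i s) := by
      constructor
      · rintro ⟨h, h', rfl⟩
        rw [exchange_castSucc, exchange_succ, exchange_exchange]
        exact ⟨h', h, rfl⟩
      · rintro ⟨h, h', rfl⟩
        rw [exchange_castSucc, exchange_succ, exchange_exchange]
        exact ⟨h', h, rfl⟩
    simp only [this]
    split_ifs <;> simp
  rw [h]
  simp only [mulVec, dotProduct, of_apply, ite_mul, one_mul, zero_mul]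
  split_ifs with h
  · simp [h]
  · exact Finset.sum_eq_zero fun t _ => if_neg fun h' => h ⟨h'.1, h'.2.1⟩

theorem eq_of_mulVec_eq {ι : Type} [Fintype ι] [DecidableEq ι] {A B : Matrix ι ι ℂ}
    (h : ∀ φ s, (A *ᵥ φ) s = (B *ᵥ φ) s) : A = B :=
  Matrix.toLin'.injective (LinearMap.ext fun φ => funext (h φ))

theorem isUnitaryRep_fock {g : Type*} [LieRing g] [LieAlgebra ℂ g] {H : LieSubalgebra ℂ g}
    {b : LieAlgebra.Basis (Fin l) H} (hb : b.A = CartanMatrix.A l) :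
    IsUnitaryRep b fockE fockWeight where
  lie_h_e i j := by
    refine eq_of_mulVec_eq fun φ s => ?_
    rw [hb, Ring.lie_def, sub_mulVec, ← mulVec_mulVec, ← mulVec_mulVec, Pi.sub_apply,
      mulVec_diagonal, fockE_mulVec, fockE_mulVec, mulVec_diagonal, ← Int.cast_smul_eq_zsmul ℂ,
      smul_mulVec, Pi.smul_apply, fockE_mulVec]
    split_ifs with h
    · rw [← sub_mul, smul_eq_mul, ← Int.cast_sub]
      congr 2
      simp only [fockWeight, exchange_apply, CartanMatrix.A, of_apply, Fin.val_castSucc,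
        Fin.val_succ]
      obtain ⟨h1, h2⟩ := h
      have e1 : i.val + 1 = j.val → i.succ = j.castSucc := fun h => Fin.ext h
      have e2 : j.val + 1 = i.val → j.succ = i.castSucc := fun h => Fin.ext h
      have e3 : i.val = j.val → i = j := fun h => Fin.ext h
      grind
    · simp
  lie_e_f i := by
    refine eq_of_mulVec_eq fun φ s => ?_
    rw [Ring.lie_def, sub_mulVec, ← mulVec_mulVec, ← mulVec_mulVec, Pi.sub_apply,
      mulVec_diagonal, fockE_mulVec, fockE_conjTranspose_mulVec, fockE_conjTranspose_mulVec,
      fockE_mulVec, exchange_castSucc, exchange_succ, exchange_exchange, fockWeight]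
    cases s i.castSucc <;> cases s i.succ <;> simp
  lie_e_f_ne i j hij := by
    refine eq_of_mulVec_eq fun φ s => ?_
    rw [Ring.lie_def, sub_mulVec, ← mulVec_mulVec, ← mulVec_mulVec, Pi.sub_apply,
      zero_mulVec, fockE_mulVec, fockE_conjTranspose_mulVec, fockE_conjTranspose_mulVec,
      fockE_mulVec, Pi.zero_apply, sub_eq_zero]
    have e1 : i.val + 1 = j.val → i.succ = j.castSucc := fun h => Fin.ext h
    have e2 : j.val + 1 = i.val → j.succ = i.castSucc := fun h => Fin.ext h
    have e3 : i.val ≠ j.val := fun h => hij (Fin.ext h)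
    -- For adjacent nodes both products vanish; for distant nodes the two exchanges commute.
    by_cases h1 : i.val + 1 = j.val
    · rw [exchange_apply, exchange_apply, exchange_apply, exchange_apply]
      simp only [Fin.val_castSucc, Fin.val_succ]
      grind
    · by_cases h2 : j.val + 1 = i.val
      · rw [exchange_apply, exchange_apply, exchange_apply, exchange_apply]
        simp only [Fin.val_castSucc, Fin.val_succ]
        grind
      · have hcomm : exchange j (exchange i s) = exchange i (exchange j s) := by
          funext k
          simp only [exchange_apply, Fin.val_castSucc, Fin.val_succ]
          grind
        rw [hcomm, exchange_apply, exchange_apply, exchange_apply, exchange_apply]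
        simp only [Fin.val_castSucc, Fin.val_succ]
        grind

variable {g : Type*} [LieRing g] [LieAlgebra ℂ g] [FiniteDimensional ℂ g] {H : LieSubalgebra ℂ g}
  {b : LieAlgebra.Basis (Fin l) H}

/-- Decreasing sequences of occupation numbers give highest weight vectors. -/
theorem exists_unitary_of_antitone (hb : b.A = CartanMatrix.A l) (s : Fin (l + 1) → Bool)
    (hs : ∀ i : Fin l, s i.succ = true → s i.castSucc = true) :
    ∃ (M : Type) (_ : AddCommGroup M) (_ : Module ℂ M) (_ : LieRingModule g M)
      (_ : LieModule ℂ g M) (v : M), IsUnitary b M ∧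
        IsHighestWeightVector b (fun i => fockWeight i s) v := by
  obtain ⟨_, _, he, hh, hu⟩ := (isUnitaryRep_fock hb).exists_module
  refine ⟨(Fin (l + 1) → Bool) → ℂ, _, _, _, inferInstance, Pi.single s 1, hu, ?_, ?_, ?_⟩
  · simp
  · refine mem_weightSpace.mpr fun i => funext fun t => ?_
    rw [hh, Pi.smul_apply, smul_eq_mul]
    rcases eq_or_ne t s with rfl | hts
    · rfl
    · simp [hts]
  · intro i
    funext t
    rw [he, fockE_mulVec, Pi.zero_apply]
    split_ifs with h
    · refine Pi.single_eq_of_ne (fun h' => ?_) _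
      have := hs i
      rw [← h', exchange_castSucc, exchange_succ] at this
      simp [h] at this
    · rfl

theorem tmul_ne_zero {M N : Type*} [AddCommGroup M] [Module ℂ M] [AddCommGroup N] [Module ℂ N]
    {m : M} {n : N} (hm : m ≠ 0) (hn : n ≠ 0) : m ⊗ₜ[ℂ] n ≠ 0 := by
  obtain ⟨f, hf⟩ := not_forall.mp (mt (Module.forall_dual_apply_eq_zero_iff ℂ m).mp hm)
  obtain ⟨f', hf'⟩ := not_forall.mp (mt (Module.forall_dual_apply_eq_zero_iff ℂ n).mp hn)
  intro h
  have := congrArg (TensorProduct.lid ℂ ℂ ∘ₗ TensorProduct.map f f' : M ⊗[ℂ] N →ₗ[ℂ] ℂ) h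
  simp [hf, hf'] at this

/-- Every dominant weight is the weight of a highest weight vector in a unitary module. -/
theorem exists_unitary (hb : b.A = CartanMatrix.A l) (x : DominantWeight l) :
    ∃ (M : Type) (_ : AddCommGroup M) (_ : Module ℂ M) (_ : LieRingModule g M)
      (_ : LieModule ℂ g M) (v : M), IsUnitary b M ∧ IsHighestWeightVector b x.1 v := by
  induction x using DominantWeight.induction with
  | zero =>
    have h := exists_unitary_of_antitone hb (fun _ => false) (by simp)
    have h0 : (fun i : Fin l => fockWeight i fun _ => false) = (0 : DominantWeight l).1 := by
      funext i
      simp only [fockWeight, Bool.false_eq_true, if_false, sub_zero]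
      rfl
    rwa [h0] at h
  | add x i ih =>
    -- Filling the positions `0, …, i` gives the highest weight vector of the exterior power of
    -- degree `i + 1`; the zero weight came from the vacuum.
    have h := exists_unitary_of_antitone hb (fun k => decide (k.val ≤ i.val))
      (by simp; omega)
    have hi : (fun j => fockWeight j fun k : Fin (l + 1) => decide (k.val ≤ i.val)) =
        (fundamentalWeight i).1 := by
      funext j
      simp only [fockWeight, fundamentalWeight, Pi.single_apply, Fin.ext_iff, decide_eq_true_eq,
        Fin.val_castSucc, Fin.val_succ]
      grind
    rw [hi] at h
    obtain ⟨M, _, _, _, _, v, hM, hv⟩ := ih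
    obtain ⟨N, _, _, _, _, w, hN, hw⟩ := h
    refine ⟨M ⊗[ℂ] N, inferInstance, inferInstance, inferInstance, inferInstance, v ⊗ₜ w,
      hM.tensor hN, ?_, tmul_mem_weightSpace hv.mem_weightSpace hw.mem_weightSpace, ?_⟩
    · exact tmul_ne_zero hv.ne_zero hw.ne_zero
    · intro j
      rw [TensorProduct.LieModule.lie_tmul_right, hv.lie_e, hw.lie_e, TensorProduct.zero_tmul,
        TensorProduct.tmul_zero, add_zero]

end Fock

/-! ### Structure of Weyl modules -/

section WeylModule

variable {l : ℕ} {g : Type*} [LieRing g] [LieAlgebra ℂ g] {H : LieSubalgebra ℂ g}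
  {b : LieAlgebra.Basis (Fin l) H}
  {M : Type*} [AddCommGroup M] [Module ℂ M] [LieRingModule g M] [LieModule ℂ g M]
  {N : Type*} [AddCommGroup N] [Module ℂ N] [LieRingModule g N] [LieModule ℂ g N]

omit [LieAlgebra ℂ g] [LieModule ℂ g M] [LieModule ℂ g N] in
theorem lieSpan_map_eq_top {v : M} (hv : LieSubmodule.lieSpan ℂ g {v} = ⊤) (φ : M →ₗ⁅ℂ, g⁆ N)
    (hφ : Function.Surjective φ) : LieSubmodule.lieSpan ℂ g {φ v} = ⊤ := by
  have h : LieSubmodule.comap φ (LieSubmodule.lieSpan ℂ g {φ v}) = ⊤ := by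
    rw [← top_le_iff, ← hv, LieSubmodule.lieSpan_le, Set.singleton_subset_iff, SetLike.mem_coe,
      LieSubmodule.mem_comap]
    exact LieSubmodule.subset_lieSpan (Set.mem_singleton _)
  rw [eq_top_iff]
  intro n _
  obtain ⟨m, rfl⟩ := hφ n
  rw [← LieSubmodule.mem_comap, h]
  trivial

omit [LieAlgebra ℂ g] [LieModule ℂ g M] in
theorem lieSpan_eq_top_of_ne_zero [LieModule.IsIrreducible ℂ g M] {v : M} (hv : v ≠ 0) :
    LieSubmodule.lieSpan ℂ g {v} = ⊤ :=
  (eq_bot_or_eq_top _).resolve_left fun h => hv (by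
    have : v ∈ LieSubmodule.lieSpan ℂ g {v} := LieSubmodule.subset_lieSpan (Set.mem_singleton v)
    rwa [h, LieSubmodule.mem_bot] at this)

omit [LieAlgebra ℂ g] [LieModule ℂ g M] [LieModule ℂ g N] in
/-- A homomorphism vanishing on a generator vanishes. -/
theorem eq_zero_of_apply_eq_zero {v : M} (hv : LieSubmodule.lieSpan ℂ g {v} = ⊤)
    {φ : M →ₗ⁅ℂ, g⁆ N} (h : φ v = 0) : φ = 0 := by
  have h1 : φ.ker = ⊤ := by
    rw [← top_le_iff, ← hv, LieSubmodule.lieSpan_le, Set.singleton_subset_iff]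
    exact h
  ext m
  have : m ∈ φ.ker := by rw [h1]; trivial
  exact this

variable [FiniteDimensional ℂ g] (hb : b.A = CartanMatrix.A l)
include hb

/-- The Weyl module is isomorphic to the submodule generated by a highest weight vector in the
module of `exists_unitary`. -/
theorem isUnitary_weylModule (x : DominantWeight l) : IsUnitary b (WeylModule b x.1) := by
  obtain ⟨M, _, _, _, _, v, hM, hv⟩ := exists_unitary hb x
  obtain ⟨e⟩ := hM.nonempty_weylModule_equiv hb hv
  exact (hM.submodule _).of_equiv e

theorem finiteDimensional_weylModule (x : DominantWeight l) :
    FiniteDimensional ℂ (WeylModule b x.1) := (isUnitary_weylModule hb x).finiteDimensional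

theorem exists_weylModule_vector (x : DominantWeight l) : ∃ v : WeylModule b x.1,
    IsHighestWeightVector b x.1 v ∧ LieSubmodule.lieSpan ℂ g {v} = ⊤ := by
  obtain ⟨M, _, _, _, _, v, hM, hv⟩ := exists_unitary hb x
  obtain ⟨e⟩ := hM.nonempty_weylModule_equiv hb hv
  refine ⟨e.symm ⟨v, LieSubmodule.subset_lieSpan (Set.mem_singleton v)⟩,
    hv.lieSpan.map e.symm.toLieModuleHom fun h => hv.lieSpan.ne_zero ?_,
    lieSpan_map_eq_top (lieSpan_singleton_self v) e.symm.toLieModuleHom e.symm.surjective⟩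
  exact e.symm.injective (h.trans (map_zero e.symm.toLieModuleHom).symm)

theorem isIrreducible_weylModule (x : DominantWeight l) :
    LieModule.IsIrreducible ℂ g (WeylModule b x.1) := by
  obtain ⟨v, hv, hc⟩ := exists_weylModule_vector hb x
  exact (isUnitary_weylModule hb x).isIrreducible_of_cyclic hb hv hc

theorem rootLE_of_weightSpace_weylModule_ne_bot {x : DominantWeight l} {μ : Weight l}
    (hμ : weightSpace b (WeylModule b x.1) μ ≠ ⊥) : RootLE μ x.1 := by
  obtain ⟨v, hv, hc⟩ := exists_weylModule_vector hb x
  exact rootLE_of_weightSpace_ne_bot hb hv.mem_weightSpace hv.lie_e hc hμ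

/-- The weights of the Weyl module form a saturated set containing `x`, so they contain the smallest
such set. -/
theorem rootLE_of_mem_saturatedWeights {x : DominantWeight l} {μ : Weight l}
    (hμ : μ ∈ saturatedWeights x) : RootLE μ x.1 := by
  have := finiteDimensional_weylModule hb x
  obtain ⟨v, hv, -⟩ := exists_weylModule_vector hb x
  refine rootLE_of_weightSpace_weylModule_ne_bot hb (Set.mem_sInter.mp hμ
    {μ | weightSpace b (WeylModule b x.1) μ ≠ ⊥} ⟨isSaturated_weights hb, ?_⟩)
  exact weightSpace_ne_bot_of_mem hv.mem_weightSpace hv.ne_zero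

theorem finrank_weightSpace_weylModule_self (x : DominantWeight l) :
    Module.finrank ℂ (weightSpace b (WeylModule b x.1) x.1) = 1 := by
  obtain ⟨v, hv, hc⟩ := exists_weylModule_vector hb x
  rw [finrank_eq_one_iff_of_nonzero' ⟨v, hv.mem_weightSpace⟩
    fun h => hv.ne_zero (congrArg Subtype.val h)]
  rintro ⟨m, hm⟩
  obtain ⟨c, rfl⟩ := exists_eq_smul_of_mem_weightSpace hb hv.mem_weightSpace hv.lie_e hc hm
  exact ⟨c, rfl⟩

omit [FiniteDimensional ℂ g] in
/-- The highest weight of an irreducible module is unique. -/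
theorem IsHighestWeightVector.weight_unique [LieModule.IsIrreducible ℂ g M] {x y : Weight l}
    {v w : M} (hv : IsHighestWeightVector b x v) (hw : IsHighestWeightVector b y w) : x = y := by
  have h := rootLE_of_weightSpace_ne_bot hb hv.mem_weightSpace hv.lie_e
    (lieSpan_eq_top_of_ne_zero hv.ne_zero)
    (weightSpace_ne_bot_of_mem hw.mem_weightSpace hw.ne_zero)
  have h' := rootLE_of_weightSpace_ne_bot hb hw.mem_weightSpace hw.lie_e
    (lieSpan_eq_top_of_ne_zero hw.ne_zero)
    (weightSpace_ne_bot_of_mem hv.mem_weightSpace hv.ne_zero)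
  exact h'.antisymm h

/-- Schur's lemma for Weyl modules. -/
theorem finrank_weylModule_hom [DecidableEq (DominantWeight l)] (x y : DominantWeight l) :
    Module.finrank ℂ (WeylModule b x.1 →ₗ⁅ℂ, g⁆ WeylModule b y.1) = if x = y then 1 else 0 := by
  obtain ⟨v, hv, hc⟩ := exists_weylModule_vector hb x
  split_ifs with h
  · subst h
    have hne : (LieModuleHom.id : WeylModule b x.1 →ₗ⁅ℂ, g⁆ WeylModule b x.1) ≠ 0 :=
      fun h => hv.ne_zero (LieModuleHom.congr_fun h v)
    rw [finrank_eq_one_iff_of_nonzero' _ hne]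
    intro φ
    obtain ⟨c, hcv⟩ := exists_eq_smul_of_mem_weightSpace hb hv.mem_weightSpace hv.lie_e hc
      (map_mem_weightSpace φ (fun _ _ => φ.map_lie _ _) hv.mem_weightSpace)
    refine ⟨c, Eq.symm (sub_eq_zero.mp (eq_zero_of_apply_eq_zero hc ?_))⟩
    rw [LieModuleHom.sub_apply, hcv, LieModuleHom.smul_apply]
    exact sub_self _
  · have : Subsingleton (WeylModule b x.1 →ₗ⁅ℂ, g⁆ WeylModule b y.1) := by
      refine subsingleton_of_forall_eq 0 fun φ => eq_zero_of_apply_eq_zero hc ?_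
      by_contra h0
      obtain ⟨w, hw, -⟩ := exists_weylModule_vector hb y
      have := isIrreducible_weylModule hb y
      exact h (Subtype.ext ((hv.map φ h0).weight_unique hb hw))
    exact Module.finrank_zero_of_subsingleton

end WeylModule

/-! ### Characters -/

section Character

variable {l : ℕ} {g : Type*} [LieRing g] [LieAlgebra ℂ g] {H : LieSubalgebra ℂ g}
  (b : LieAlgebra.Basis (Fin l) H)
  (M : Type*) [AddCommGroup M] [Module ℂ M] [LieRingModule g M] [LieModule ℂ g M]
  {N : Type*} [AddCommGroup N] [Module ℂ N] [LieRingModule g N] [LieModule ℂ g N]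

/-- The formal character of a module. -/
def character : GroupRing l :=
  ∑ᶠ μ : Weight l, AddMonoidAlgebra.single μ (Module.finrank ℂ (weightSpace b M μ) : ℤ)

variable {b M}

theorem formalCharacter_eq_character (x : DominantWeight l) :
    formalCharacter b x = character b (WeylModule b x.1) := rfl

theorem coeff_character [FiniteDimensional ℂ M] (μ : Weight l) :
    (character b M).coeff μ = Module.finrank ℂ (weightSpace b M μ) := by
  have hfin := finite_weights (b := b) (M := M)
  have hsub : (Function.support fun μ : Weight l => (AddMonoidAlgebra.single μ
      (Module.finrank ℂ (weightSpace b M μ) : ℤ) : GroupRing l)) ⊆ hfin.toFinset := by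
    intro ν hν
    rw [Set.Finite.coe_toFinset, Set.mem_ofPred_eq]
    intro h
    refine hν ?_
    beta_reduce
    rw [h, finrank_bot, Nat.cast_zero, AddMonoidAlgebra.single_zero]
  rw [character, finsum_eq_sum_of_support_subset _ hsub, AddMonoidAlgebra.coeff_sum,
    Finsupp.finsetSum_apply]
  simp only [AddMonoidAlgebra.coeff_single, Finsupp.single_apply]
  rw [Finset.sum_ite_eq']
  split_ifs with h
  · rfl
  · have : weightSpace b M μ = ⊥ := by
      rwa [Set.Finite.mem_toFinset, Set.mem_ofPred_eq, not_not] at h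
    rw [this, finrank_bot, Nat.cast_zero]

theorem isWeylInvariant_character [FiniteDimensional ℂ M] (hb : b.A = CartanMatrix.A l) :
    IsWeylInvariant (character b M) :=
  IsWeylInvariant.of_coeff fun i μ => by
    rw [coeff_character, coeff_character, finrank_weightSpace_simpleReflection hb]

/-- A module that is the sum of its weight spaces has a basis of weight vectors. -/
theorem exists_weightBasis [FiniteDimensional ℂ M] (h : ⨆ μ, weightSpace b M μ = ⊤) :
    ∃ (κ : Type) (_ : Fintype κ) (B : Module.Basis κ ℂ M) (wt : κ → Weight l),
      ∀ k, B k ∈ weightSpace b M (wt k) := by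
  classical
  have hint := DirectSum.isInternal_submodule_of_iSupIndep_of_iSup_eq_top
    (iSupIndep_weightSpace b M) h
  let B := hint.collectedBasis fun μ => Module.finBasis ℂ (weightSpace b M μ)
  exact ⟨_, FiniteDimensional.fintypeBasisIndex B, B, Sigma.fst,
    fun k => hint.collectedBasis_mem _ k⟩

/-- This reduces the behaviour of characters under direct sums and tensor products to that of weight
bases. -/
theorem character_eq_sum {κ : Type*} [Fintype κ] (B : Module.Basis κ ℂ M) (wt : κ → Weight l)
    (hB : ∀ k, B k ∈ weightSpace b M (wt k)) :
    character b M = ∑ k, AddMonoidAlgebra.single (wt k) 1 := by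
  classical
  have : FiniteDimensional ℂ M := B.finiteDimensional_of_finite
  ext μ
  rw [coeff_character, AddMonoidAlgebra.coeff_sum, Finsupp.finsetSum_apply]
  simp only [AddMonoidAlgebra.coeff_single, Finsupp.single_apply, Finset.sum_boole]
  have hspan : weightSpace b M μ = Submodule.span ℂ (Set.range fun k : {k // wt k = μ} => B k) := by
    refine le_antisymm (fun m hm => ?_) (Submodule.span_le.mpr ?_)
    · rw [← B.sum_repr m]
      refine Submodule.sum_mem _ fun k _ => ?_
      by_cases hk : wt k = μ
      · exact Submodule.smul_mem _ _ (Submodule.subset_span ⟨⟨k, hk⟩, rfl⟩)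
      · have hrepr : B.repr m k = 0 := by
          obtain ⟨i, hi⟩ := Function.ne_iff.mp hk
          have h1 := congrArg (fun n => B.repr n k) (mem_weightSpace.mp hm i)
          have h2 : ⁅b.h i, m⁆ = ∑ j, (B.repr m j * wt j i) • B j := by
            conv_lhs => rw [← B.sum_repr m]
            rw [lie_sum]
            refine Finset.sum_congr rfl fun j _ => ?_
            rw [lie_smul, mem_weightSpace.mp (hB j) i, smul_smul]
          have h3 : B.repr ⁅b.h i, m⁆ k = B.repr m k * wt k i := by
            rw [h2, B.repr_sum_self]
          simp only [h3, map_smul, Finsupp.smul_apply, smul_eq_mul] at h1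
          by_contra h0
          rw [mul_comm] at h1
          exact hi (by exact_mod_cast mul_right_cancel₀ h0 h1)
        rw [hrepr, zero_smul]
        exact zero_mem _
    · rintro _ ⟨⟨k, rfl⟩, rfl⟩
      exact hB k
  have hli : LinearIndependent ℂ fun k : {k // wt k = μ} => B k :=
    B.linearIndependent.comp _ Subtype.val_injective
  rw [hspan, finrank_span_eq_card hli, Fintype.card_subtype]

theorem character_congr (e : M ≃ₗ⁅ℂ, g⁆ N) : character b M = character b N := by
  have h : ∀ μ, Module.finrank ℂ (weightSpace b M μ) = Module.finrank ℂ (weightSpace b N μ) := by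
    intro μ
    refine LinearEquiv.finrank_eq (LinearEquiv.ofSubmodules (e : M ≃ₗ[ℂ] N) _ _ ?_)
    ext n
    rw [Submodule.mem_map_equiv]
    constructor
    · intro hn
      have := map_mem_weightSpace e.toLieModuleHom (fun _ _ => LieModuleHom.map_lie _ _ _) hn
      rwa [show e.toLieModuleHom ((e : M ≃ₗ[ℂ] N).symm n) = n from e.apply_symm_apply n] at this
    · exact map_mem_weightSpace e.symm.toLieModuleHom (fun _ _ => LieModuleHom.map_lie _ _ _)
  simp only [character, h]

theorem character_eq_add {U U' : LieSubmodule ℂ g M} (hU : IsCompl U U')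
    [FiniteDimensional ℂ U] [FiniteDimensional ℂ U']
    (h : ⨆ μ, weightSpace b U μ = ⊤) (h' : ⨆ μ, weightSpace b U' μ = ⊤) :
    character b M = character b U + character b U' := by
  obtain ⟨κ, _, B, wt, hB⟩ := exists_weightBasis h
  obtain ⟨κ', _, B', wt', hB'⟩ := exists_weightBasis h'
  have hU' : IsCompl (U : Submodule ℂ M) (U' : Submodule ℂ M) :=
    LieSubmodule.isCompl_toSubmodule.mpr hU
  rw [character_eq_sum B wt hB, character_eq_sum B' wt' hB',
    character_eq_sum ((B.prod B').map (Submodule.prodEquivOfIsCompl _ _ hU')) (Sum.elim wt wt'),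
    Fintype.sum_sum_type]
  · rfl
  · rintro (k | k)
    · have := map_mem_weightSpace U.incl (fun _ _ => LieModuleHom.map_lie _ _ _) (hB k)
      convert this using 1
      · rfl
      rw [Module.Basis.map_apply, Submodule.coe_prodEquivOfIsCompl']
      simp
    · have := map_mem_weightSpace U'.incl (fun _ _ => LieModuleHom.map_lie _ _ _) (hB' k)
      convert this using 1
      · rfl
      rw [Module.Basis.map_apply, Submodule.coe_prodEquivOfIsCompl']
      simp

theorem character_tensor [FiniteDimensional ℂ M] [FiniteDimensional ℂ N]
    (h : ⨆ μ, weightSpace b M μ = ⊤) (h' : ⨆ μ, weightSpace b N μ = ⊤) :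
    character b (M ⊗[ℂ] N) = character b M * character b N := by
  obtain ⟨κ, _, B, wt, hB⟩ := exists_weightBasis h
  obtain ⟨κ', _, B', wt', hB'⟩ := exists_weightBasis h'
  rw [character_eq_sum B wt hB, character_eq_sum B' wt' hB',
    character_eq_sum (B.tensorProduct B') (fun k => wt k.1 + wt' k.2), Fintype.sum_mul_sum,
    Fintype.sum_prod_type]
  · simp only [AddMonoidAlgebra.single_mul_single, mul_one]
  · rintro ⟨k, k'⟩
    rw [Module.Basis.tensorProduct_apply]
    exact tmul_mem_weightSpace (hB k) (hB' k')

theorem isTriangular_formalCharacter [FiniteDimensional ℂ g] (hb : b.A = CartanMatrix.A l) :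
    IsTriangular (formalCharacter b) where
  invariant x := by
    have := finiteDimensional_weylModule hb x
    exact isWeylInvariant_character hb
  top x := by
    have := finiteDimensional_weylModule hb x
    rw [formalCharacter_eq_character, coeff_character, finrank_weightSpace_weylModule_self hb,
      Nat.cast_one]
  support x μ h := by
    have := finiteDimensional_weylModule hb x
    rw [formalCharacter_eq_character, coeff_character] at h
    refine rootLE_of_weightSpace_weylModule_ne_bot hb fun h0 => h ?_
    rw [h0, finrank_bot, Nat.cast_zero]

end Character

/-! ### Decomposition of unitary modules -/

section Hom

variable {g : Type*} [LieRing g] [LieAlgebra ℂ g]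
  {M : Type*} [AddCommGroup M] [Module ℂ M] [LieRingModule g M] [LieModule ℂ g M]
  {M' : Type*} [AddCommGroup M'] [Module ℂ M'] [LieRingModule g M'] [LieModule ℂ g M']
  {N : Type*} [AddCommGroup N] [Module ℂ N] [LieRingModule g N] [LieModule ℂ g N]

instance finiteDimensional_hom [FiniteDimensional ℂ M] [FiniteDimensional ℂ N] :
    FiniteDimensional ℂ (M →ₗ⁅ℂ, g⁆ N) := by
  let T : (M →ₗ⁅ℂ, g⁆ N) →ₗ[ℂ] M →ₗ[ℂ] N :=
    { toFun φ := φ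
      map_add' _ _ := rfl
      map_smul' _ _ := rfl }
  exact FiniteDimensional.of_injective T fun φ ψ h =>
    LieModuleHom.ext fun m => LinearMap.congr_fun h m

omit [LieAlgebra ℂ g] [LieModule ℂ g M] in
theorem exists_projections {U U' : LieSubmodule ℂ g M} (h : IsCompl U U') :
    ∃ (π : M →ₗ⁅ℂ, g⁆ U) (π' : M →ₗ⁅ℂ, g⁆ U'), (∀ u : U, π u = u ∧ π' u = 0) ∧
      (∀ u : U', π u = 0 ∧ π' u = u) ∧ ∀ m, (π m : M) + π' m = m := by
  obtain ⟨π, hπ, hπ0⟩ := exists_projection h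
  obtain ⟨π', hπ', hπ0'⟩ := exists_projection h.symm
  refine ⟨π, π', fun u => ⟨hπ u, (hπ0' u).mpr u.2⟩, fun u => ⟨(hπ0 u).mpr u.2, hπ' u⟩, fun m => ?_⟩
  have h1 : m - π m ∈ U' := by rw [← hπ0, map_sub, hπ, sub_self]
  have h2 : π' (m - π m) = ⟨_, h1⟩ := hπ' ⟨_, h1⟩
  rw [map_sub, (hπ0' _).mpr (π m).2, sub_zero] at h2
  rw [h2, add_sub_cancel]

omit [LieModule ℂ g N] in
theorem finrank_hom_eq_add_of_isCompl_right [FiniteDimensional ℂ M] [FiniteDimensional ℂ N]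
    {U U' : LieSubmodule ℂ g M} (h : IsCompl U U') :
    Module.finrank ℂ (N →ₗ⁅ℂ, g⁆ M) =
      Module.finrank ℂ (N →ₗ⁅ℂ, g⁆ U) + Module.finrank ℂ (N →ₗ⁅ℂ, g⁆ U') := by
  obtain ⟨π, π', hU, hU', hm⟩ := exists_projections h
  have : FiniteDimensional ℂ U := inferInstanceAs (FiniteDimensional ℂ U.toSubmodule)
  have : FiniteDimensional ℂ U' := inferInstanceAs (FiniteDimensional ℂ U'.toSubmodule)
  rw [← Module.finrank_prod]
  refine LinearEquiv.finrank_eq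
    { toFun φ := (π.comp φ, π'.comp φ)
      map_add' φ ψ := Prod.ext (LieModuleHom.ext fun n => map_add π _ _)
        (LieModuleHom.ext fun n => map_add π' _ _)
      map_smul' t φ := Prod.ext (LieModuleHom.ext fun n => map_smul π t _)
        (LieModuleHom.ext fun n => map_smul π' t _)
      invFun ψ := U.incl.comp ψ.1 + U'.incl.comp ψ.2
      left_inv φ := LieModuleHom.ext fun n => hm (φ n)
      right_inv ψ := Prod.ext (LieModuleHom.ext fun n => ?_) (LieModuleHom.ext fun n => ?_) }
  · change π ((ψ.1 n : M) + ψ.2 n) = ψ.1 n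
    rw [map_add, (hU _).1, (hU' _).1, add_zero]
  · change π' ((ψ.1 n : M) + ψ.2 n) = ψ.2 n
    rw [map_add, (hU _).2, (hU' _).2, zero_add]

omit [LieModule ℂ g M] in
theorem finrank_hom_eq_add_of_isCompl_left [FiniteDimensional ℂ M] [FiniteDimensional ℂ N]
    {U U' : LieSubmodule ℂ g M} (h : IsCompl U U') :
    Module.finrank ℂ (M →ₗ⁅ℂ, g⁆ N) =
      Module.finrank ℂ (U →ₗ⁅ℂ, g⁆ N) + Module.finrank ℂ (U' →ₗ⁅ℂ, g⁆ N) := by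
  obtain ⟨π, π', hU, hU', hm⟩ := exists_projections h
  have : FiniteDimensional ℂ U := inferInstanceAs (FiniteDimensional ℂ U.toSubmodule)
  have : FiniteDimensional ℂ U' := inferInstanceAs (FiniteDimensional ℂ U'.toSubmodule)
  rw [← Module.finrank_prod]
  refine LinearEquiv.finrank_eq
    { toFun φ := (φ.comp U.incl, φ.comp U'.incl)
      map_add' φ ψ := rfl
      map_smul' t φ := rfl
      invFun ψ := ψ.1.comp π + ψ.2.comp π'
      left_inv φ := LieModuleHom.ext fun m => ?_
      right_inv ψ := Prod.ext (LieModuleHom.ext fun u => ?_) (LieModuleHom.ext fun u => ?_) }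
  · change φ (π m : M) + φ (π' m : M) = φ m
    rw [← map_add, hm]
  · change ψ.1 (π u) + ψ.2 (π' u) = ψ.1 u
    rw [(hU u).1, (hU u).2, map_zero, add_zero]
  · change ψ.1 (π u) + ψ.2 (π' u) = ψ.2 u
    rw [(hU' u).1, (hU' u).2, map_zero, zero_add]

omit [LieModule ℂ g N] in
theorem finrank_hom_congr_right (e : M ≃ₗ⁅ℂ, g⁆ M') :
    Module.finrank ℂ (N →ₗ⁅ℂ, g⁆ M) = Module.finrank ℂ (N →ₗ⁅ℂ, g⁆ M') :=
  LinearEquiv.finrank_eq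
    { toFun φ := e.toLieModuleHom.comp φ
      map_add' _ _ := LieModuleHom.ext fun _ => map_add e.toLieModuleHom _ _
      map_smul' t _ := LieModuleHom.ext fun _ => map_smul e.toLieModuleHom t _
      invFun φ := e.symm.toLieModuleHom.comp φ
      left_inv φ := LieModuleHom.ext fun n => e.symm_apply_apply (φ n)
      right_inv φ := LieModuleHom.ext fun n => e.apply_symm_apply (φ n) }

omit [LieModule ℂ g M] [LieModule ℂ g M'] in
theorem finrank_hom_congr_left (e : M ≃ₗ⁅ℂ, g⁆ M') :
    Module.finrank ℂ (M →ₗ⁅ℂ, g⁆ N) = Module.finrank ℂ (M' →ₗ⁅ℂ, g⁆ N) :=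
  LinearEquiv.finrank_eq
    { toFun φ := φ.comp e.symm.toLieModuleHom
      map_add' _ _ := rfl
      map_smul' _ _ := rfl
      invFun φ := φ.comp e.toLieModuleHom
      left_inv φ := LieModuleHom.ext fun n => congrArg φ (e.symm_apply_apply n)
      right_inv φ := LieModuleHom.ext fun n => congrArg φ (e.apply_symm_apply n) }

end Hom

/-! ### Complete reducibility and multiplicities -/

section Decomposition

universe u

variable {l : ℕ} {g : Type*} [LieRing g] [LieAlgebra ℂ g] [FiniteDimensional ℂ g]
  {H : LieSubalgebra ℂ g} {b : LieAlgebra.Basis (Fin l) H} (hb : b.A = CartanMatrix.A l)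
include hb

/-- The character of a unitary module is the sum of the characters of the Weyl modules, with
multiplicities the dimensions of the spaces of homomorphisms. -/
theorem IsUnitary.exists_decomposition {M : Type u} [AddCommGroup M] [Module ℂ M]
    [LieRingModule g M] [LieModule ℂ g M] (hM : IsUnitary b M) :
    ∃ c : DominantWeight l →₀ ℤ, character b M = c.sum (fun x a => a • formalCharacter b x) ∧
      (∀ x, c x = Module.finrank ℂ (WeylModule b x.1 →ₗ⁅ℂ, g⁆ M)) ∧
      ∀ x, c x = Module.finrank ℂ (M →ₗ⁅ℂ, g⁆ WeylModule b x.1) := by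
  classical
  induction hn : Module.finrank ℂ M using Nat.strong_induction_on generalizing M with
  | _ n ih =>
  have hfd := hM.finiteDimensional
  rcases subsingleton_or_nontrivial M with hsub | hnon
  · refine ⟨0, ?_, fun x => ?_, fun x => ?_⟩
    · have h0 : ∀ μ, weightSpace b M μ = ⊥ := fun μ => Subsingleton.elim _ _
      rw [Finsupp.sum_zero_index, character]
      refine finsum_eq_zero_of_forall_eq_zero fun μ => ?_
      rw [h0, finrank_bot, Nat.cast_zero, AddMonoidAlgebra.single_zero]
    · have : Subsingleton (WeylModule b x.1 →ₗ⁅ℂ, g⁆ M) :=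
        ⟨fun φ ψ => LieModuleHom.ext fun m => Subsingleton.elim _ _⟩
      rw [Module.finrank_zero_of_subsingleton]
      rfl
    · have : Subsingleton (M →ₗ⁅ℂ, g⁆ WeylModule b x.1) :=
        ⟨fun φ ψ => LieModuleHom.ext fun m => by rw [Subsingleton.elim m 0, map_zero, map_zero]⟩
      rw [Module.finrank_zero_of_subsingleton]
      rfl
  · obtain ⟨y, v, hv⟩ := exists_isHighestWeightVector hM.iSup_weightSpace hb
    obtain ⟨e⟩ := hM.nonempty_weylModule_equiv hb hv
    set U := LieSubmodule.lieSpan ℂ g {v}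
    -- One Weyl module splits off, the complement has smaller dimension, and Schur's lemma shows
    -- that each count of homomorphisms grows by one exactly at `y`.
    obtain ⟨U', hU'⟩ := hM.exists_isCompl U
    have hu := hM.submodule U
    have hu' := hM.submodule U'
    have := hu.finiteDimensional
    have := hu'.finiteDimensional
    have := finiteDimensional_weylModule hb y
    have hlt : Module.finrank ℂ U' < n := by
      rw [← hn]
      refine Submodule.finrank_lt (s := U'.toSubmodule) fun htop => ?_
      have h1 := hU'.disjoint
      rw [(LieSubmodule.toSubmodule_eq_top (N := U')).mp htop, disjoint_top] at h1
      have h2 : v ∈ U := LieSubmodule.subset_lieSpan (Set.mem_singleton v)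
      rw [h1, LieSubmodule.mem_bot] at h2
      exact hv.ne_zero h2
    obtain ⟨c, hc, hc1, hc2⟩ := ih _ hlt hu' rfl
    refine ⟨c + Finsupp.single y 1, ?_, fun x => ?_, fun x => ?_⟩
    · rw [character_eq_add hU' hu.iSup_weightSpace hu'.iSup_weightSpace, ← character_congr e, hc,
        Finsupp.sum_add_index' (by simp) (by simp [add_smul]), Finsupp.sum_single_index (by simp),
        one_smul, add_comm]
      rfl
    · have := finiteDimensional_weylModule hb x
      rw [finrank_hom_eq_add_of_isCompl_right hU', ← finrank_hom_congr_right e,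
        finrank_weylModule_hom hb, Finsupp.add_apply, hc1, Finsupp.single_apply]
      push_cast
      rw [add_comm]
      congr 1
      exact if_congr eq_comm rfl rfl
    · have := finiteDimensional_weylModule hb x
      rw [finrank_hom_eq_add_of_isCompl_left hU', ← finrank_hom_congr_left e,
        finrank_weylModule_hom hb, Finsupp.add_apply, hc2, Finsupp.single_apply]
      push_cast
      rw [add_comm]

theorem formalCharacter_mul (μ ν : DominantWeight l) : formalCharacter b μ * formalCharacter b ν =
    character b (WeylModule b μ.1 ⊗[ℂ] WeylModule b ν.1) := by
  have hμ := isUnitary_weylModule hb μ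
  have hν := isUnitary_weylModule hb ν
  have := hμ.finiteDimensional
  have := hν.finiteDimensional
  exact (character_tensor hμ.iSup_weightSpace hν.iSup_weightSpace).symm

/-- The structure constants of the characters are the Littlewood–Richardson coefficients, which
are also the dimensions of the spaces of homomorphisms in the other direction. -/
theorem structConst_formalCharacter (x μ ν : DominantWeight l) :
    structConst (formalCharacter b) μ ν x = littlewoodRichardson b μ ν x ∧
      structConst (formalCharacter b) μ ν x = Module.finrank ℂ
        (WeylModule b μ.1 ⊗[ℂ] WeylModule b ν.1 →ₗ⁅ℂ, g⁆ WeylModule b x.1) := by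
  obtain ⟨c, hc, hc1, hc2⟩ :=
    ((isUnitary_weylModule hb μ).tensor (isUnitary_weylModule hb ν)).exists_decomposition hb
  rw [← formalCharacter_mul hb] at hc
  rw [(isTriangular_formalCharacter hb).structConst_eq hc]
  exact ⟨hc1 x, hc2 x⟩

end Decomposition

/-! ### Duality -/

theorem DominantWeight.dual_dual {l : ℕ} (ν : DominantWeight l) : ν.dual.dual = ν := by
  refine Subtype.ext (funext fun i => ?_)
  simp [DominantWeight.dual, longest_apply]

section Dual

variable {l : ℕ} {g : Type*} [LieRing g] [LieAlgebra ℂ g] {H : LieSubalgebra ℂ g}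
  {b : LieAlgebra.Basis (Fin l) H}
  {M : Type*} [AddCommGroup M] [Module ℂ M] [LieRingModule g M] [LieModule ℂ g M]
  {N : Type*} [AddCommGroup N] [Module ℂ N] [LieRingModule g N] [LieModule ℂ g N]

theorem dualBasis_mem_weightSpace {κ : Type*} [Finite κ] [DecidableEq κ] (B : Module.Basis κ ℂ M)
    {wt : κ → Weight l} (hB : ∀ k, B k ∈ weightSpace b M (wt k)) (k : κ) :
    B.dualBasis k ∈ weightSpace b (M →ₗ[ℂ] ℂ) (-wt k) := by
  refine mem_weightSpace.mpr fun i => B.ext fun j => ?_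
  rw [Module.Dual.lie_apply, mem_weightSpace.mp (hB j), map_smul, LinearMap.smul_apply,
    Module.Basis.dualBasis_apply_self]
  rcases eq_or_ne j k with rfl | h
  · simp
  · simp [h]

theorem iSup_weightSpace_dual [FiniteDimensional ℂ M] (h : ⨆ μ, weightSpace b M μ = ⊤) :
    ⨆ μ, weightSpace b (M →ₗ[ℂ] ℂ) μ = ⊤ := by
  classical
  obtain ⟨κ, _, B, wt, hB⟩ := exists_weightBasis h
  rw [eq_top_iff, ← B.dualBasis.span_eq, Submodule.span_le]
  rintro _ ⟨k, rfl⟩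
  exact Submodule.mem_iSup_of_mem _ (dualBasis_mem_weightSpace B hB k)

theorem neg_weight_of_weightSpace_dual_ne_bot (h : ⨆ μ, weightSpace b M μ = ⊤) {μ : Weight l}
    (hμ : weightSpace b (M →ₗ[ℂ] ℂ) μ ≠ ⊥) : weightSpace b M (-μ) ≠ ⊥ := by
  obtain ⟨ξ, hξ, hξ0⟩ := Submodule.exists_mem_ne_zero_of_ne_bot hμ
  intro hbot
  refine hξ0 (LinearMap.ext fun m => ?_)
  have hm : m ∈ ⨆ ν, weightSpace b M ν := by rw [h]; trivial
  induction hm using Submodule.iSup_induction' with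
  | mem ν m hm =>
    by_cases hν : ν = -μ
    · rw [hν, hbot, Submodule.mem_bot] at hm
      rw [hm, map_zero, map_zero]
    · obtain ⟨i, hi⟩ := Function.ne_iff.mp hν
      have h1 := LinearMap.congr_fun (mem_weightSpace.mp hξ i) m
      rw [Module.Dual.lie_apply, mem_weightSpace.mp hm i, map_smul, LinearMap.smul_apply,
        smul_eq_mul, smul_eq_mul, neg_eq_iff_add_eq_zero, ← add_mul, mul_eq_zero] at h1
      refine h1.resolve_left fun h2 => hi ?_
      rw [Pi.neg_apply, eq_neg_iff_add_eq_zero]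
      exact_mod_cast h2
  | zero => rw [map_zero, map_zero]
  | add m m' _ _ h h' => rw [map_add, h, h', LinearMap.zero_apply, LinearMap.zero_apply,
      LinearMap.zero_apply, add_zero]

/-- A weight of `M` is a weight of its double dual through evaluation, so the preceding lemma
applies to the dual. -/
theorem weightSpace_dual_neg_ne_bot [FiniteDimensional ℂ M] (h : ⨆ μ, weightSpace b M μ = ⊤)
    {μ : Weight l} (hμ : weightSpace b M μ ≠ ⊥) : weightSpace b (M →ₗ[ℂ] ℂ) (-μ) ≠ ⊥ := by
  have hd := iSup_weightSpace_dual (iSup_weightSpace_dual h)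
  have hev : ∀ x (m : M), Module.Dual.eval ℂ M ⁅x, m⁆ = ⁅(x : g), Module.Dual.eval ℂ M m⁆ := by
    intro x m
    ext ξ
    simp
  obtain ⟨m, hm, hm0⟩ := Submodule.exists_mem_ne_zero_of_ne_bot hμ
  refine neg_weight_of_weightSpace_dual_ne_bot (iSup_weightSpace_dual h)
    (weightSpace_ne_bot_of_mem (map_mem_weightSpace (Module.Dual.eval ℂ M) hev hm) fun h0 => hm0 ?_)
  exact (Module.eval_apply_eq_zero_iff ℂ m).mp h0

/-- The common kernel of a submodule `U` of the dual is a submodule of `M`, hence zero or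
everything, and by finite dimensional duality it determines `U`. -/
theorem isIrreducible_dual [FiniteDimensional ℂ M] [LieModule.IsIrreducible ℂ g M] :
    LieModule.IsIrreducible ℂ g (M →ₗ[ℂ] ℂ) := by
  have : Nontrivial M := LieSubmodule.nontrivial_iff ℂ g M |>.mp inferInstance
  have : Nontrivial (M →ₗ[ℂ] ℂ) := inferInstanceAs (Nontrivial (Module.Dual ℂ M))
  refine LieModule.IsIrreducible.mk fun U hU => ?_
  let W : LieSubmodule ℂ g M :=
    { Submodule.dualCoannihilator (U : Submodule ℂ (Module.Dual ℂ M)) with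
      lie_mem := by
        intro x m hm
        rw [AddSubsemigroup.mem_carrier, AddSubmonoid.mem_toSubsemigroup,
          Submodule.mem_toAddSubmonoid, Submodule.mem_dualCoannihilator] at hm ⊢
        intro ξ hξ
        have := hm _ (U.lie_mem (x := x) hξ)
        rwa [Module.Dual.lie_apply, neg_eq_zero] at this }
  have hW : ∀ m, m ∈ W ↔ ∀ ξ ∈ U, ξ m = 0 := fun m => Submodule.mem_dualCoannihilator m
  rcases eq_bot_or_eq_top W with h | h
  · have h1 : Submodule.dualCoannihilator (U : Submodule ℂ (Module.Dual ℂ M)) = ⊥ :=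
      congrArg LieSubmodule.toSubmodule h
    rw [← LieSubmodule.toSubmodule_eq_top]
    have h2 := Subspace.dualCoannihilator_dualAnnihilator_eq
      (W := (U : Submodule ℂ (Module.Dual ℂ M)))
    rw [← h2, h1, Submodule.dualAnnihilator_bot]
  · refine absurd ?_ hU
    rw [LieSubmodule.eq_bot_iff]
    intro ξ hξ
    ext m
    have : m ∈ W := by rw [h]; trivial
    exact (hW m).mp this ξ hξ

/-- A linear equivalence of tensor products is a homomorphism of modules if it is equivariant on
pure tensors. -/
def tensorEquivOfTmul {M N P : Type*} [AddCommGroup M] [Module ℂ M] [LieRingModule g M]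
    [LieModule ℂ g M] [AddCommGroup N] [Module ℂ N] [LieRingModule g N] [LieModule ℂ g N]
    [AddCommGroup P] [Module ℂ P] [LieRingModule g P] [LieModule ℂ g P]
    (e : M ⊗[ℂ] N ≃ₗ[ℂ] P)
    (he : ∀ (x : g) m n, e (⁅x, m⁆ ⊗ₜ n) + e (m ⊗ₜ ⁅x, n⁆) = ⁅x, e (m ⊗ₜ n)⁆) :
    M ⊗[ℂ] N ≃ₗ⁅ℂ, g⁆ P where
  __ := e
  map_lie' := by
    intro x t
    change e ⁅x, t⁆ = ⁅x, e t⁆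
    induction t using TensorProduct.induction_on with
    | zero => simp
    | tmul m n => rw [TensorProduct.LieModule.lie_tmul_right, map_add, he]
    | add t t' h h' => rw [lie_add, map_add, map_add, h, h', lie_add]

/-- `N ⊗ M* ≃ Hom(M, N)`. -/
def tensorDualEquiv (g : Type*) [LieRing g] [LieAlgebra ℂ g]
    (M N : Type*) [AddCommGroup M] [Module ℂ M] [LieRingModule g M] [LieModule ℂ g M]
    [AddCommGroup N] [Module ℂ N] [LieRingModule g N] [LieModule ℂ g N] [FiniteDimensional ℂ M] :
    N ⊗[ℂ] (M →ₗ[ℂ] ℂ) ≃ₗ⁅ℂ, g⁆ (M →ₗ[ℂ] N) :=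
  tensorEquivOfTmul ((TensorProduct.comm ℂ N (Module.Dual ℂ M)).trans
      (dualTensorHomEquiv ℂ M N)) (by
    intro x n ξ
    ext m
    simp [dualTensorHom_apply, sub_eq_add_neg])

/-- `Hom(M ⊗ N, P) = Hom(M, Hom(N, P)) = Hom(M, P ⊗ N*)`. -/
theorem finrank_tensor_hom [FiniteDimensional ℂ N] {P : Type*} [AddCommGroup P] [Module ℂ P]
    [LieRingModule g P] [LieModule ℂ g P] {N' : Type*} [AddCommGroup N'] [Module ℂ N']
    [LieRingModule g N'] [LieModule ℂ g N'] (e : N' ≃ₗ⁅ℂ, g⁆ (N →ₗ[ℂ] ℂ)) :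
    Module.finrank ℂ (M ⊗[ℂ] N →ₗ⁅ℂ, g⁆ P) = Module.finrank ℂ (M →ₗ⁅ℂ, g⁆ P ⊗[ℂ] N') := by
  have e' : P ⊗[ℂ] N' ≃ₗ⁅ℂ, g⁆ P ⊗[ℂ] (N →ₗ[ℂ] ℂ) :=
    tensorEquivOfTmul (TensorProduct.congr (LinearEquiv.refl ℂ P) (e : N' ≃ₗ[ℂ] (N →ₗ[ℂ] ℂ)))
      (by
        intro x p n
        have : (e : N' ≃ₗ[ℂ] (N →ₗ[ℂ] ℂ)) ⁅x, n⁆ = ⁅x, (e : N' ≃ₗ[ℂ] (N →ₗ[ℂ] ℂ)) n⁆ :=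
          LieModuleHom.map_lie e.toLieModuleHom x n
        rw [TensorProduct.congr_tmul, TensorProduct.congr_tmul, TensorProduct.congr_tmul, this,
          TensorProduct.LieModule.lie_tmul_right]
        rfl)
  rw [finrank_hom_congr_right e', finrank_hom_congr_right (tensorDualEquiv g N P)]
  exact (TensorProduct.LieModule.liftLie ℂ g M N P).finrank_eq.symm

variable [FiniteDimensional ℂ g] (hb : b.A = CartanMatrix.A l)
include hb

/-- The dual is irreducible, so only its highest weight `κ` is to be found. Since `-κ` is a weight
of `V(ν)`, applying `w₀` gives `-w₀ κ ≤ ν`; since `-ν` is a weight of the dual, `-w₀ ν ≤ κ`. The map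
`-w₀` preserves the order, so both inequalities are equalities. -/
theorem nonempty_dual_equiv (ν : DominantWeight l) :
    Nonempty (WeylModule b ν.dual.1 ≃ₗ⁅ℂ, g⁆ (WeylModule b ν.1 →ₗ[ℂ] ℂ)) := by
  have hu := isUnitary_weylModule hb ν
  have := hu.finiteDimensional
  have := isIrreducible_weylModule hb ν
  have := isIrreducible_dual (g := g) (M := WeylModule b ν.1)
  have : FiniteDimensional ℂ (WeylModule b ν.1 →ₗ[ℂ] ℂ) :=
    inferInstanceAs (FiniteDimensional ℂ (Module.Dual ℂ (WeylModule b ν.1)))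
  have : Nontrivial (WeylModule b ν.1 →ₗ[ℂ] ℂ) :=
    LieSubmodule.nontrivial_iff ℂ g _ |>.mp inferInstance
  obtain ⟨κ, ξ, hξ⟩ := exists_isHighestWeightVector (iSup_weightSpace_dual hu.iSup_weightSpace) hb
  obtain ⟨v, hv, -⟩ := exists_weylModule_vector hb ν
  have hw0 : ∀ (M : Type _) [AddCommGroup M] [Module ℂ M] [LieRingModule g M] [LieModule ℂ g M]
      [FiniteDimensional ℂ M] (μ : Weight l), weightSpace b M μ ≠ ⊥ →
      weightSpace b M (longest l μ) ≠ ⊥ := by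
    intro M _ _ _ _ _ μ h
    rw [← Submodule.nontrivial_iff_ne_bot, ← Module.finrank_pos_iff (R := ℂ)] at h ⊢
    rwa [finrank_weightSpace_weylGroup hb (longest_mem_weylGroup l)]
  have h1 : RootLE κ.dual.1 ν.1 := by
    refine rootLE_of_weightSpace_weylModule_ne_bot hb ?_
    have := hw0 _ _ (neg_weight_of_weightSpace_dual_ne_bot hu.iSup_weightSpace
      (weightSpace_ne_bot_of_mem hξ.mem_weightSpace hξ.ne_zero))
    rwa [map_neg] at this
  have h2 : RootLE ν.dual.1 κ.1 := by
    refine rootLE_of_weightSpace_ne_bot hb hξ.mem_weightSpace hξ.lie_e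
      (lieSpan_eq_top_of_ne_zero hξ.ne_zero) ?_
    have := hw0 _ _ (weightSpace_dual_neg_ne_bot hu.iSup_weightSpace
      (weightSpace_ne_bot_of_mem hv.mem_weightSpace hv.ne_zero))
    rwa [map_neg] at this
  have h3 : RootLE κ.1 ν.dual.1 := by
    have := h1.longest.neg
    rwa [← DominantWeight.dual_dual κ]
  have h4 : κ = ν.dual := Subtype.ext (h3.antisymm h2)
  rw [h4] at hξ
  exact nonempty_weylModule_equiv hb hξ

/-- One side counts homomorphisms out of `V(μ) ⊗ V(ν)` into `V(x)`, the other those from `V(μ)` into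
`V(x) ⊗ V(ν)*`; complete reducibility makes both counts of homomorphisms equal to multiplicities. -/
theorem hasSymmetricStructConst_formalCharacter :
    HasSymmetricStructConst (formalCharacter b) := by
  intro x μ ν
  have := finiteDimensional_weylModule hb ν
  obtain ⟨e⟩ := nonempty_dual_equiv hb ν
  rw [(structConst_formalCharacter hb x μ ν).2, (structConst_formalCharacter hb μ x ν.dual).1,
    finrank_tensor_hom e]
  rfl

end Dual

end TypeA

end

/-! ### Uniqueness applied to the characters of Weyl modules -/

theorem theorem1 {l : ℕ} {g : Type*} [LieRing g] [LieAlgebra ℂ g] [FiniteDimensional ℂ g]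
    [LieAlgebra.IsSimple ℂ g] {H : LieSubalgebra ℂ g} (b : LieAlgebra.Basis (Fin l) H)
    (hb : b.A = CartanMatrix.A l)
    (f : TypeA.DominantWeight l → TypeA.GroupRing l)
    (f_invariant : ∀ x, TypeA.IsWeylInvariant (f x))
    (f_top : ∀ x, (f x).coeff x.1 = 1)
    (f_support : ∀ x, ∀ μ ∉ TypeA.saturatedWeights x, (f x).coeff μ = 0)
    (cond_one : ∀ (x μ : TypeA.DominantWeight l) (k : Fin l → ℤ),
      x.1 - μ.1 = ∑ i, k i • TypeA.simpleRoot i → (Function.support k).ncard < l →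
        TypeA.weightMult b x μ.1 = (f x).coeff μ.1)
    (cond_two : ∀ x μ ν : TypeA.DominantWeight l,
      TypeA.structConst f μ ν x = TypeA.structConst f x ν.dual μ) :
    (∀ x, f x = TypeA.formalCharacter b x) ∧
      ∀ x μ ν, TypeA.structConst f μ ν x = TypeA.littlewoodRichardson b μ ν x := by
  have hφ := TypeA.isTriangular_formalCharacter hb
  have hf : TypeA.IsTriangular f :=
    ⟨f_invariant, f_top, fun x μ h => TypeA.rootLE_of_mem_saturatedWeights hb
      (by_contra fun h' => h (f_support x μ h'))⟩
  have hagree : TypeA.AgreeOnProperSupport f (TypeA.formalCharacter b) := by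
    intro x μ k hk hl
    have := TypeA.finiteDimensional_weylModule hb x
    rw [← cond_one x μ k hk hl, TypeA.formalCharacter_eq_character, TypeA.coeff_character]
    rfl
  have h : f = TypeA.formalCharacter b :=
    hagree.eq hf hφ cond_two (TypeA.hasSymmetricStructConst_formalCharacter hb)
  exact ⟨fun x => congrFun h x, fun x μ ν => h ▸ (TypeA.structConst_formalCharacter hb x μ ν).1⟩
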